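/- Let $\Gamma$ be a (finite-dimensional, real, Hausdorff, second countable) Lie group with Lie algebra $\mathfrak g$, let $\Gamma_0\subset\Gamma$ be a closed subgroup with Lie algebra $\mathfrak g_0$, and let the homogeneous space $\Gamma/\Gamma_0$ carry its standard smooth structure, for which the projection $\Gamma\to\Gamma/\Gamma_0$ is a submersion. Let $M=T^*(\Gamma/\Gamma_0)$ carry the standard symplectic form $d\theta=dp\wedge dq$, where $\theta=p\,dq$ is the tautological one-form, and the cotangent lift of the left action of $\Gamma$ on $\Gamma/\Gamma_0$, with momentum map $\Phi:M\to\mathfrak g^*$, $\Phi(q,p)(X)=p\left(\left.\frac{d}{dt}\right|_{t=0}\exp(tX)q\right)$ for $X\in\mathfrak g$. For $\gamma\in\Gamma$, $\beta\in\mathfrak g^*$ put $\mathrm{Ad}^*_\gamma\beta=\beta\circ\mathrm{Ad}_\gamma$. Fix $\beta_0\in\mathfrak g^*$; let $\Gamma_{\beta_0}=\{\gamma\in\Gamma:\mathrm{Ad}^*_\gamma\beta_0=\beta_0\}$ and let $\mathcal O_{\beta_0}=\mathrm{Ad}^*_\Gamma\beta_0$ be the coadjoint orbit, with its smooth structure as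 the homogeneous space $\Gamma_{\beta_0}\backslash\Gamma$ and with the Kirillov form, whose value at $\beta\in\mathcal O_{\beta_0}$ on the vectors $\left.\frac{d}{dt}\right|_{t=0}\mathrm{Ad}^*_{\exp(tX)}\beta$ and $\left.\frac{d}{dt}\right|_{t=0}\mathrm{Ad}^*_{\exp(tY)}\beta$ is $\beta([X,Y])$, $X,Y\in\mathfrak g$. Let $\mathrm{Ann}\,\mathfrak g_0=\{\beta\in\mathfrak g^*:\beta|_{\mathfrak g_0}=0\}$ and $\mathcal O'_{\beta_0}=\mathcal O_{\beta_0}\cap\mathrm{Ann}\,\mathfrak g_0$, with the subspace topology of $\mathcal O_{\beta_0}$; it is invariant under $\mathrm{Ad}^*_{\Gamma_0}$. Suppose that $\mathcal O_{\beta_0}$ is transversal to $\mathrm{Ann}\,\mathfrak g_0$, that is, $T_\beta\mathcal O_{\beta_0}+\mathrm{Ann}\,\mathfrak g_0=\mathfrak g^*$ for every $\beta\in\mathcal O'_{\beta_0}$, and that the $\mathrm{Ad}^*_{\Gamma_0}$-action on $\mathcal O'_{\beta_0}$ is free and proper (preimages of compact sets under $\Gamma_0\times\mathcal O'_{\beta_0}\to\mathcal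 O'_{\beta_0}\times\mathcal O'_{\beta_0}$, $(\gamma,\beta)\mapsto(\mathrm{Ad}^*_\gamma\beta,\beta)$, are compact). Then: 1. $\mathcal O'_{\beta_0}$ is an embedded submanifold of $\mathcal O_{\beta_0}$; the orbit space $\widetilde{\mathcal O}_{\beta_0}=\mathcal O'_{\beta_0}/\mathrm{Ad}^*_{\Gamma_0}$ with the quotient topology is a (Hausdorff, second countable) smooth manifold such that $\pi:\mathcal O'_{\beta_0}\to\widetilde{\mathcal O}_{\beta_0}$ is a submersion; and there is a symplectic form $\widetilde\omega$ on $\widetilde{\mathcal O}_{\beta_0}$ whose pullback by $\pi$ is the restriction of the Kirillov form to $\mathcal O'_{\beta_0}$. 2. $M_{\beta_0}=\Phi^{-1}(\beta_0)$ is an embedded submanifold of $M$; the reduced space $\widetilde M_{\beta_0}=\Gamma_{\beta_0}\backslash M_{\beta_0}$ with the quotient topology is a (Hausdorff, second countable) smooth manifold such that $M_{\beta_0}\to\widetilde M_{\beta_0}$ is a submersion; and there is a symplectic form $\widehat\omega$ on $\widetilde M_{\beta_0}$ whose pullback to $M_{\beta_0}$ is the restriction of $d\theta$. 3. There is a diffeomorphism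 $\varphi:\widetilde M_{\beta_0}\to\widetilde{\mathcal O}_{\beta_0}$ with $\varphi^*\widetilde\omega=\widehat\omega$; that is, $(\widetilde M_{\beta_0},\widehat\omega)$ is symplectomorphic to $(\widetilde{\mathcal O}_{\beta_0},\widetilde\omega)$. (All these smooth structures and forms are uniquely determined by the stated properties; the manifolds may be empty.) -/

import Mathlib

open scoped Manifold ContDiff

noncomputable section

namespace CoadjointReduction

/-! ### Differential forms on manifolds without boundary -/

section Forms

variable {E : Type*} [NormedAddCommGroup E] [NormedSpace ℝ E]
  {H : Type*} [TopologicalSpace H] (I : ModelWithCorners ℝ E H)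
  {M : Type*} [TopologicalSpace M] [ChartedSpace H M]
  {E' : Type*} [NormedAddCommGroup E'] [NormedSpace ℝ E']
  {H' : Type*} [TopologicalSpace H'] (I' : ModelWithCorners ℝ E' H')
  {M' : Type*} [TopologicalSpace M'] [ChartedSpace H' M']
  {k : ℕ}

/-- Real differential `k`-forms on `M` (no regularity imposed). -/
abbrev DiffForm (M : Type*) [TopologicalSpace M] [ChartedSpace H M] (k : ℕ) : Type _ :=
  ∀ x : M, TangentSpace I x [⋀^Fin k]→L[ℝ] ℝ

/-- The pullback `f^* σ`. -/
def pullback (f : M → M') (σ : DiffForm I' M' k) : DiffForm I M k := fun x =>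
  (σ (f x)).compContinuousLinearMap (mfderiv I I' f x)

/-- The coordinate expression of `σ` in the preferred chart at `x₀`: the pullback of `σ` along
the inverse of that chart. It is meaningful on the target of the chart. -/
def formInChart (σ : DiffForm I M k) (x₀ : M) : E → E [⋀^Fin k]→L[ℝ] ℝ :=
  pullback 𝓘(ℝ, E) I (extChartAt I x₀).symm σ

/-- Smoothness of a form: all its coordinate expressions are smooth. -/
def IsSmoothForm (σ : DiffForm I M k) : Prop :=
  ∀ x₀ : M, ContDiffOn ℝ ∞ (formInChart I σ x₀) (extChartAt I x₀).target

/-- The exterior derivative: `dσ` at `x` is computed in the chart at `x` and pulled back. -/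
def formDeriv (σ : DiffForm I M k) : DiffForm I M (k + 1) := fun x =>
  pullback I 𝓘(ℝ, E) (extChartAt I x) (extDeriv (formInChart I σ x)) x

/-- A symplectic form: a smooth, closed, nondegenerate `2`-form. -/
structure IsSymplecticForm (σ : DiffForm I M 2) : Prop where
  smooth : IsSmoothForm I σ
  closed : ∀ x, formDeriv I σ x = 0
  nondegenerate : ∀ (x : M) (u : TangentSpace I x), (∀ v, σ x ![u, v] = 0) → u = 0

end Forms

/-! ### The cotangent bundle -/

section Cotangent

variable (F : Type*) [NormedAddCommGroup F] [NormedSpace ℝ F]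
  (Q : Type*) [TopologicalSpace Q] [ChartedSpace F Q] [IsManifold 𝓘(ℝ, F) ∞ Q]

/-- The cotangent bundle `T^*Q`. -/
abbrev Cotangent : Type _ :=
  Bundle.TotalSpace (F →L[ℝ] ℝ) (fun q : Q => TangentSpace 𝓘(ℝ, F) q →L[ℝ] ℝ)

/-- The tautological one-form `θ = p dq`: `θ_{(q,p)}(v) = p (dπ v)`. -/
def tautologicalForm : DiffForm (𝓘(ℝ, F).prod 𝓘(ℝ, F →L[ℝ] ℝ)) (Cotangent F Q) 1 := fun x =>
  ContinuousAlternatingMap.ofSubsingleton ℝ _ _ (0 : Fin 1)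
    (x.2 ∘L mfderiv (𝓘(ℝ, F).prod 𝓘(ℝ, F →L[ℝ] ℝ)) 𝓘(ℝ, F)
      (fun y : Cotangent F Q => y.proj) x)

/-- The standard symplectic form `dθ = dp ∧ dq`. -/
def canonicalForm : DiffForm (𝓘(ℝ, F).prod 𝓘(ℝ, F →L[ℝ] ℝ)) (Cotangent F Q) 2 :=
  formDeriv _ (tautologicalForm F Q)

end Cotangent

/-! ### The coadjoint representation, coadjoint orbits and `O'` -/

section Coadjoint

variable {E : Type*} [NormedAddCommGroup E] [NormedSpace ℝ E]
  {Γ : Type*} [TopologicalSpace Γ] [ChartedSpace E Γ] [Group Γ]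

variable (E Γ) in
/-- The dual `𝔤^*` of the Lie algebra `𝔤 = T_1 Γ`. -/
abbrev LieDual : Type _ := GroupLieAlgebra 𝓘(ℝ, E) Γ →L[ℝ] ℝ

variable (E) in
/-- The adjoint representation: `Ad γ` is the differential at `1` of `h ↦ γ h γ⁻¹`. -/
def Ad (γ : Γ) : GroupLieAlgebra 𝓘(ℝ, E) Γ →L[ℝ] GroupLieAlgebra 𝓘(ℝ, E) Γ :=
  (mfderiv 𝓘(ℝ, E) 𝓘(ℝ, E) (fun h : Γ => γ * h * γ⁻¹) 1 :)

/-- The coadjoint action `Ad^*_γ β = β ∘ Ad_γ`; it is a right action. -/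
def coAd (γ : Γ) (β : LieDual E Γ) : LieDual E Γ := β ∘L Ad E γ

/-- The Lie algebra of a (closed) subgroup `Γ₀`, as a subset of `𝔤`: the velocities at `1` of
smooth curves in `Γ₀`. -/
def lieAlgebraOf (Γ₀ : Subgroup Γ) : Set (GroupLieAlgebra 𝓘(ℝ, E) Γ) :=
  {X | ∃ c : ℝ → Γ, c 0 = 1 ∧ (∀ t, c t ∈ Γ₀) ∧ ContMDiffAt 𝓘(ℝ, ℝ) 𝓘(ℝ, E) ∞ c 0 ∧
    (mfderiv 𝓘(ℝ, ℝ) 𝓘(ℝ, E) c 0 (1 : ℝ) :) = X}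

/-- The annihilator in `𝔤^*` of the Lie algebra of `Γ₀`. -/
def Ann (Γ₀ : Subgroup Γ) : Set (LieDual E Γ) := {β | ∀ X ∈ lieAlgebraOf Γ₀, β X = 0}

/-- The tangent space at `β` of the coadjoint orbit of `β`, as a subset of `𝔤^*`: the velocities
`d/dt Ad^*_{c(t)} β` at `t = 0`, with `c(0) = 1` and `c'(0) = X`, for `X ∈ 𝔤`. -/
def orbitTangent (β : LieDual E Γ) : Set (LieDual E Γ) :=
  {α | ∃ X : GroupLieAlgebra 𝓘(ℝ, E) Γ, ∀ Z : GroupLieAlgebra 𝓘(ℝ, E) Γ,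
    α Z = (mfderiv 𝓘(ℝ, E) 𝓘(ℝ, ℝ) (fun γ : Γ => coAd γ β Z) 1 X :)}

/-- The coadjoint orbit of `β₀`. As a space it is the homogeneous space `Γ_{β₀} \ Γ`: its
topology is the quotient topology of the orbit map (in general finer than that of `𝔤^*`). -/
def Orbit (β₀ : LieDual E Γ) : Type _ := {β : LieDual E Γ // ∃ γ : Γ, coAd γ β₀ = β}

/-- The orbit map `γ ↦ Ad^*_γ β₀`. -/
def orbitMap (β₀ : LieDual E Γ) (γ : Γ) : Orbit β₀ := ⟨coAd γ β₀, γ, rfl⟩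

instance (β₀ : LieDual E Γ) : TopologicalSpace (Orbit β₀) :=
  TopologicalSpace.coinduced (orbitMap β₀) inferInstance

/-- Transversality of the coadjoint orbit of `β₀` and `Ann 𝔤₀`: at each common point `β`,
`T_β O + Ann 𝔤₀ = 𝔤^*`. -/
def IsTransversal (Γ₀ : Subgroup Γ) (β₀ : LieDual E Γ) : Prop :=
  ∀ b : Orbit β₀, b.1 ∈ Ann Γ₀ →
    ∀ α : LieDual E Γ, ∃ α₁ ∈ orbitTangent b.1, ∃ α₂ ∈ Ann Γ₀, α = α₁ + α₂

/-- `O'`: the points of the coadjoint orbit that vanish on `𝔤₀`, a subspace of the orbit. -/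
abbrev Orbit' (Γ₀ : Subgroup Γ) (β₀ : LieDual E Γ) : Type _ := {b : Orbit β₀ // b.1 ∈ Ann Γ₀}

variable [LieGroup 𝓘(ℝ, E) ∞ Γ]

theorem contMDiff_conj (γ : Γ) :
    ContMDiff 𝓘(ℝ, E) 𝓘(ℝ, E) ∞ (fun h : Γ => γ * h * γ⁻¹) :=
  (contMDiff_const.mul contMDiff_id).mul contMDiff_const

theorem Ad_mul (γ δ : Γ) : Ad E (γ * δ) = Ad E γ ∘L Ad E δ := by
  have h : (fun h : Γ => γ * δ * h * (γ * δ)⁻¹) =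
      (fun h : Γ => γ * h * γ⁻¹) ∘ (fun h : Γ => δ * h * δ⁻¹) := by
    funext x; simp [mul_assoc]
  have h1 : δ * 1 * δ⁻¹ = 1 := by simp
  have := mfderiv_comp (I := 𝓘(ℝ, E)) (I' := 𝓘(ℝ, E)) (I'' := 𝓘(ℝ, E)) (1 : Γ)
    ((contMDiff_conj (E := E) γ).mdifferentiableAt (by simp))
    ((contMDiff_conj (E := E) δ).mdifferentiableAt (by simp))
  rw [← h, h1] at this
  exact this

theorem coAd_coAd (γ δ : Γ) (β : LieDual E Γ) : coAd δ (coAd γ β) = coAd (γ * δ) β := by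
  simp only [coAd, Ad_mul]; rfl

theorem Ad_mem {Γ₀ : Subgroup Γ} {γ : Γ} (hγ : γ ∈ Γ₀)
    {X : GroupLieAlgebra 𝓘(ℝ, E) Γ} (hX : X ∈ lieAlgebraOf Γ₀) :
    Ad E γ X ∈ lieAlgebraOf Γ₀ := by
  obtain ⟨c, hc0, hc, hs, rfl⟩ := hX
  refine ⟨fun t => γ * c t * γ⁻¹, by simp [hc0], fun t =>
    Γ₀.mul_mem (Γ₀.mul_mem hγ (hc t)) (Γ₀.inv_mem hγ),
    (contMDiff_conj (E := E) γ).contMDiffAt.comp (0 : ℝ) hs, ?_⟩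
  have := mfderiv_comp (I := 𝓘(ℝ, ℝ)) (I' := 𝓘(ℝ, E)) (I'' := 𝓘(ℝ, E)) (0 : ℝ)
    ((contMDiff_conj (E := E) γ).mdifferentiableAt (x := c 0) (by simp))
    (hs.mdifferentiableAt (by simp))
  rw [hc0] at this
  exact congrArg (fun L : ℝ →L[ℝ] E => L 1) this

/-- The orbit map based at an arbitrary point of the orbit. -/
def orbitMapAt {β₀ : LieDual E Γ} (b : Orbit β₀) (γ : Γ) : Orbit β₀ :=
  ⟨coAd γ b.1, by obtain ⟨δ, hδ⟩ := b.2; exact ⟨δ * γ, by rw [← hδ, coAd_coAd]⟩⟩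

/-- The coadjoint action of `Γ₀` on `O'`. -/
def coAd' {Γ₀ : Subgroup Γ} {β₀ : LieDual E Γ} (γ : Γ₀) (b : Orbit' Γ₀ β₀) : Orbit' Γ₀ β₀ :=
  ⟨orbitMapAt b.1 (γ : Γ), fun _ hX => b.2 _ (Ad_mem γ.2 hX)⟩

/-- Freeness of the coadjoint action of `Γ₀` on `O'`. -/
def IsFreeAction (Γ₀ : Subgroup Γ) (β₀ : LieDual E Γ) : Prop :=
  ∀ (γ : Γ₀) (b : Orbit' Γ₀ β₀), coAd' γ b = b → γ = 1

/-- Properness of the coadjoint action of `Γ₀` on `O'`: preimages of compact sets under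
`(γ, b) ↦ (Ad^*_γ b, b)` are compact. -/
def IsProperAction (Γ₀ : Subgroup Γ) (β₀ : LieDual E Γ) : Prop :=
  ∀ K : Set (Orbit' Γ₀ β₀ × Orbit' Γ₀ β₀), IsCompact K →
    IsCompact ((fun p : Γ₀ × Orbit' Γ₀ β₀ => (coAd' p.1 p.2, p.2)) ⁻¹' K)

/-- The orbit space `O' / Ad^*_{Γ₀}`, with the quotient topology. -/
abbrev OrbitQuotient (Γ₀ : Subgroup Γ) (β₀ : LieDual E Γ) : Type _ :=
  Quot (fun b b' : Orbit' Γ₀ β₀ => ∃ γ : Γ₀, coAd' γ b = b')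

/-- `σ` is the Kirillov form on the coadjoint orbit: at `b`, on the velocities of
`t ↦ Ad^*_{exp tX} b` and `t ↦ Ad^*_{exp tY} b`, it takes the value `b [X, Y]`. -/
def IsKirillovForm {β₀ : LieDual E Γ} {d : ℕ} [ChartedSpace (EuclideanSpace ℝ (Fin d)) (Orbit β₀)]
    (σ : DiffForm (𝓡 d) (Orbit β₀) 2) : Prop :=
  ∀ (b : Orbit β₀) (X Y : GroupLieAlgebra 𝓘(ℝ, E) Γ),
    pullback 𝓘(ℝ, E) (𝓡 d) (orbitMapAt b) σ 1 ![X, Y] = b.1 ⁅X, Y⁆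

end Coadjoint

/-! ### The `Γ`-action on `T^*(Γ/Γ₀)`, its momentum map and the reduced space -/

section Reduction

variable {E : Type*} [NormedAddCommGroup E] [NormedSpace ℝ E]
  {Γ : Type*} [TopologicalSpace Γ] [ChartedSpace E Γ] [Group Γ]
  (F : Type*) [NormedAddCommGroup F] [NormedSpace ℝ F]
  {Γ₀ : Subgroup Γ} [ChartedSpace F (Γ ⧸ Γ₀)] [IsManifold 𝓘(ℝ, F) ∞ (Γ ⧸ Γ₀)]

/-- The cotangent lift of the left translation by `γ`:
`(q, p) ↦ (γ q, p ∘ d(γ⁻¹))`. -/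
def cotangentLift (γ : Γ) (x : Cotangent F (Γ ⧸ Γ₀)) : Cotangent F (Γ ⧸ Γ₀) :=
  ⟨γ • x.proj, (x.2 : F →L[ℝ] ℝ) ∘L
    (mfderiv 𝓘(ℝ, F) 𝓘(ℝ, F) (fun q : Γ ⧸ Γ₀ => γ⁻¹ • q) (γ • x.proj) :)⟩

variable (E) in
/-- The momentum map of the `Γ`-action on `T^*(Γ/Γ₀)`: `Φ(q, p)(X) = p (X_q)`, where `X_q` is
the velocity at `q` of the infinitesimal generator `d/dt exp(tX) q`. -/
def momentumMap (x : Cotangent F (Γ ⧸ Γ₀)) : LieDual E Γ :=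
  (x.2 : F →L[ℝ] ℝ) ∘L (mfderiv 𝓘(ℝ, E) 𝓘(ℝ, F) (fun γ : Γ => γ • x.proj) 1 :)

variable (Γ₀) in
/-- The level set `M_{β₀} = Φ⁻¹(β₀)`, a subspace of `T^*(Γ/Γ₀)`. -/
abbrev MomentumLevel (β₀ : LieDual E Γ) : Type _ :=
  {x : Cotangent F (Γ ⧸ Γ₀) // momentumMap E F x = β₀}

variable (Γ₀) in
/-- The Marsden-Weinstein reduced space `Γ_{β₀} \ Φ⁻¹(β₀)`, with the quotient topology, where
`Γ_{β₀}` is the stabilizer of `β₀` for the coadjoint action. -/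
abbrev ReducedSpace (β₀ : LieDual E Γ) : Type _ :=
  Quot (fun x y : MomentumLevel F Γ₀ β₀ =>
    ∃ γ : Γ, coAd γ β₀ = β₀ ∧ cotangentLift F γ x.1 = y.1)

end Reduction

end CoadjointReduction

end

open CoadjointReduction

noncomputable section

open scoped Manifold ContDiff Topology
open Set Function

set_option linter.unusedSectionVars false

/-! Let `P ⊆ Γ` be the set of `γ` for which `Ad^*_γ β₀` annihilates `𝔤₀`. A covector `p` at `γ Γ₀`
has momentum `β₀` exactly when its pullback to `T_γ Γ` is the right-invariant covector `β₀ ∘ rho γ`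
(`momentumMap_eq_iff`). Such a `p` is unique because the projection is a submersion, and it exists
iff `β₀ ∘ rho γ` kills the vertical vectors, that is, iff `γ ∈ P`. Hence `Φ⁻¹(β₀)` is `P/Γ₀`, while
`O'` is `Γ_{β₀}\P`, and both reduced spaces are the double quotient `Γ_{β₀}\P/Γ₀`; this bijection is
`toOrbitQuotient_eq_iff`.

The forms agree because both come from the right-invariant one-form `β₀ ∘ rho` on `Γ`. Along a local
section of `Γ → Γ/Γ₀` it becomes the tautological form (`pullback_tautologicalForm`). By the
Maurer-Cartan equation (`fderiv_maurerCartan_sub`) its exterior derivative is `β₀([rho u, rho v])`,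
the pullback of the Kirillov form by the orbit map (`pullback_reduced_kirillovForm`). So the
pullbacks of both 2-forms along a map that lifts to `Γ` are the differential of one and the same
one-form. This gives smoothness and closedness (`exists_pullback_eq_extDeriv`) as well as the
comparison (`pullback_toOrbitQuotient_eq_canonicalForm`).

Transversality works twice. It makes `0` a regular value of the restriction `O → 𝔤₀^*`, so that `O'`
is a submanifold; and, by skew-symmetry of `β([X, Y])`, it makes the `Γ₀`-action on `O'`
infinitesimally free (`eq_zero_of_mem_lieSub`). With freeness and properness the action then has
slices and a closed orbit relation, so `O'/Γ₀` is a Hausdorff manifold. The Kirillov form descends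
because `𝔤₀` is orthogonal to `T O'` and isotropic. It is nondegenerate downstairs because a vector
of `T O` orthogonal to `T O ∩ Ann 𝔤₀` is generated by `𝔤₀` (`exists_mem_lieSub_dcoAdL_eq`).

The level set embeds in `Γ/Γ₀` by its base point, as a regular zero set. The reduced space receives
its structure from `O'/Γ₀`: the map from the level set has smooth local sections, so the induced
bijection is a homeomorphism. -/

namespace CoadjointReduction


/-! ### Smooth inverse function theorem. -/

section InverseFunction

variable {E : Type*} [NormedAddCommGroup E] [NormedSpace ℝ E]
  {V : Type*} [NormedAddCommGroup V] [NormedSpace ℝ V]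

/-- Smooth inverse function theorem: a smooth map with invertible derivative at `a` restricts to a
diffeomorphism between open sets. -/
theorem exists_openPartialHomeomorph_of_contDiffOn [CompleteSpace E] {f : E → V} {U : Set E}
    (hU : IsOpen U) (hf : ContDiffOn ℝ ∞ f U) {a : E} (ha : a ∈ U) (L : E ≃L[ℝ] V)
    (hL : fderiv ℝ f a = L) :
    ∃ e : OpenPartialHomeomorph E V, a ∈ e.source ∧ e.source ⊆ U ∧ (∀ x, e x = f x) ∧
      ContDiffOn ℝ ∞ e e.source ∧ ContDiffOn ℝ ∞ e.symm e.target := by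
  have hfa : ContDiffAt ℝ ∞ f a := hf.contDiffAt (hU.mem_nhds ha)
  have hf' : HasFDerivAt f (L : E →L[ℝ] V) a := by
    rw [← hL]; exact (hfa.differentiableAt (by simp)).hasFDerivAt
  let e₀ := hfa.toOpenPartialHomeomorph f hf' (by simp)
  have hcont : ContinuousOn (fderiv ℝ f) U :=
    hf.continuousOn_fderiv_of_isOpen hU (by simp)
  -- Invertibility of the derivative is an open condition; shrinking to it makes the local inverse
  -- smooth at every point of the target, not only at `f a`.
  let W : Set E := U ∩ fderiv ℝ f ⁻¹' range ((↑) : (E ≃L[ℝ] V) → E →L[ℝ] V)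
  have hW : IsOpen W := hcont.isOpen_inter_preimage hU ContinuousLinearEquiv.isOpen
  have haW : a ∈ W := ⟨ha, L, hL.symm⟩
  refine ⟨e₀.restrOpen W hW, ⟨hfa.mem_toOpenPartialHomeomorph_source hf' (by simp), haW⟩,
    fun x hx => hx.2.1, fun x => rfl, hf.mono fun x hx => hx.2.1, fun y hy => ?_⟩
  set e := e₀.restrOpen W hW
  have hx : e.symm y ∈ e.source := e.map_target hy
  obtain ⟨L', hL'⟩ := hx.2.2
  have hs : ContDiffAt ℝ ∞ f (e.symm y) := hf.contDiffAt (hU.mem_nhds hx.2.1)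
  refine (e.contDiffAt_symm (f₀' := L') hy ?_ hs).contDiffWithinAt
  rw [hL']
  exact (hs.differentiableAt (by simp)).hasFDerivAt

variable {M : Type*} [TopologicalSpace M] [ChartedSpace E M]

/-- The tangent space at `x` is identified with `E` through the preferred chart at `x`, so the
manifold derivative there is an ordinary derivative. -/
theorem fderiv_comp_chartAt_symm {f : M → V} {x : M}
    (hf : MDifferentiableAt 𝓘(ℝ, E) 𝓘(ℝ, V) f x) :
    fderiv ℝ (f ∘ (chartAt E x).symm) (chartAt E x x) = mfderiv 𝓘(ℝ, E) 𝓘(ℝ, V) f x := by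
  simp [mfderiv, hf, writtenInExtChartAt, extChartAt, fderivWithin_univ]
  rfl

/-- Inverse function theorem for maps from a manifold to a vector space. -/
theorem exists_openPartialHomeomorph_of_contMDiffOn [CompleteSpace E]
    [IsManifold 𝓘(ℝ, E) ∞ M] {f : M → V} {U : Set M}
    (hU : IsOpen U) (hf : ContMDiffOn 𝓘(ℝ, E) 𝓘(ℝ, V) ∞ f U) {x : M} (hx : x ∈ U)
    (L : E ≃L[ℝ] V) (hL : (L : E →L[ℝ] V) = mfderiv 𝓘(ℝ, E) 𝓘(ℝ, V) f x) :
    ∃ e : OpenPartialHomeomorph M V, x ∈ e.source ∧ e.source ⊆ U ∧ (∀ y ∈ e.source, e y = f y) ∧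
      ContMDiffOn 𝓘(ℝ, E) 𝓘(ℝ, V) ∞ e e.source ∧
      ContMDiffOn 𝓘(ℝ, V) 𝓘(ℝ, E) ∞ e.symm e.target := by
  set φ := chartAt E x
  have hφ : ContMDiffOn 𝓘(ℝ, E) 𝓘(ℝ, E) ∞ φ φ.source :=
    contMDiffOn_of_mem_maximalAtlas (IsManifold.chart_mem_maximalAtlas x)
  have hφs : ContMDiffOn 𝓘(ℝ, E) 𝓘(ℝ, E) ∞ φ.symm φ.target :=
    contMDiffOn_symm_of_mem_maximalAtlas (IsManifold.chart_mem_maximalAtlas x)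
  have hxφ : x ∈ φ.source := mem_chart_source E x
  have hO : IsOpen (φ.target ∩ φ.symm ⁻¹' U) := φ.symm.isOpen_inter_preimage hU
  have hg : ContDiffOn ℝ ∞ (f ∘ φ.symm) (φ.target ∩ φ.symm ⁻¹' U) :=
    contMDiffOn_iff_contDiffOn.1 (hf.comp (hφs.mono inter_subset_left) fun y hy => hy.2)
  obtain ⟨e, hae, heU, hef, hes, het⟩ := exists_openPartialHomeomorph_of_contDiffOn hO hg
    (a := φ x) ⟨φ.map_source hxφ, by simpa [φ.left_inv hxφ] using hx⟩ L
    ((fderiv_comp_chartAt_symm ((hf.contMDiffAt (hU.mem_nhds hx)).mdifferentiableAt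
      (by simp))).trans hL.symm)
  refine ⟨φ.trans e, ⟨hxφ, hae⟩, fun y hy => ?_, fun y hy => ?_, ?_, ?_⟩
  · have := (heU hy.2).2
    simpa [φ.left_inv hy.1] using this
  · have : (φ.trans e) y = e (φ y) := rfl
    rw [this, hef, comp_apply, φ.left_inv hy.1]
  · exact hes.contMDiffOn.comp (hφ.mono fun y hy => hy.1) fun y hy => hy.2
  · exact hφs.comp (het.contMDiffOn.mono fun y hy => hy.1) fun y hy => hy.2

end InverseFunction


/-! ### Completing surjective and injective linear maps to isomorphisms. -/

section LinearAlgebra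

open Module

variable {E W K : Type*} [NormedAddCommGroup E] [NormedSpace ℝ E] [FiniteDimensional ℝ E]
  [NormedAddCommGroup W] [NormedSpace ℝ W] [FiniteDimensional ℝ W]
  [NormedAddCommGroup K] [NormedSpace ℝ K] [FiniteDimensional ℝ K]

/-- The second component is a linear projection of `E` onto the kernel of `D`, identified with `K`
by dimension. -/
theorem exists_equiv_prod_of_surjective (D : E →L[ℝ] W) (hD : Surjective D)
    (hK : finrank ℝ W + finrank ℝ K = finrank ℝ E) :
    ∃ L : E ≃L[ℝ] W × K, ∀ x, (L x).1 = D x := by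
  have hker : finrank ℝ (LinearMap.ker D.toLinearMap) = finrank ℝ K := by
    have h1 := LinearMap.finrank_range_add_finrank_ker D.toLinearMap
    rw [LinearMap.range_eq_top.2 hD, finrank_top] at h1
    omega
  obtain ⟨g, hg⟩ := (LinearMap.ker D.toLinearMap).subtype.exists_leftInverse_of_injective
    (by simp)
  let ek := LinearEquiv.ofFinrankEq _ _ hker
  let T : E →ₗ[ℝ] W × K := D.toLinearMap.prod (ek.toLinearMap ∘ₗ g)
  have hT : Injective T := by
    refine (injective_iff_map_eq_zero T).2 fun x hx => ?_
    have h1 : D x = 0 := congrArg Prod.fst hx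
    have h2 : ek (g x) = 0 := congrArg Prod.snd hx
    have h3 := LinearMap.congr_fun hg ⟨x, h1⟩
    simp only [LinearMap.comp_apply, Submodule.subtype_apply, LinearMap.id_apply] at h3
    rw [LinearEquiv.map_eq_zero_iff, h3] at h2
    exact congrArg Subtype.val h2
  refine ⟨(LinearEquiv.ofInjectiveOfFinrankEq T hT (by
    rw [finrank_prod, hK])).toContinuousLinearEquiv, fun x => rfl⟩

/-- The factor `K` is sent isomorphically onto a complement of the range of `D`. -/
theorem exists_prod_equiv_of_injective (D : E →L[ℝ] W) (hD : Injective D)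
    (hK : finrank ℝ E + finrank ℝ K = finrank ℝ W) :
    ∃ L : (E × K) ≃L[ℝ] W, ∀ x, L (x, 0) = D x := by
  obtain ⟨C, hC⟩ := (LinearMap.range D.toLinearMap).exists_isCompl
  have h1 := Submodule.finrank_add_eq_of_isCompl hC
  rw [LinearMap.finrank_range_of_inj hD] at h1
  let ek : K ≃ₗ[ℝ] C := LinearEquiv.ofFinrankEq _ _ (by omega)
  let T : E × K →ₗ[ℝ] W := D.toLinearMap.coprod (C.subtype ∘ₗ ek.toLinearMap)
  have hT : Injective T := by
    refine (injective_iff_map_eq_zero T).2 fun x hx => ?_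
    have hx' : D x.1 + (ek x.2 : W) = 0 := hx
    have h2 : D x.1 ∈ C := by
      rw [eq_neg_of_add_eq_zero_left hx']; exact C.neg_mem (ek x.2).2
    have h3 : D x.1 = 0 := (Submodule.disjoint_def.1 hC.disjoint) _ ⟨x.1, rfl⟩ h2
    rw [h3, zero_add] at hx'
    have h4 : x.2 = 0 := ek.map_eq_zero_iff.1 (Subtype.ext hx')
    exact Prod.ext ((injective_iff_map_eq_zero D).1 hD _ h3) h4
  exact ⟨(LinearEquiv.ofInjectiveOfFinrankEq T hT (by
    rw [finrank_prod, hK])).toContinuousLinearEquiv, fun x => by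
      change D x + (ek 0 : W) = D x; simp⟩

end LinearAlgebra

/-! ### Straightening a map with surjective differential. -/

section Submersion

open Module

variable {E : Type*} [NormedAddCommGroup E] [NormedSpace ℝ E] [FiniteDimensional ℝ E]
  {M : Type*} [TopologicalSpace M] [ChartedSpace E M] [IsManifold 𝓘(ℝ, E) ∞ M]
  {W : Type*} [NormedAddCommGroup W] [NormedSpace ℝ W] [FiniteDimensional ℝ W]
  {K : Type*} [NormedAddCommGroup K] [NormedSpace ℝ K] [FiniteDimensional ℝ K]

/-- A smooth map to a vector space with surjective differential at `x` is the first component of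
a diffeomorphism near `x`. -/
theorem exists_straightening_of_surjective {f : M → W} {U : Set M} (hU : IsOpen U)
    (hf : ContMDiffOn 𝓘(ℝ, E) 𝓘(ℝ, W) ∞ f U) {x : M} (hx : x ∈ U)
    (hs : Surjective (mfderiv 𝓘(ℝ, E) 𝓘(ℝ, W) f x))
    (hK : finrank ℝ W + finrank ℝ K = finrank ℝ E) :
    ∃ e : OpenPartialHomeomorph M (W × K), x ∈ e.source ∧ e.source ⊆ U ∧
      (∀ y ∈ e.source, (e y).1 = f y) ∧
      ContMDiffOn 𝓘(ℝ, E) 𝓘(ℝ, W × K) ∞ e e.source ∧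
      ContMDiffOn 𝓘(ℝ, W × K) 𝓘(ℝ, E) ∞ e.symm e.target := by
  have hcomplete : CompleteSpace E := FiniteDimensional.complete ℝ E
  set φ := chartAt E x with hφdef
  have hφ : ContMDiffOn 𝓘(ℝ, E) 𝓘(ℝ, E) ∞ φ φ.source :=
    contMDiffOn_of_mem_maximalAtlas (IsManifold.chart_mem_maximalAtlas x)
  have hxφ : x ∈ φ.source := mem_chart_source E x
  obtain ⟨L, hL⟩ := exists_equiv_prod_of_surjective (E := E) (W := W) (K := K)
    (mfderiv 𝓘(ℝ, E) 𝓘(ℝ, W) f x) hs hK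
  let p : E →L[ℝ] K := ContinuousLinearMap.snd ℝ W K ∘L (L : E →L[ℝ] W × K)
  -- Adjoining the linear function `p` of the chart coordinates makes the derivative at `x` equal to
  -- `L`, so the inverse function theorem applies.
  let T : M → W × K := fun y => (f y, p (φ y))
  have hT : ContMDiffOn 𝓘(ℝ, E) 𝓘(ℝ, W × K) ∞ T (U ∩ φ.source) := by
    refine ContMDiffOn.prodMk_space (hf.mono inter_subset_left) ?_
    exact p.contMDiff.comp_contMDiffOn (hφ.mono inter_subset_right)
  have hO := hU.inter φ.open_source
  have hTx := (hT.contMDiffAt (hO.mem_nhds ⟨hx, hxφ⟩)).mdifferentiableAt (by simp)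
  have hfx := (hf.contMDiffAt (hU.mem_nhds hx)).mdifferentiableAt (by simp)
  obtain ⟨e, h1, h2, h3, h4, h5⟩ := exists_openPartialHomeomorph_of_contMDiffOn hO hT ⟨hx, hxφ⟩ L
    (by
      rw [← fderiv_comp_chartAt_symm hTx]
      have hev : T ∘ (chartAt E x).symm =ᶠ[𝓝 (chartAt E x x)]
          fun y => ((f ∘ φ.symm) y, p y) := by
        filter_upwards [φ.open_target.mem_nhds (φ.map_source hxφ)] with y hy
        simp [T, ← hφdef, φ.right_inv hy]
      have hd : DifferentiableAt ℝ (f ∘ φ.symm) (φ x) := by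
        have := (hf.contMDiffAt (hU.mem_nhds hx))
        have h6 : ContMDiffAt 𝓘(ℝ, E) 𝓘(ℝ, W) ∞ (f ∘ φ.symm) (φ x) := by
          refine ContMDiffAt.comp (φ x) (by rwa [φ.left_inv hxφ]) ?_
          exact (contMDiffOn_symm_of_mem_maximalAtlas
            (IsManifold.chart_mem_maximalAtlas x)).contMDiffAt
              (φ.open_target.mem_nhds (φ.map_source hxφ))
        exact h6.contDiffAt.differentiableAt (by simp)
      rw [hev.fderiv_eq, DifferentiableAt.fderiv_prodMk hd p.differentiableAt,
        fderiv_comp_chartAt_symm hfx, p.fderiv]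
      ext y
      · exact hL y
      · rfl)
  exact ⟨e, h1, h2.trans inter_subset_left, fun y hy => by rw [h3 y hy], h4, h5⟩

end Submersion


/-! ### Submersions: rank criterion and local sections. -/

section SubmersionImmersion

open Module Manifold

variable {E : Type*} [NormedAddCommGroup E] [NormedSpace ℝ E]
  {M : Type*} [TopologicalSpace M] [ChartedSpace E M] [IsManifold 𝓘(ℝ, E) ∞ M]
  {E' : Type*} [NormedAddCommGroup E'] [NormedSpace ℝ E']
  {N : Type*} [TopologicalSpace N] [ChartedSpace E' N] [IsManifold 𝓘(ℝ, E') ∞ N]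

theorem contMDiffOn_chartAt' (x : M) :
    ContMDiffOn 𝓘(ℝ, E) 𝓘(ℝ, E) ∞ (chartAt E x) (chartAt E x).source :=
  contMDiffOn_of_mem_maximalAtlas (IsManifold.chart_mem_maximalAtlas x)

theorem mfderiv_chartAt_self (x : M) :
    mfderiv 𝓘(ℝ, E) 𝓘(ℝ, E) (chartAt E x) x = ContinuousLinearMap.id ℝ E := by
  have hx := mem_chart_source E x
  have h : MDifferentiableAt 𝓘(ℝ, E) 𝓘(ℝ, E) (chartAt E x) x :=
    ((contMDiffOn_chartAt' x).contMDiffAt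
      ((chartAt E x).open_source.mem_nhds hx)).mdifferentiableAt (by simp)
  rw [← fderiv_comp_chartAt_symm h]
  have : (chartAt E x) ∘ (chartAt E x).symm =ᶠ[𝓝 (chartAt E x x)] id := by
    filter_upwards [(chartAt E x).open_target.mem_nhds ((chartAt E x).map_source hx)] with y hy
    simp [(chartAt E x).right_inv hy]
  rw [this.fderiv_eq, fderiv_id]

/-- The preferred chart at `f x` has identity derivative there, so reading `f` in it turns the
target into a vector space at no cost. -/
theorem mfderiv_chartAt_comp {f : M → N} {x : M}
    (hf : MDifferentiableAt 𝓘(ℝ, E) 𝓘(ℝ, E') f x) :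
    mfderiv 𝓘(ℝ, E) 𝓘(ℝ, E') (fun y => chartAt E' (f x) (f y)) x =
      mfderiv 𝓘(ℝ, E) 𝓘(ℝ, E') f x := by
  have h : MDifferentiableAt 𝓘(ℝ, E') 𝓘(ℝ, E') (chartAt E' (f x)) (f x) :=
    ((contMDiffOn_chartAt' (f x)).contMDiffAt
      ((chartAt E' (f x)).open_source.mem_nhds (mem_chart_source E' (f x)))).mdifferentiableAt
        (by simp)
  have := mfderiv_comp x h hf
  rw [mfderiv_chartAt_self] at this
  exact this

/-- A smooth map of finite-dimensional manifolds with surjective differentials is a submersion. -/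
theorem isSubmersion_of_surjective_mfderiv [FiniteDimensional ℝ E] [FiniteDimensional ℝ E']
    {f : M → N} (hf : ContMDiff 𝓘(ℝ, E) 𝓘(ℝ, E') ∞ f)
    (hs : ∀ x, Surjective (mfderiv 𝓘(ℝ, E) 𝓘(ℝ, E') f x)) :
    IsSubmersion 𝓘(ℝ, E) 𝓘(ℝ, E') ∞ f := by
  let K := EuclideanSpace ℝ (Fin (finrank ℝ E - finrank ℝ E'))
  refine IsSubmersionOfComplement.isSubmersion (F := K) fun x => ?_
  have hle : finrank ℝ E' ≤ finrank ℝ E :=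
    LinearMap.finrank_le_finrank_of_surjective
      (f := (mfderiv 𝓘(ℝ, E) 𝓘(ℝ, E') f x : E →L[ℝ] E').toLinearMap) (hs x)
  have hK : finrank ℝ E' + finrank ℝ K = finrank ℝ E := by
    simp [K]; omega
  set ψ := chartAt E' (f x)
  have hU : IsOpen (f ⁻¹' ψ.source) := ψ.open_source.preimage hf.continuous
  have hx : x ∈ f ⁻¹' ψ.source := mem_chart_source E' (f x)
  have hg : ContMDiffOn 𝓘(ℝ, E) 𝓘(ℝ, E') ∞ (fun y => ψ (f y)) (f ⁻¹' ψ.source) :=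
    (contMDiffOn_chartAt' (f x)).comp hf.contMDiffOn fun y hy => hy
  obtain ⟨e, hxe, heU, hef, hes, het⟩ := exists_straightening_of_surjective (K := K) hU hg hx
    (by rw [mfderiv_chartAt_comp (hf.mdifferentiableAt (by simp))]; exact hs x) hK
  -- The normal form needs a chart with values in the model `E`. Any isomorphism will do: applied
  -- after `e` as `L.symm`, it cancels in the normal form.
  let L : E ≃L[ℝ] E' × K := ContinuousLinearEquiv.ofFinrankEq (by rw [finrank_prod, hK])
  refine IsSubmersionAtOfComplement.mk_of_continuousAt hf.continuous.continuousAt L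
    (e.trans L.symm.toHomeomorph.toOpenPartialHomeomorph) ψ (by simpa using hxe) hx ?_
    (IsManifold.chart_mem_maximalAtlas _) ?_
  · refine OpenPartialHomeomorph.mem_maximalAtlas_of_contMDiffOn _ ?_ ?_
    · exact L.symm.contDiff.contMDiff.comp_contMDiffOn (hes.mono (by simp))
    · refine het.comp L.contDiff.contMDiff.contMDiffOn fun y hy => ?_
      simpa using hy
  · intro u hu
    have hu' : L u ∈ e.target := by simpa using hu
    have := hef _ (e.map_target hu')
    rw [e.right_inv hu'] at this
    simpa using this.symm

/-- A submersion has smooth local sections through every point. -/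
theorem exists_local_section {f : M → N} (hf : IsSubmersion 𝓘(ℝ, E) 𝓘(ℝ, E') ∞ f) (x : M) :
    ∃ (s : N → M) (U : Set N), IsOpen U ∧ f x ∈ U ∧ s (f x) = x ∧ (∀ y ∈ U, f (s y) = y) ∧
      ContMDiffOn 𝓘(ℝ, E') 𝓘(ℝ, E) ∞ s U := by
  have h := hf.isSubmersionAt x
  set φ := h.domChart
  set ψ := h.codChart
  set L := h.equiv
  have hxφ : x ∈ φ.source := h.mem_domChart_source
  have hfψ : f x ∈ ψ.source := h.mem_codChart_source
  have hw : ∀ u ∈ φ.target, ψ (f (φ.symm u)) = (L u).1 := fun u hu => by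
    have h1 : u ∈ (h.domChart.extend 𝓘(ℝ, E)).target := by simpa using hu
    simpa using h.writtenInCharts h1
  have hφψ : ∀ z ∈ φ.source, f z ∈ ψ.source := h.source_subset_preimage_source
  -- In the normal form `f` is the projection to the first factor; the section freezes the second
  -- factor at its value for `x`.
  let g : N → E := fun y => L.symm (ψ y, (L (φ x)).2)
  have hψ : ContMDiffOn 𝓘(ℝ, E') 𝓘(ℝ, E') ∞ ψ ψ.source :=
    contMDiffOn_of_mem_maximalAtlas h.codChart_mem_maximalAtlas
  have hg : ContMDiffOn 𝓘(ℝ, E') 𝓘(ℝ, E) ∞ g ψ.source :=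
    L.symm.contDiff.contMDiff.comp_contMDiffOn (hψ.prodMk_space contMDiffOn_const)
  have hgx : g (f x) = φ x := by
    have := hw (φ x) (φ.map_source hxφ)
    rw [φ.left_inv hxφ] at this
    simp [g, this]
  refine ⟨fun y => φ.symm (g y), ψ.source ∩ g ⁻¹' φ.target,
    hg.continuousOn.isOpen_inter_preimage ψ.open_source φ.open_target,
    ⟨hfψ, by rw [mem_preimage, hgx]; exact φ.map_source hxφ⟩,
    by simp only [hgx, φ.left_inv hxφ], fun y hy => ?_, ?_⟩
  · refine ψ.injOn (hφψ _ (φ.map_target hy.2)) hy.1 ?_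
    rw [hw _ hy.2]; simp [g]
  · exact (contMDiffOn_symm_of_mem_maximalAtlas h.domChart_mem_maximalAtlas).comp
      (hg.mono inter_subset_left) fun y hy => hy.2

theorem mfderiv_comp_local_section {f : M → N} {s : N → M} {U : Set N} (hU : IsOpen U) {y : N}
    (hy : y ∈ U) (hfs : ∀ y ∈ U, f (s y) = y)
    (hs : MDifferentiableAt 𝓘(ℝ, E') 𝓘(ℝ, E) s y)
    (hf : MDifferentiableAt 𝓘(ℝ, E) 𝓘(ℝ, E') f (s y)) (v : E') :
    mfderiv 𝓘(ℝ, E) 𝓘(ℝ, E') f (s y) (mfderiv 𝓘(ℝ, E') 𝓘(ℝ, E) s y v) = v := by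
  have h1 := mfderiv_comp y hf hs
  have h2 : f ∘ s =ᶠ[𝓝 y] id := by
    filter_upwards [hU.mem_nhds hy] with z hz using hfs z hz
  rw [h2.mfderiv_eq, mfderiv_id] at h1
  exact (congrArg (fun T : E' →L[ℝ] E' => T v) h1).symm

theorem surjective_mfderiv_of_isSubmersion {f : M → N}
    (hf : IsSubmersion 𝓘(ℝ, E) 𝓘(ℝ, E') ∞ f) (x : M) :
    Surjective (mfderiv 𝓘(ℝ, E) 𝓘(ℝ, E') f x) := by
  obtain ⟨s, U, hU, hxU, hsx, hfs, hs⟩ := exists_local_section hf x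
  intro v
  have h1 := mfderiv_comp_local_section hU hxU hfs
    ((hs.contMDiffAt (hU.mem_nhds hxU)).mdifferentiableAt (by simp))
    (hf.contMDiff.mdifferentiableAt (by simp)) v
  rw [hsx] at h1
  exact ⟨_, h1⟩

end SubmersionImmersion

/-! ### Immersions: rank criterion. -/

section Immersion

open Module Manifold

variable {E : Type*} [NormedAddCommGroup E] [NormedSpace ℝ E] [FiniteDimensional ℝ E]
  {M : Type*} [TopologicalSpace M] [ChartedSpace E M] [IsManifold 𝓘(ℝ, E) ∞ M]
  {E' : Type*} [NormedAddCommGroup E'] [NormedSpace ℝ E'] [FiniteDimensional ℝ E']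
  {G : Type*} [TopologicalSpace G] {J : ModelWithCorners ℝ E' G} [J.Boundaryless]
  {N : Type*} [TopologicalSpace N] [ChartedSpace G N] [IsManifold J ∞ N]

/-- A smooth map of finite-dimensional manifolds with injective differentials is an immersion. -/
theorem isImmersion_of_injective_mfderiv {f : M → N} (hf : ContMDiff 𝓘(ℝ, E) J ∞ f)
    (hi : ∀ x, Injective (mfderiv 𝓘(ℝ, E) J f x)) : IsImmersion 𝓘(ℝ, E) J ∞ f := by
  have hcomplete : CompleteSpace E := FiniteDimensional.complete ℝ E
  let K := EuclideanSpace ℝ (Fin (finrank ℝ E' - finrank ℝ E))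
  refine IsImmersionOfComplement.isImmersion (F := K) fun x => ?_
  have hle : finrank ℝ E ≤ finrank ℝ E' :=
    LinearMap.finrank_le_finrank_of_injective
      (f := (mfderiv 𝓘(ℝ, E) J f x : E →L[ℝ] E').toLinearMap) (hi x)
  have hK : finrank ℝ E + finrank ℝ K = finrank ℝ E' := by simp [K]; omega
  obtain ⟨L, hL⟩ := exists_prod_equiv_of_injective (E := E) (W := E') (K := K)
    (mfderiv 𝓘(ℝ, E) J f x) (hi x) hK
  let D : E →L[ℝ] E' := mfderiv 𝓘(ℝ, E) J f x
  set φ := chartAt E x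
  set ψ := chartAt G (f x)
  have hxφ : x ∈ φ.source := mem_chart_source E x
  have hφs : ContMDiffOn 𝓘(ℝ, E) 𝓘(ℝ, E) ∞ φ.symm φ.target :=
    contMDiffOn_symm_of_mem_maximalAtlas (IsManifold.chart_mem_maximalAtlas x)
  have hψ : ContMDiffOn J J ∞ ψ ψ.source :=
    contMDiffOn_of_mem_maximalAtlas (IsManifold.chart_mem_maximalAtlas (f x))
  have hψs : ContMDiffOn J J ∞ ψ.symm ψ.target :=
    contMDiffOn_symm_of_mem_maximalAtlas (IsManifold.chart_mem_maximalAtlas (f x))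
  let g : E → E' := fun u => J (ψ (f (φ.symm u)))
  let U : Set E := φ.target ∩ φ.symm ⁻¹' (f ⁻¹' ψ.source)
  have hU : IsOpen U :=
    φ.symm.isOpen_inter_preimage (ψ.open_source.preimage hf.continuous)
  have hxU : φ x ∈ U := ⟨φ.map_source hxφ, by
    rw [mem_preimage, φ.left_inv hxφ]; exact mem_chart_source G (f x)⟩
  have hg : ContDiffOn ℝ ∞ g U := by
    refine contMDiffOn_iff_contDiffOn.1 ?_
    exact J.contMDiff.comp_contMDiffOn (hψ.comp (hf.comp_contMDiffOn
      (hφs.mono inter_subset_left)) fun u hu => hu.2)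
  have hgd : fderiv ℝ g (φ x) = mfderiv 𝓘(ℝ, E) J f x := by
    have := hf.mdifferentiableAt (x := x) (by simp)
    simp [mfderiv, this, writtenInExtChartAt, extChartAt, fderivWithin_univ]
    rfl
  -- The local expression `g` is thickened in the complementary directions. The derivative of `T` at
  -- `(φ x, 0)` is `L`, and in the coordinates given by the inverse of `T` the map becomes `u ↦ (u,
  -- 0)`.
  let T : E × K → E' := fun p => g p.1 + L (0, p.2)
  have hT : ContDiffOn ℝ ∞ T (U ×ˢ univ) := by
    refine (hg.comp contDiffOn_fst fun p hp => hp.1).add ?_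
    exact ContDiff.contDiffOn (by fun_prop)
  obtain ⟨e, hae, heU, heT, hes, het⟩ := exists_openPartialHomeomorph_of_contDiffOn
    (hU.prod isOpen_univ) hT (a := (φ x, 0)) ⟨hxU, mem_univ _⟩ L (by
      have h1 : HasFDerivAt g D (φ x) := by
        rw [show D = fderiv ℝ g (φ x) from hgd.symm]
        exact ((hg.contDiffAt (hU.mem_nhds hxU)).differentiableAt (by simp)).hasFDerivAt
      have h2 : HasFDerivAt T (D ∘L
          ContinuousLinearMap.fst ℝ E K + (L : E × K →L[ℝ] E') ∘L
            (ContinuousLinearMap.inr ℝ E K ∘L ContinuousLinearMap.snd ℝ E K)) (φ x, 0) := by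
        refine HasFDerivAt.add ?_ ?_
        · exact HasFDerivAt.comp (φ x, (0 : K)) (g := g) h1 hasFDerivAt_fst
        · exact ((L : E × K →L[ℝ] E') ∘L (ContinuousLinearMap.inr ℝ E K ∘L
            ContinuousLinearMap.snd ℝ E K)).hasFDerivAt
      rw [h2.fderiv]
      refine ContinuousLinearMap.ext fun p => ?_
      have h3 : L p = L (p.1, 0) + L (0, p.2) := by rw [← map_add]; simp
      change D p.1 + L (0, p.2) = L p
      rw [h3, hL])
  let j := J.toHomeomorph.toOpenPartialHomeomorph
  -- Without boundary `J` is a homeomorphism onto `E'`, so the straightening can be carried out in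
  -- `E'` and transported back to `G`.
  let c : OpenPartialHomeomorph N G :=
    ψ.trans (j.trans (e.symm.trans (L.toHomeomorph.toOpenPartialHomeomorph.trans j.symm)))
  have hcs : ∀ y, y ∈ c.source ↔ y ∈ ψ.source ∧ J (ψ y) ∈ e.target := fun y => by
    simp [c, j]
  have hct : ∀ z, z ∈ c.target ↔ L.symm (J z) ∈ e.source ∧
      J.symm (e (L.symm (J z))) ∈ ψ.target := fun y => by
    simp [c, j]
  have hcc : ∀ y, c y = J.symm (L (e.symm (J (ψ y)))) := fun y => by simp [c, j]
  have hcc' : ∀ z, c.symm z = ψ.symm (J.symm (e (L.symm (J z)))) := fun z => by simp [c, j]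
  clear_value c
  let d := φ.restrOpen (φ.source ∩ φ ⁻¹' ((fun u => ((u, 0) : E × K)) ⁻¹' e.source))
    (φ.isOpen_inter_preimage (e.open_source.preimage (by fun_prop)))
  have he0 : ∀ u, e (u, 0) = g u := fun u => by
    rw [heT]
    change g u + L (0, 0) = g u
    rw [Prod.mk_zero_zero, map_zero, add_zero]
  refine IsImmersionAtOfComplement.mk_of_continuousAt hf.continuous.continuousAt L d c
    ⟨hxφ, hxφ, hae⟩ ((hcs _).2 ⟨mem_chart_source G (f x), ?_⟩) ?_ ?_ ?_
  · have := e.map_source hae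
    rw [he0] at this
    simpa [g, φ.left_inv hxφ] using this
  · refine OpenPartialHomeomorph.mem_maximalAtlas_of_contMDiffOn _ ?_ ?_
    · exact (contMDiffOn_chartAt' x).mono fun y hy => hy.1
    · exact hφs.mono fun y hy => hy.1
  · refine OpenPartialHomeomorph.mem_maximalAtlas_of_contMDiffOn _ ?_ ?_
    · have h1 : ContMDiffOn J 𝓘(ℝ, E') ∞ (fun y => L (e.symm (J (ψ y)))) c.source :=
        L.contDiff.contMDiff.comp_contMDiffOn (het.contMDiffOn.comp (J.contMDiff.comp_contMDiffOn
          (hψ.mono fun y hy => ((hcs y).1 hy).1)) fun y hy => ((hcs y).1 hy).2)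
      exact (J.contMDiffOn_symm.comp h1 fun y _ => by simp [J.range_eq_univ]).congr fun y _ => hcc y
    · have h1 : ContMDiffOn J 𝓘(ℝ, E') ∞ (fun z => e (L.symm (J z))) c.target :=
        hes.contMDiffOn.comp (L.symm.contDiff.contMDiff.comp J.contMDiff).contMDiffOn
          fun z hz => ((hct z).1 hz).1
      exact (hψs.comp (J.contMDiffOn_symm.comp h1 fun y _ => by simp [J.range_eq_univ])
        fun z hz => ((hct z).1 hz).2).congr fun z _ => hcc' z
  · intro u hu
    have hu' : u ∈ φ.target ∧ (u, (0 : K)) ∈ e.source := by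
      have : u ∈ d.target := by simpa using hu
      have h2 := d.map_target this
      refine ⟨d.symm.map_source this |>.1 |> fun h => ?_, ?_⟩
      · have h3 := d.right_inv this
        rw [← h3]; exact φ.map_source h
      · have h4 : (φ (d.symm u), (0 : K)) ∈ e.source := h2.2.2
        have h3 : φ (d.symm u) = u := d.right_inv this
        rwa [h3] at h4
    have h5 : e.symm (g u) = (u, 0) := by rw [← he0, e.left_inv hu'.2]
    change J (c (f (φ.symm u))) = L (u, 0)
    rw [hcc]
    change J (J.symm (L (e.symm (g u)))) = L (u, 0)
    rw [h5, J.right_inv (by simp [J.range_eq_univ])]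

end Immersion


/-! ### Manifold structures from families of charts. -/

section ChartFamily

variable {V : Type*} [NormedAddCommGroup V] [NormedSpace ℝ V]
  {Z : Type*} [TopologicalSpace Z]

/-- The charted space structure given by a family of charts, one at each point. -/
abbrev chartedSpaceOfCharts (c : Z → OpenPartialHomeomorph Z V) (hc : ∀ z, z ∈ (c z).source) :
    ChartedSpace V Z where
  atlas := range c
  chartAt := c
  mem_chart_source := hc
  chart_mem_atlas := mem_range_self

theorem isManifold_chartedSpaceOfCharts (c : Z → OpenPartialHomeomorph Z V)
    (hc : ∀ z, z ∈ (c z).source)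
    (h : ∀ z z', ∀ v ∈ (c z).target, (c z).symm v ∈ (c z').source →
      ContDiffAt ℝ ∞ (fun w => c z' ((c z).symm w)) v) :
    letI := chartedSpaceOfCharts c hc
    IsManifold 𝓘(ℝ, V) ∞ Z := by
  let _ := chartedSpaceOfCharts c hc
  refine isManifold_of_contDiffOn _ _ _ ?_
  rintro _ _ ⟨z, rfl⟩ ⟨z', rfl⟩
  intro v hv
  have hv' : v ∈ (c z).target ∧ (c z).symm v ∈ (c z').source := by simpa using hv
  exact (h z z' v hv'.1 hv'.2).contDiffWithinAt

end ChartFamily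

/-! ### Regular zero sets as submanifolds. -/

section Submanifold

open Module Manifold Topology

variable {E : Type*} [NormedAddCommGroup E] [NormedSpace ℝ E] [FiniteDimensional ℝ E]
  {X : Type*} [TopologicalSpace X] [ChartedSpace E X] [IsManifold 𝓘(ℝ, E) ∞ X]
  {W : Type*} [NormedAddCommGroup W] [NormedSpace ℝ W] [FiniteDimensional ℝ W]
  {Z : Type*} [TopologicalSpace Z]

/-- The chart on `Z` induced by a chart of the ambient space which straightens the image of the
embedding `i : Z → X`. -/
def sliceChart {K : Type*} [NormedAddCommGroup K] {i : Z → X} (hi : IsEmbedding i)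
    (e : OpenPartialHomeomorph X (W × K)) (z : Z)
    (he : ∀ x ∈ e.source, (e x).1 = 0 ↔ x ∈ range i) : OpenPartialHomeomorph Z K :=
  haveI : Nonempty Z := ⟨z⟩
  -- Points of the source with vanishing first coordinate lie in the range of `i`, so the chosen
  -- inverse of `i` is a true inverse on them.
  have hinv : ∀ v : K, (0, v) ∈ e.target → i (invFun i (e.symm (0, v))) = e.symm (0, v) :=
    fun v hv => invFun_eq ((he _ (e.map_target hv)).1 (by rw [e.right_inv hv]))
  { toFun := fun z' => (e (i z')).2
    invFun := fun v => invFun i (e.symm (0, v))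
    source := i ⁻¹' e.source
    target := {v | (0, v) ∈ e.target}
    map_source' := fun z' hz' => by
      have h0 : (e (i z')).1 = 0 := (he _ hz').2 (mem_range_self z')
      have : ((0 : W), (e (i z')).2) = e (i z') := by rw [← h0]
      rw [mem_ofPred_eq, this]
      exact e.map_source hz'
    map_target' := fun v hv => by
      rw [mem_preimage, hinv v hv]
      exact e.map_target hv
    left_inv' := fun z' hz' => by
      have h0 : (e (i z')).1 = 0 := (he _ hz').2 (mem_range_self z')
      have : ((0 : W), (e (i z')).2) = e (i z') := by rw [← h0]
      rw [this, e.left_inv hz']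
      exact leftInverse_invFun hi.injective z'
    right_inv' := fun v hv => by
      rw [hinv v hv, e.right_inv hv]
    open_source := e.open_source.preimage hi.continuous
    open_target := e.open_target.preimage (by fun_prop)
    continuousOn_toFun := continuous_snd.comp_continuousOn
      (e.continuousOn.comp hi.continuous.continuousOn fun z' hz' => hz')
    continuousOn_invFun := by
      rw [hi.isInducing.continuousOn_iff]
      refine ContinuousOn.congr (f := fun v => e.symm (0, v)) ?_ fun v hv => hinv v hv
      exact e.symm.continuousOn.comp (Continuous.continuousOn (by fun_prop)) fun v hv => hv }

theorem sliceChart_symm {K : Type*} [NormedAddCommGroup K] {i : Z → X} (hi : IsEmbedding i)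
    (e : OpenPartialHomeomorph X (W × K)) (z : Z)
    (he : ∀ x ∈ e.source, (e x).1 = 0 ↔ x ∈ range i) {v : K}
    (hv : v ∈ (sliceChart hi e z he).target) :
    i ((sliceChart hi e z he).symm v) = e.symm (0, v) := by
  have : Nonempty Z := ⟨z⟩
  exact invFun_eq ((he _ (e.map_target hv)).1 (by rw [e.right_inv hv]))

/-- A subspace which is locally the zero set of a smooth map with surjective differential is a
submanifold. -/
theorem exists_submanifold {i : Z → X} (hi : IsEmbedding i)
    (hreg : ∀ z, ∃ (U : Set X) (h : X → W), IsOpen U ∧ i z ∈ U ∧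
      ContMDiffOn 𝓘(ℝ, E) 𝓘(ℝ, W) ∞ h U ∧ (∀ x ∈ U, h x = 0 ↔ x ∈ range i) ∧
      Surjective (mfderiv 𝓘(ℝ, E) 𝓘(ℝ, W) h (i z)))
    {n : ℕ} (hn : n = finrank ℝ E - finrank ℝ W) :
    ∃ (_ : ChartedSpace (EuclideanSpace ℝ (Fin n)) Z) (_ : IsManifold (𝓡 n) ∞ Z),
      IsSmoothEmbedding (𝓡 n) 𝓘(ℝ, E) ∞ i ∧
      ∀ z, Injective (mfderiv (𝓡 n) 𝓘(ℝ, E) i z) := by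
  choose U h hU hzU hh hzero hsurj using hreg
  have hdim : ∀ z : Z, finrank ℝ W + finrank ℝ (EuclideanSpace ℝ (Fin n)) = finrank ℝ E := by
    intro z
    have hle : finrank ℝ W ≤ finrank ℝ E :=
      LinearMap.finrank_le_finrank_of_surjective
        (f := (mfderiv 𝓘(ℝ, E) 𝓘(ℝ, W) (h z) (i z) : E →L[ℝ] W).toLinearMap) (hsurj z)
    rw [finrank_euclideanSpace_fin]; omega
  choose e hze heU heh hes het using fun z => exists_straightening_of_surjective
    (K := EuclideanSpace ℝ (Fin n)) (hU z) (hh z) (hzU z) (hsurj z) (hdim z)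
  have he : ∀ z, ∀ x ∈ (e z).source, (e z x).1 = 0 ↔ x ∈ range i := fun z x hx => by
    rw [heh z x hx, hzero z x (heU z hx)]
  let c : Z → OpenPartialHomeomorph Z (EuclideanSpace ℝ (Fin n)) :=
    fun z => sliceChart hi (e z) z (he z)
  have hc : ∀ z, z ∈ (c z).source := hze
  have hlift : ∀ z, ContMDiffOn 𝓘(ℝ, EuclideanSpace ℝ (Fin n)) 𝓘(ℝ, E) ∞
      (fun v => (e z).symm (0, v)) (c z).target := fun z =>
    (het z).comp (contMDiffOn_const.prodMk_space contMDiffOn_id) fun v hv => hv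
  let _ := chartedSpaceOfCharts c hc
  have : IsManifold (𝓡 n) ∞ Z := by
    refine isManifold_chartedSpaceOfCharts c hc fun z z' v hv hv' => ?_
    have h1 : ContMDiffAt 𝓘(ℝ, EuclideanSpace ℝ (Fin n)) 𝓘(ℝ, EuclideanSpace ℝ (Fin n)) ∞
        (fun v => (e z' ((e z).symm (0, v))).2) v := by
      refine (ContinuousLinearMap.snd ℝ W (EuclideanSpace ℝ (Fin n))).contMDiff.contMDiffAt.comp
        v ?_
      have h2 : (e z).symm (0, v) ∈ (e z').source := by
        rw [← sliceChart_symm hi (e z) z (he z) hv]; exact hv'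
      exact ((hes z').contMDiffAt ((e z').open_source.mem_nhds h2)).comp v
        ((hlift z).contMDiffAt ((c z).open_target.mem_nhds hv))
    refine h1.contDiffAt.congr_of_eventuallyEq ?_
    filter_upwards [(c z).open_target.mem_nhds hv] with w hw
    change (e z' (i ((c z).symm w))).2 = _
    rw [sliceChart_symm hi (e z) z (he z) hw]
  have hci : ∀ z, c z ∈ IsManifold.maximalAtlas (𝓡 n) ∞ Z := fun z =>
    IsManifold.chart_mem_maximalAtlas z
  have hism : ContMDiff (𝓡 n) 𝓘(ℝ, E) ∞ i := fun z => by
    have h1 : ContMDiffAt (𝓡 n) 𝓘(ℝ, E) ∞ (fun z' => (e z).symm (0, c z z')) z :=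
      ((hlift z).contMDiffAt ((c z).open_target.mem_nhds ((c z).map_source (hc z)))).comp z
        (contMDiffAt_of_mem_maximalAtlas (hci z) (hc z))
    refine h1.congr_of_eventuallyEq ?_
    filter_upwards [(c z).open_source.mem_nhds (hc z)] with z' hz'
    rw [← sliceChart_symm hi (e z) z (he z) ((c z).map_source hz')]
    exact congrArg i ((c z).left_inv hz').symm
  have hinj : ∀ z, Injective (mfderiv (𝓡 n) 𝓘(ℝ, E) i z) := fun z => by
    have h1 : MDifferentiableAt 𝓘(ℝ, E) 𝓘(ℝ, W × EuclideanSpace ℝ (Fin n)) (e z) (i z) :=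
      ((hes z).contMDiffAt ((e z).open_source.mem_nhds (hze z))).mdifferentiableAt (by simp)
    have h2 : MDifferentiableAt 𝓘(ℝ, E) (𝓡 n) (fun x => (e z x).2) (i z) :=
      (ContinuousLinearMap.snd ℝ W (EuclideanSpace ℝ (Fin n))).mdifferentiableAt.comp (i z) h1
    have h3 := mfderiv_comp z h2 (hism.mdifferentiableAt (by simp))
    -- The composite is the preferred chart of `Z` at `z`, so the derivative of the second
    -- coordinate of `e` is a left inverse of that of `i`.
    have h4 : mfderiv (𝓡 n) (𝓡 n) ((fun x => (e z x).2) ∘ i) z =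
        ContinuousLinearMap.id ℝ (EuclideanSpace ℝ (Fin n)) := mfderiv_chartAt_self z
    rw [h4] at h3
    refine HasLeftInverse.injective ⟨mfderiv 𝓘(ℝ, E) (𝓡 n) (fun x => (e z x).2) (i z), fun u => ?_⟩
    exact (congrArg (fun T : EuclideanSpace ℝ (Fin n) →L[ℝ] EuclideanSpace ℝ (Fin n) => T u)
      h3).symm
  exact ⟨inferInstance, inferInstance, ⟨isImmersion_of_injective_mfderiv hism hinj, hi⟩, hinj⟩

/-- The tangent space of a regular zero set is the kernel of the differential of the equation. -/
theorem exists_mfderiv_eq_of_mem_ker {n : ℕ} [ChartedSpace (EuclideanSpace ℝ (Fin n)) Z]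
    {i : Z → X} {z : Z} (hi : MDifferentiableAt (𝓡 n) 𝓘(ℝ, E) i z)
    (hinj : Injective (mfderiv (𝓡 n) 𝓘(ℝ, E) i z)) {h : X → W}
    (hh : MDifferentiableAt 𝓘(ℝ, E) 𝓘(ℝ, W) h (i z)) (h0 : ∀ᶠ z' in 𝓝 z, h (i z') = 0)
    (hs : Surjective (mfderiv 𝓘(ℝ, E) 𝓘(ℝ, W) h (i z))) (hn : n = finrank ℝ E - finrank ℝ W)
    (v : E) (hv : mfderiv 𝓘(ℝ, E) 𝓘(ℝ, W) h (i z) v = 0) :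
    ∃ u, mfderiv (𝓡 n) 𝓘(ℝ, E) i z u = v := by
  let A : EuclideanSpace ℝ (Fin n) →L[ℝ] E := mfderiv (𝓡 n) 𝓘(ℝ, E) i z
  let B : E →L[ℝ] W := mfderiv 𝓘(ℝ, E) 𝓘(ℝ, W) h (i z)
  have h1 := mfderiv_comp z hh hi
  have h2 : h ∘ i =ᶠ[𝓝 z] fun _ => 0 := h0
  rw [h2.mfderiv_eq, mfderiv_const] at h1
  have hBA : ∀ u, B (A u) = 0 := fun u =>
    (congrArg (fun T : EuclideanSpace ℝ (Fin n) →L[ℝ] W => T u) h1).symm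
  have hle : LinearMap.range A.toLinearMap ≤ LinearMap.ker B.toLinearMap := by
    rintro _ ⟨u, rfl⟩; exact hBA u
  have hdimB := LinearMap.finrank_range_add_finrank_ker B.toLinearMap
  rw [LinearMap.range_eq_top.2 (show Surjective B.toLinearMap from hs), finrank_top] at hdimB
  have heq := Submodule.eq_of_le_of_finrank_eq hle (by
    rw [LinearMap.finrank_range_of_inj (show Injective A.toLinearMap from hinj), finrank_euclideanSpace_fin]; omega)
  have hv' : v ∈ LinearMap.ker B.toLinearMap := hv
  rw [← heq] at hv'
  exact hv'

end Submanifold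

/-! ### Quotient manifolds from local slices. -/

section Quotient

open Module Manifold Topology

variable {E : Type*} [NormedAddCommGroup E] [NormedSpace ℝ E] [FiniteDimensional ℝ E]
  {X : Type*} [TopologicalSpace X] [ChartedSpace E X] [IsManifold 𝓘(ℝ, E) ∞ X]
  {V : Type*} [NormedAddCommGroup V] [NormedSpace ℝ V] [FiniteDimensional ℝ V]
  {Y : Type*} [TopologicalSpace Y]

/-- A local slice for the map `π : X → Y`: on the open set `U` the fibres of `π` are those of the
smooth map `ρ`, which has the smooth section `l`. -/
structure LocalSlice (π : X → Y) (V : Type*) [NormedAddCommGroup V] [NormedSpace ℝ V] where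
  U : Set X
  ρ : X → V
  T : Set V
  l : V → X
  isOpen_U : IsOpen U
  isOpen_T : IsOpen T
  contMDiffOn_ρ : ContMDiffOn 𝓘(ℝ, E) 𝓘(ℝ, V) ∞ ρ U
  contMDiffOn_l : ContMDiffOn 𝓘(ℝ, V) 𝓘(ℝ, E) ∞ l T
  mapsTo_ρ : MapsTo ρ U T
  mapsTo_l : MapsTo l T U
  ρ_l : ∀ v ∈ T, ρ (l v) = v
  fibre : ∀ u ∈ U, ∀ u' ∈ U, π u = π u' ↔ ρ u = ρ u'

namespace LocalSlice

variable {π : X → Y} (S : LocalSlice (E := E) π V)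

theorem π_l_ρ {u : X} (hu : u ∈ S.U) : π (S.l (S.ρ u)) = π u :=
  (S.fibre _ (S.mapsTo_l (S.mapsTo_ρ hu)) _ hu).2 (S.ρ_l _ (S.mapsTo_ρ hu))

/-- The function on `Y` induced by `ρ`. -/
def descend (x : X) : Y → V :=
  haveI : Nonempty X := ⟨x⟩
  fun y => S.ρ (invFunOn π S.U y)

theorem descend_apply (x : X) {u : X} (hu : u ∈ S.U) : S.descend x (π u) = S.ρ u := by
  have : Nonempty X := ⟨x⟩
  have h : ∃ a ∈ S.U, π a = π u := ⟨u, hu, rfl⟩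
  exact (S.fibre _ (invFunOn_mem h) _ hu).1 (invFunOn_eq h)

/-- The chart of `Y` given by a local slice. -/
def chart (hπ : IsOpenQuotientMap π) (x : X) : OpenPartialHomeomorph Y V where
  toFun := S.descend x
  invFun := fun v => π (S.l v)
  source := π '' S.U
  target := S.T
  map_source' := by
    rintro _ ⟨u, hu, rfl⟩
    rw [S.descend_apply x hu]; exact S.mapsTo_ρ hu
  map_target' := fun v hv => ⟨_, S.mapsTo_l hv, rfl⟩
  left_inv' := by
    rintro _ ⟨u, hu, rfl⟩
    rw [S.descend_apply x hu, S.π_l_ρ hu]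
  right_inv' := fun v hv => by rw [S.descend_apply x (S.mapsTo_l hv), S.ρ_l v hv]
  open_source := hπ.isOpenMap _ S.isOpen_U
  open_target := S.isOpen_T
  continuousOn_toFun := by
    rintro _ ⟨u, hu, rfl⟩
    refine ContinuousAt.continuousWithinAt ?_
    rw [← hπ.continuousAt_comp_iff]
    refine ContinuousAt.congr
      (S.contMDiffOn_ρ.continuousOn.continuousAt (S.isOpen_U.mem_nhds hu)) ?_
    filter_upwards [S.isOpen_U.mem_nhds hu] with u' hu'
    exact (S.descend_apply x hu').symm
  continuousOn_invFun := hπ.continuous.comp_continuousOn S.contMDiffOn_l.continuousOn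

end LocalSlice

/-- A quotient of a manifold which admits local slices, and whose fibres are permuted transitively
by smooth maps, is a manifold. -/
theorem exists_quotient_manifold {π : X → Y} (hπ : IsOpenQuotientMap π) {n : ℕ}
    (hmove : ∀ x x', π x = π x' → ∃ g : X → X, ContMDiff 𝓘(ℝ, E) 𝓘(ℝ, E) ∞ g ∧ g x = x' ∧
      ∀ z, π (g z) = π z)
    (hslice : ∀ x, ∃ S : LocalSlice (E := E) π (EuclideanSpace ℝ (Fin n)), x ∈ S.U) :
    ∃ (_ : ChartedSpace (EuclideanSpace ℝ (Fin n)) Y) (_ : IsManifold (𝓡 n) ∞ Y),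
      IsSubmersion 𝓘(ℝ, E) (𝓡 n) ∞ π := by
  choose S hS using hslice
  let r : Y → X := surjInv hπ.surjective
  have hr : ∀ y, π (r y) = y := surjInv_eq hπ.surjective
  let c : Y → OpenPartialHomeomorph Y (EuclideanSpace ℝ (Fin n)) :=
    fun y => (S (r y)).chart hπ (r y)
  have hc : ∀ y, y ∈ (c y).source := fun y => ⟨r y, hS _, hr y⟩
  -- Each chart is built from a slice at the chosen representative `r y`. A fibre-preserving smooth
  -- map brings a neighbourhood of any other point `x` over the chart into that slice.
  have hlocal : ∀ y x, π x ∈ (c y).source → ∃ g : X → X, ContMDiff 𝓘(ℝ, E) 𝓘(ℝ, E) ∞ g ∧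
      (∀ z, π (g z) = π z) ∧ ∀ᶠ z in 𝓝 x, g z ∈ (S (r y)).U := by
    rintro y x ⟨u, hu, hux⟩
    obtain ⟨g, hg, hgx, hgπ⟩ := hmove x u hux.symm
    refine ⟨g, hg, hgπ, hg.continuous.continuousAt.eventually_mem
      ((S (r y)).isOpen_U.mem_nhds ?_)⟩
    rwa [hgx]
  let _ := chartedSpaceOfCharts c hc
  have : IsManifold (𝓡 n) ∞ Y := by
    refine isManifold_chartedSpaceOfCharts c hc fun y y' v hv hv' => ?_
    obtain ⟨g, hg, hgπ, hgU⟩ := hlocal y' ((S (r y)).l v) hv'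
    have hl := (S (r y)).contMDiffOn_l.contMDiffAt ((S (r y)).isOpen_T.mem_nhds hv)
    have h1 : ContMDiffAt (𝓡 n) (𝓡 n) ∞ (fun w => (S (r y')).ρ (g ((S (r y)).l w))) v :=
      ((S (r y')).contMDiffOn_ρ.contMDiffAt ((S (r y')).isOpen_U.mem_nhds hgU.self_of_nhds)).comp v
        (hg.contMDiffAt.comp v hl)
    refine h1.contDiffAt.congr_of_eventuallyEq ?_
    filter_upwards [hl.continuousAt.eventually hgU] with w hw
    change (S (r y')).descend (r y') (π ((S (r y)).l w)) = _
    rw [← hgπ, (S (r y')).descend_apply _ hw]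
  have hca : ∀ y, c y ∈ IsManifold.maximalAtlas (𝓡 n) ∞ Y := fun y =>
    IsManifold.chart_mem_maximalAtlas y
  have hsm : ContMDiff 𝓘(ℝ, E) (𝓡 n) ∞ π := fun x => by
    obtain ⟨g, hg, hgπ, hgU⟩ := hlocal (π x) x (hc _)
    set S' := S (r (π x))
    have hx := hgU.self_of_nhds
    have h1 : ContMDiffAt 𝓘(ℝ, E) (𝓡 n) ∞ (fun z => (c (π x)).symm (S'.ρ (g z))) x :=
      (contMDiffAt_symm_of_mem_maximalAtlas (hca _) (S'.mapsTo_ρ hx)).comp x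
        ((S'.contMDiffOn_ρ.contMDiffAt (S'.isOpen_U.mem_nhds hx)).comp x hg.contMDiffAt)
    refine h1.congr_of_eventuallyEq ?_
    filter_upwards [hgU] with z hz
    change π z = π (S'.l (S'.ρ (g z)))
    rw [S'.π_l_ρ hz, hgπ]
  refine ⟨inferInstance, inferInstance, isSubmersion_of_surjective_mfderiv hsm fun x v => ?_⟩
  set S' := S (r (π x))
  have hsrc := hc (π x)
  -- The slice section need not pass through `x`; moving it along the fibre corrects this, and its
  -- derivative then gives a preimage of `v`.
  obtain ⟨g, hg, hgx, hgπ⟩ := hmove (S'.l (c (π x) (π x))) x ((c (π x)).left_inv hsrc)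
  have hs : ContMDiffOn (𝓡 n) 𝓘(ℝ, E) ∞ (fun y => g (S'.l (c (π x) y))) (c (π x)).source :=
    hg.comp_contMDiffOn (S'.contMDiffOn_l.comp (contMDiffOn_of_mem_maximalAtlas (hca _))
      fun y hy => (c (π x)).map_source hy)
  have h1 := mfderiv_comp_local_section (f := π) (c (π x)).open_source hsrc
    (fun y hy => (hgπ _).trans ((c (π x)).left_inv hy))
    ((hs.contMDiffAt ((c (π x)).open_source.mem_nhds hsrc)).mdifferentiableAt (by simp))
    (hsm.mdifferentiableAt (by simp)) v
  rw [hgx] at h1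
  exact ⟨_, h1⟩

end Quotient


/-! ### The Lie bracket from second derivatives of the multiplication. -/

section LieCalculus

variable {E : Type*} [NormedAddCommGroup E] [NormedSpace ℝ E]
  {Γ : Type*} [TopologicalSpace Γ] [ChartedSpace E Γ] [Group Γ] [LieGroup 𝓘(ℝ, E) ∞ Γ]
  {E₁ : Type*} [NormedAddCommGroup E₁] [NormedSpace ℝ E₁]

variable (E Γ) in
/-- The preferred chart at the identity. -/
abbrev chartOne : OpenPartialHomeomorph Γ E := chartAt E (1 : Γ)

variable (E Γ) in
/-- The multiplication in the chart at the identity. -/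
def mulChart (p : E × E) : E :=
  chartOne E Γ ((chartOne E Γ).symm p.1 * (chartOne E Γ).symm p.2)

variable (E Γ) in
/-- The coordinates of the identity. -/
def coordOne : E := chartOne E Γ 1

theorem one_mem_chartOne : (1 : Γ) ∈ (chartOne E Γ).source := mem_chart_source E 1

theorem coordOne_mem : coordOne E Γ ∈ (chartOne E Γ).target :=
  (chartOne E Γ).map_source one_mem_chartOne

theorem chartOne_symm_coordOne : (chartOne E Γ).symm (coordOne E Γ) = 1 :=
  (chartOne E Γ).left_inv one_mem_chartOne

theorem isManifold_group : IsManifold 𝓘(ℝ, E) ∞ Γ := inferInstance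

theorem contMDiffAt_chartOne {γ : Γ} (h : γ ∈ (chartOne E Γ).source) :
    ContMDiffAt 𝓘(ℝ, E) 𝓘(ℝ, E) ∞ (chartOne E Γ) γ :=
  contMDiffAt_of_mem_maximalAtlas (IsManifold.chart_mem_maximalAtlas _) h

theorem contMDiffAt_chartOne_symm {x : E} (h : x ∈ (chartOne E Γ).target) :
    ContMDiffAt 𝓘(ℝ, E) 𝓘(ℝ, E) ∞ (chartOne E Γ).symm x :=
  contMDiffAt_symm_of_mem_maximalAtlas (IsManifold.chart_mem_maximalAtlas _) h

theorem contDiffAt_mulChart {p : E × E} (h1 : p.1 ∈ (chartOne E Γ).target)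
    (h2 : p.2 ∈ (chartOne E Γ).target)
    (h : (chartOne E Γ).symm p.1 * (chartOne E Γ).symm p.2 ∈ (chartOne E Γ).source) :
    ContDiffAt ℝ ∞ (mulChart E Γ) p := by
  refine ContMDiffAt.contDiffAt ?_
  refine (contMDiffAt_chartOne h).comp p (ContMDiffAt.mul ?_ ?_)
  · exact (contMDiffAt_chartOne_symm h1).comp p contDiff_fst.contMDiff.contMDiffAt
  · exact (contMDiffAt_chartOne_symm h2).comp p contDiff_snd.contMDiff.contMDiffAt

theorem contDiffAt_mulChart_one :
    ContDiffAt ℝ ∞ (mulChart E Γ) (coordOne E Γ, coordOne E Γ) :=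
  contDiffAt_mulChart coordOne_mem coordOne_mem (by
    simp only [chartOne_symm_coordOne, mul_one]; exact one_mem_chartOne)

theorem contDiffAt_mulChart_right {x : E} (hx : x ∈ (chartOne E Γ).target) :
    ContDiffAt ℝ ∞ (mulChart E Γ) (coordOne E Γ, x) :=
  contDiffAt_mulChart coordOne_mem hx (by
    simp only [chartOne_symm_coordOne, one_mul]; exact (chartOne E Γ).map_target hx)

theorem contDiffAt_mulChart_left {x : E} (hx : x ∈ (chartOne E Γ).target) :
    ContDiffAt ℝ ∞ (mulChart E Γ) (x, coordOne E Γ) :=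
  contDiffAt_mulChart hx coordOne_mem (by
    simp only [chartOne_symm_coordOne, mul_one]; exact (chartOne E Γ).map_target hx)

/-- Derivative of the unit law `x * 1 = x`. -/
theorem fderiv_mulChart_one_left (v : E) :
    fderiv ℝ (mulChart E Γ) (coordOne E Γ, coordOne E Γ) (v, 0) = v := by
  have h1 : HasFDerivAt (fun x : E => (x, coordOne E Γ)) (ContinuousLinearMap.inl ℝ E E)
      (coordOne E Γ) := hasFDerivAt_prodMk_left _ _
  have h2 := HasFDerivAt.comp (coordOne E Γ) (g := mulChart E Γ)
    (f := fun x : E => (x, coordOne E Γ))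
    (contDiffAt_mulChart_one.differentiableAt (by simp)).hasFDerivAt h1
  have h3 : (mulChart E Γ ∘ fun x : E => (x, coordOne E Γ)) =ᶠ[𝓝 (coordOne E Γ)] id := by
    filter_upwards [(chartOne E Γ).open_target.mem_nhds coordOne_mem] with x hx
    simp only [comp_apply, mulChart, chartOne_symm_coordOne, mul_one, id_eq]
    exact (chartOne E Γ).right_inv hx
  have h4 := h2.fderiv
  rw [h3.fderiv_eq, fderiv_id] at h4
  exact (DFunLike.congr_fun h4 v).symm

variable (E Γ) in
/-- The second derivative of the multiplication at the identity, in the chart at the identity. -/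
def mulHess : (E × E) →L[ℝ] (E × E) →L[ℝ] E :=
  fderiv ℝ (fderiv ℝ (mulChart E Γ)) (coordOne E Γ, coordOne E Γ)

theorem mulHess_symm (p q : E × E) : mulHess E Γ p q = mulHess E Γ q p :=
  (contDiffAt_mulChart_one.isSymmSndFDerivAt (by simp; exact WithTop.coe_le_coe.2 le_top)).eq p q

theorem hasFDerivAt_fderiv_mulChart :
    HasFDerivAt (fderiv ℝ (mulChart E Γ)) (mulHess E Γ) (coordOne E Γ, coordOne E Γ) :=
  ((contDiffAt_mulChart_one.fderiv_right (m := ∞) (by simp)).differentiableAt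
    (by simp)).hasFDerivAt

/-- The differential of a map into the group which takes the value `1`, computed in the chart at
the identity. -/
theorem mfderiv_eq_fderiv_chartOne {f : E₁ → Γ} {a : E₁} (hfa : f a = 1)
    (hf : MDifferentiableAt 𝓘(ℝ, E₁) 𝓘(ℝ, E) f a) :
    mfderiv 𝓘(ℝ, E₁) 𝓘(ℝ, E) f a = fderiv ℝ (fun w => chartOne E Γ (f w)) a := by
  have h := mfderiv_chartAt_comp hf
  rw [hfa] at h
  rw [← h, mfderiv_eq_fderiv]

/-- `T_1 Γ` is identified with `E` by this very chart, so the inverse chart has identity derivative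
at the coordinates of `1`. -/
theorem mfderiv_comp_chartOne_symm {N : Type*} [TopologicalSpace N] [ChartedSpace E₁ N]
    {f : Γ → N} (hf : MDifferentiableAt 𝓘(ℝ, E) 𝓘(ℝ, E₁) f 1) :
    mfderiv 𝓘(ℝ, E) 𝓘(ℝ, E₁) (fun x => f ((chartOne E Γ).symm x)) (coordOne E Γ) =
      mfderiv 𝓘(ℝ, E) 𝓘(ℝ, E₁) f 1 := by
  have h1 : MDifferentiableAt 𝓘(ℝ, E) 𝓘(ℝ, E) (chartOne E Γ).symm (coordOne E Γ) :=
    (contMDiffAt_chartOne_symm coordOne_mem).mdifferentiableAt (by simp)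
  have h2 : mfderiv 𝓘(ℝ, E) 𝓘(ℝ, E) (chartOne E Γ).symm (coordOne E Γ) =
      ContinuousLinearMap.id ℝ E := by
    rw [mfderiv_eq_fderiv_chartOne (Γ := Γ) chartOne_symm_coordOne h1]
    have : (fun w => chartOne E Γ ((chartOne E Γ).symm w)) =ᶠ[𝓝 (coordOne E Γ)] id := by
      filter_upwards [(chartOne E Γ).open_target.mem_nhds coordOne_mem] with x hx
      exact (chartOne E Γ).right_inv hx
    rw [this.fderiv_eq, fderiv_id]
  have h3 := mfderiv_comp (I := 𝓘(ℝ, E)) (I' := 𝓘(ℝ, E)) (I'' := 𝓘(ℝ, E₁)) (coordOne E Γ)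
    (g := f) (f := (chartOne E Γ).symm) (by rw [chartOne_symm_coordOne]; exact hf) h1
  rw [h2, chartOne_symm_coordOne] at h3
  exact h3

variable (Γ) in
/-- The bracket of the Lie algebra, in coordinates. -/
def brk (X Y : E) : E := mulHess E Γ (X, 0) (0, Y) - mulHess E Γ (Y, 0) (0, X)

theorem brk_swap (X Y : E) : brk Γ Y X = -brk Γ X Y := by simp [brk]

/-- The bracket of the Lie algebra in terms of the multiplication in the chart at `1`. -/
theorem bracket_eq_brk (X Y : GroupLieAlgebra 𝓘(ℝ, E) Γ) :
    (⁅X, Y⁆ : GroupLieAlgebra 𝓘(ℝ, E) Γ) = brk (E := E) Γ X Y := by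
  have hid : mfderiv 𝓘(ℝ, E) 𝓘(ℝ, E) (chartOne E Γ) 1 = ContinuousLinearMap.id ℝ E :=
    mfderiv_chartAt_self 1
  -- In coordinates the left-invariant field of `Z` at `x` is the partial derivative of the
  -- multiplication in its second argument; the bracket of two such fields then involves only the
  -- Hessian at the identity.
  have key : ∀ Z : GroupLieAlgebra 𝓘(ℝ, E) Γ, ∀ x ∈ (chartOne E Γ).target,
      VectorField.mpullbackWithin 𝓘(ℝ, E) 𝓘(ℝ, E) (extChartAt 𝓘(ℝ, E) (1 : Γ)).symm
        (mulInvariantVectorField Z) (range 𝓘(ℝ, E)) x =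
      fderiv ℝ (mulChart E Γ) (x, coordOne E Γ) (0, (Z : E)) := by
    intro Z x hx
    set g := (chartOne E Γ).symm x with hg
    have hgs : g ∈ (chartOne E Γ).source := (chartOne E Γ).map_target hx
    have hxg : chartOne E Γ g = x := (chartOne E Γ).right_inv hx
    have hd1 : MDifferentiableAt 𝓘(ℝ, E) 𝓘(ℝ, E) (chartOne E Γ).symm x :=
      (contMDiffAt_chartOne_symm hx).mdifferentiableAt (by simp)
    have hd2 : MDifferentiableAt 𝓘(ℝ, E) 𝓘(ℝ, E) (chartOne E Γ) g :=
      (contMDiffAt_chartOne hgs).mdifferentiableAt (by simp)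
    let A : E →L[ℝ] E := mfderiv 𝓘(ℝ, E) 𝓘(ℝ, E) (chartOne E Γ).symm x
    let B : E →L[ℝ] E := mfderiv 𝓘(ℝ, E) 𝓘(ℝ, E) (chartOne E Γ) g
    have hBA : B ∘L A = ContinuousLinearMap.id ℝ E := by
      have h1 := mfderiv_comp x (g := chartOne E Γ) (f := (chartOne E Γ).symm) hd2 hd1
      have h2 : (chartOne E Γ ∘ (chartOne E Γ).symm) =ᶠ[𝓝 x] id := by
        filter_upwards [(chartOne E Γ).open_target.mem_nhds hx] with y hy
        exact (chartOne E Γ).right_inv hy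
      rw [h2.mfderiv_eq, mfderiv_id] at h1
      exact h1.symm
    have hAB : A ∘L B = ContinuousLinearMap.id ℝ E := by
      have h1 := mfderiv_comp g (g := (chartOne E Γ).symm) (f := chartOne E Γ)
        (by rw [hxg]; exact hd1) hd2
      have h2 : ((chartOne E Γ).symm ∘ chartOne E Γ) =ᶠ[𝓝 g] id := by
        filter_upwards [(chartOne E Γ).open_source.mem_nhds hgs] with y hy
        exact (chartOne E Γ).left_inv hy
      rw [h2.mfderiv_eq, mfderiv_id, hxg] at h1
      exact h1.symm
    have hinv : A.inverse = B := ContinuousLinearMap.inverse_eq hAB hBA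
    have hmul : ContMDiff 𝓘(ℝ, E) 𝓘(ℝ, E) ∞ (fun h : Γ => g * h) := contMDiff_mul_left
    have h3 : VectorField.mpullbackWithin 𝓘(ℝ, E) 𝓘(ℝ, E) (extChartAt 𝓘(ℝ, E) (1 : Γ)).symm
        (mulInvariantVectorField Z) (range 𝓘(ℝ, E)) x =
        B ((mfderiv 𝓘(ℝ, E) 𝓘(ℝ, E) (fun h : Γ => g * h) 1 : E →L[ℝ] E) Z) := by
      rw [← hinv]
      simp only [VectorField.mpullbackWithin_apply, modelWithCornersSelf_coe, range_id,
        mfderivWithin_univ]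
      rfl
    rw [h3]
    have hF : MDifferentiableAt 𝓘(ℝ, E) 𝓘(ℝ, E) (fun h : Γ => chartOne E Γ (g * h)) 1 :=
      MDifferentiableAt.comp (I' := 𝓘(ℝ, E)) (g := chartOne E Γ) (f := fun h : Γ => g * h) 1
        (by rw [mul_one]; exact hd2) (hmul.mdifferentiableAt (by simp))
    have h4 := mfderiv_comp (1 : Γ) (g := chartOne E Γ) (f := fun h : Γ => g * h)
      (by rw [mul_one]; exact hd2) (hmul.mdifferentiableAt (by simp))
    rw [mul_one] at h4
    have h5 := mfderiv_comp_chartOne_symm hF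
    have h6 : HasFDerivAt (fun y : E => mulChart E Γ (x, y))
        (fderiv ℝ (mulChart E Γ) (x, coordOne E Γ) ∘L ContinuousLinearMap.inr ℝ E E)
        (coordOne E Γ) :=
      HasFDerivAt.comp (coordOne E Γ) (g := mulChart E Γ)
        ((contDiffAt_mulChart_left hx).differentiableAt (by simp)).hasFDerivAt
        (hasFDerivAt_prodMk_right _ _)
    have h7 : mfderiv 𝓘(ℝ, E) 𝓘(ℝ, E)
        (fun y => chartOne E Γ (g * (chartOne E Γ).symm y)) (coordOne E Γ) =
        fderiv ℝ (mulChart E Γ) (x, coordOne E Γ) ∘L ContinuousLinearMap.inr ℝ E E := by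
      rw [mfderiv_eq_fderiv]
      exact h6.fderiv
    have h8 := (h4.symm.trans (h5.symm.trans h7))
    exact DFunLike.congr_fun (F := E →L[ℝ] E) h8 Z
  have hD : ∀ Z : E, HasFDerivAt
      (fun x : E => fderiv ℝ (mulChart E Γ) (x, coordOne E Γ) (0, Z))
      ((ContinuousLinearMap.apply ℝ E ((0, Z) : E × E)) ∘L
        (mulHess E Γ ∘L ContinuousLinearMap.inl ℝ E E)) (coordOne E Γ) := fun Z =>
    (ContinuousLinearMap.apply ℝ E ((0, Z) : E × E)).hasFDerivAt.comp (coordOne E Γ)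
      (HasFDerivAt.comp (coordOne E Γ) (g := fderiv ℝ (mulChart E Γ))
        hasFDerivAt_fderiv_mulChart (hasFDerivAt_prodMk_left _ _))
  have h0 : ∀ Z : E, fderiv ℝ (mulChart E Γ) (coordOne E Γ, coordOne E Γ) (0, Z) = Z := by
    intro Z
    have h1 : HasFDerivAt (fun x : E => (coordOne E Γ, x)) (ContinuousLinearMap.inr ℝ E E)
        (coordOne E Γ) := hasFDerivAt_prodMk_right _ _
    have h2 := HasFDerivAt.comp (coordOne E Γ) (g := mulChart E Γ)
      (contDiffAt_mulChart_one.differentiableAt (by simp)).hasFDerivAt h1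
    have h3 : (mulChart E Γ ∘ fun x : E => (coordOne E Γ, x)) =ᶠ[𝓝 (coordOne E Γ)] id := by
      filter_upwards [(chartOne E Γ).open_target.mem_nhds coordOne_mem] with x hx
      simp only [comp_apply, mulChart, chartOne_symm_coordOne, one_mul, id_eq]
      exact (chartOne E Γ).right_inv hx
    have h4 := h2.fderiv
    rw [h3.fderiv_eq, fderiv_id] at h4
    exact (DFunLike.congr_fun h4 Z).symm
  have hev : ∀ Z : GroupLieAlgebra 𝓘(ℝ, E) Γ,
      (VectorField.mpullbackWithin 𝓘(ℝ, E) 𝓘(ℝ, E) (extChartAt 𝓘(ℝ, E) (1 : Γ)).symm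
        (mulInvariantVectorField Z) (range 𝓘(ℝ, E)) : E → E) =ᶠ[𝓝 (coordOne E Γ)]
      fun x : E => fderiv ℝ (mulChart E Γ) (x, coordOne E Γ) (0, (Z : E)) := fun Z => by
    filter_upwards [(chartOne E Γ).open_target.mem_nhds coordOne_mem] with x hx using key Z x hx
  have hl₀ : ∀ X Y : E, VectorField.lieBracket ℝ
      (fun x : E => fderiv ℝ (mulChart E Γ) (x, coordOne E Γ) (0, X))
      (fun x : E => fderiv ℝ (mulChart E Γ) (x, coordOne E Γ) (0, Y)) (coordOne E Γ) =
      mulHess E Γ (X, 0) (0, Y) - mulHess E Γ (Y, 0) (0, X) := fun X Y => by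
    rw [VectorField.lieBracket, (hD X).fderiv, (hD Y).fderiv, h0, h0]
    rfl
  have hl := (Filter.EventuallyEq.lieBracket_vectorField_eq (hev X) (hev Y)).trans (hl₀ X Y)
  rw [GroupLieAlgebra.bracket_def]
  rw [← VectorField.mlieBracketWithin_univ, VectorField.mlieBracketWithin_apply]
  simp only [preimage_univ, modelWithCornersSelf_coe, range_id, inter_univ] at hl ⊢
  -- The bracket on the manifold is the coordinate bracket pulled back by the derivative of the
  -- chart, which is the identity at `1`.
  let A : E →L[ℝ] E := mfderiv 𝓘(ℝ, E) 𝓘(ℝ, E) (chartOne E Γ) 1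
  have hA : A.inverse = ContinuousLinearMap.id ℝ E := by
    rw [show A = ContinuousLinearMap.id ℝ E from hid, ContinuousLinearMap.inverse_id]
  refine Eq.trans ?_ (DFunLike.congr_fun hA _)
  refine congrArg A.inverse ?_
  exact (congrFun VectorField.lieBracketWithin_univ _).trans hl

end LieCalculus


/-! ### The adjoint and coadjoint representations and their differentials. -/

section LieCalculus

variable {E : Type*} [NormedAddCommGroup E] [NormedSpace ℝ E]
  {Γ : Type*} [TopologicalSpace Γ] [ChartedSpace E Γ] [Group Γ] [LieGroup 𝓘(ℝ, E) ∞ Γ]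
  {E₁ : Type*} [NormedAddCommGroup E₁] [NormedSpace ℝ E₁]

variable (E) in
/-- The adjoint representation, on the model space. -/
def AdL (γ : Γ) : E →L[ℝ] E := Ad E γ

theorem AdL_mul (γ δ : Γ) : AdL E (γ * δ) = AdL E γ ∘L AdL E δ := Ad_mul γ δ

theorem AdL_one : AdL E (1 : Γ) = ContinuousLinearMap.id ℝ E := by
  have h : (fun h : Γ => 1 * h * 1⁻¹) = id := by ext; simp
  change (mfderiv 𝓘(ℝ, E) 𝓘(ℝ, E) (fun h : Γ => 1 * h * 1⁻¹) 1 : E →L[ℝ] E) = _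
  rw [h]
  exact mfderiv_id

theorem AdL_inv_apply (γ : Γ) (X : E) : AdL E γ⁻¹ (AdL E γ X) = X := by
  have := AdL_mul (E := E) γ⁻¹ γ
  rw [inv_mul_cancel, AdL_one] at this
  exact (DFunLike.congr_fun this X).symm

theorem AdL_apply_inv (γ : Γ) (X : E) : AdL E γ (AdL E γ⁻¹ X) = X := by
  simpa using AdL_inv_apply γ⁻¹ X

theorem AdL_eq_fderiv (γ : Γ) : AdL E γ = fderiv ℝ
    (fun y => chartOne E Γ (γ * (chartOne E Γ).symm y * γ⁻¹)) (coordOne E Γ) := by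
  have h1 := mfderiv_comp_chartOne_symm (f := fun h : Γ => γ * h * γ⁻¹)
    ((contMDiff_conj (E := E) γ).mdifferentiableAt (by simp))
  have hd : MDifferentiableAt 𝓘(ℝ, E) 𝓘(ℝ, E)
      (fun x => γ * (chartOne E Γ).symm x * γ⁻¹) (coordOne E Γ) :=
    ((contMDiff_conj (E := E) γ).contMDiffAt.comp (coordOne E Γ)
      (contMDiffAt_chartOne_symm coordOne_mem)).mdifferentiableAt (by simp)
  have h2 := mfderiv_eq_fderiv_chartOne (f := fun x => γ * (chartOne E Γ).symm x * γ⁻¹)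
    (a := coordOne E Γ) (by simp [chartOne_symm_coordOne]) hd
  exact h1.symm.trans h2

variable (E Γ) in
/-- Conjugation in the chart at the identity. -/
def conjChart (p : E × E) : E :=
  chartOne E Γ ((chartOne E Γ).symm p.1 * (chartOne E Γ).symm p.2 * ((chartOne E Γ).symm p.1)⁻¹)

theorem contDiffAt_conjChart {x : E} (hx : x ∈ (chartOne E Γ).target) :
    ContDiffAt ℝ ∞ (conjChart E Γ) (x, coordOne E Γ) := by
  refine ContMDiffAt.contDiffAt ?_
  refine (contMDiffAt_chartOne ?_).comp (x, coordOne E Γ)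
    (ContMDiffAt.mul (ContMDiffAt.mul ?_ ?_) (ContMDiffAt.inv ?_))
  · simp only [chartOne_symm_coordOne, mul_one, mul_inv_cancel]; exact one_mem_chartOne
  · exact (contMDiffAt_chartOne_symm hx).comp (x, coordOne E Γ)
      contDiff_fst.contMDiff.contMDiffAt
  · exact (contMDiffAt_chartOne_symm coordOne_mem).comp (x, coordOne E Γ)
      contDiff_snd.contMDiff.contMDiffAt
  · exact (contMDiffAt_chartOne_symm hx).comp (x, coordOne E Γ)
      contDiff_fst.contMDiff.contMDiffAt

/-- Expressing `Ad` as a partial derivative of one smooth function of two variables gives its smooth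
dependence on the group element. -/
theorem AdL_chartOne_symm {x : E} (hx : x ∈ (chartOne E Γ).target) :
    AdL E ((chartOne E Γ).symm x) =
      fderiv ℝ (conjChart E Γ) (x, coordOne E Γ) ∘L ContinuousLinearMap.inr ℝ E E := by
  rw [AdL_eq_fderiv]
  have h := HasFDerivAt.comp (coordOne E Γ) (g := conjChart E Γ) (f := fun y : E => (x, y))
    ((contDiffAt_conjChart hx).differentiableAt (by simp)).hasFDerivAt
    (hasFDerivAt_prodMk_right _ _)
  exact h.fderiv

theorem contDiffAt_AdL_chartOne_symm :
    ContDiffAt ℝ ∞ (fun x => AdL E ((chartOne E Γ).symm x)) (coordOne E Γ) := by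
  have h1 : ContDiffAt ℝ ∞ (fun x : E => fderiv ℝ (conjChart E Γ) (x, coordOne E Γ))
      (coordOne E Γ) :=
    ContDiffAt.comp (coordOne E Γ) (g := fderiv ℝ (conjChart E Γ))
      ((contDiffAt_conjChart coordOne_mem).fderiv_right (m := ∞) (by simp))
      (contDiffAt_id.prodMk contDiffAt_const)
  have h2 : ContDiffAt ℝ ∞ (fun x : E => fderiv ℝ (conjChart E Γ) (x, coordOne E Γ) ∘L
      ContinuousLinearMap.inr ℝ E E) (coordOne E Γ) := h1.clm_comp contDiffAt_const
  refine h2.congr_of_eventuallyEq ?_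
  filter_upwards [(chartOne E Γ).open_target.mem_nhds coordOne_mem] with x hx
    using AdL_chartOne_symm hx

/-- Smoothness near `1` comes from conjugation in the chart; the homomorphism property `Ad γ = Ad γ₀
∘ Ad (γ₀⁻¹ γ)` carries it to every `γ₀`. -/
theorem contMDiff_AdL : ContMDiff 𝓘(ℝ, E) 𝓘(ℝ, E →L[ℝ] E) ∞ (AdL E : Γ → E →L[ℝ] E) := by
  have h1 : ContMDiffAt 𝓘(ℝ, E) 𝓘(ℝ, E →L[ℝ] E) ∞ (AdL E : Γ → E →L[ℝ] E) 1 := by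
    have h2 : ContMDiffAt 𝓘(ℝ, E) 𝓘(ℝ, E →L[ℝ] E) ∞
        (fun γ : Γ => AdL E ((chartOne E Γ).symm (chartOne E Γ γ))) 1 :=
      contDiffAt_AdL_chartOne_symm.contMDiffAt.comp (1 : Γ)
        (contMDiffAt_chartOne one_mem_chartOne)
    refine h2.congr_of_eventuallyEq ?_
    filter_upwards [(chartOne E Γ).open_source.mem_nhds one_mem_chartOne] with γ hγ
    rw [(chartOne E Γ).left_inv hγ]
  intro γ₀
  have h3 : (AdL E : Γ → E →L[ℝ] E) = fun γ => AdL E γ₀ ∘L AdL E (γ₀⁻¹ * γ) := by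
    funext γ; rw [← AdL_mul, mul_inv_cancel_left]
  rw [h3]
  refine ContMDiffAt.clm_comp contMDiffAt_const ?_
  refine ContMDiffAt.comp γ₀ (g := (AdL E : Γ → E →L[ℝ] E)) (f := fun γ => γ₀⁻¹ * γ)
    (by rw [inv_mul_cancel]; exact h1) ?_
  exact contMDiff_mul_left.contMDiffAt

/-- Derivative at `h = 1` of `(γ h γ⁻¹) γ = γ h`, where `γ` has coordinates `x`. Differentiating
once more in `x` produces the bracket. -/
theorem fderiv_mulChart_AdL {x : E} (hx : x ∈ (chartOne E Γ).target) (Y : E) :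
    fderiv ℝ (mulChart E Γ) (coordOne E Γ, x) (AdL E ((chartOne E Γ).symm x) Y, 0) =
      fderiv ℝ (mulChart E Γ) (x, coordOne E Γ) (0, Y) := by
  set γ := (chartOne E Γ).symm x with hγ
  let a : E → E := fun y => chartOne E Γ (γ * (chartOne E Γ).symm y * γ⁻¹)
  have ha0 : a (coordOne E Γ) = coordOne E Γ := by
    simp [a, coordOne]
  have hconj : ContMDiffAt 𝓘(ℝ, E) 𝓘(ℝ, E) ∞
      (fun x => γ * (chartOne E Γ).symm x * γ⁻¹) (coordOne E Γ) :=
    (contMDiff_conj (E := E) γ).contMDiffAt.comp (coordOne E Γ)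
      (contMDiffAt_chartOne_symm coordOne_mem)
  have h1m : γ * (chartOne E Γ).symm (coordOne E Γ) * γ⁻¹ = 1 := by
    simp [chartOne_symm_coordOne]
  have ha : DifferentiableAt ℝ a (coordOne E Γ) := by
    refine (ContMDiffAt.contDiffAt (n := ∞) ?_).differentiableAt (by simp)
    exact (contMDiffAt_chartOne (by rw [h1m]; exact one_mem_chartOne)).comp (coordOne E Γ) hconj
  have h1 : HasFDerivAt (fun y => mulChart E Γ (a y, x))
      (fderiv ℝ (mulChart E Γ) (coordOne E Γ, x) ∘L
        (AdL E γ).prod (0 : E →L[ℝ] E)) (coordOne E Γ) := by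
    have h2 : HasFDerivAt (fun y => (a y, x)) ((AdL E γ).prod (0 : E →L[ℝ] E)) (coordOne E Γ) := by
      rw [AdL_eq_fderiv]
      exact ha.hasFDerivAt.prodMk (hasFDerivAt_const x _)
    refine HasFDerivAt.comp (coordOne E Γ) (g := mulChart E Γ) (f := fun y => (a y, x)) ?_ h2
    rw [ha0]
    exact ((contDiffAt_mulChart_right hx).differentiableAt (by simp)).hasFDerivAt
  have h2 := HasFDerivAt.comp (coordOne E Γ) (g := mulChart E Γ) (f := fun y : E => (x, y))
    ((contDiffAt_mulChart_left hx).differentiableAt (by simp)).hasFDerivAt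
    (hasFDerivAt_prodMk_right _ _)
  have h3 : (fun y => mulChart E Γ (a y, x)) =ᶠ[𝓝 (coordOne E Γ)]
      (mulChart E Γ ∘ fun y : E => (x, y)) := by
    filter_upwards [hconj.continuousAt.preimage_mem_nhds
      ((chartOne E Γ).open_source.mem_nhds (by rw [h1m]; exact one_mem_chartOne))] with y hy
    simp only [mulChart, comp_apply, a]
    rw [(chartOne E Γ).left_inv hy, ← hγ, inv_mul_cancel_right]
  have h4 := h1.fderiv
  rw [h3.fderiv_eq, h2.fderiv] at h4
  exact (DFunLike.congr_fun h4 Y).symm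

/-- The differential of the adjoint representation is the bracket. -/
theorem fderiv_AdL_chartOne_symm (X Y : E) :
    fderiv ℝ (fun x => AdL E ((chartOne E Γ).symm x)) (coordOne E Γ) X Y = brk Γ X Y := by
  have ha := (contDiffAt_AdL_chartOne_symm (E := E) (Γ := Γ)).differentiableAt (by simp)
  have h1 : HasFDerivAt (fun x => fderiv ℝ (mulChart E Γ) (coordOne E Γ, x))
      (mulHess E Γ ∘L ContinuousLinearMap.inr ℝ E E) (coordOne E Γ) :=
    HasFDerivAt.comp (coordOne E Γ) (g := fderiv ℝ (mulChart E Γ))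
      (f := fun x : E => (coordOne E Γ, x)) hasFDerivAt_fderiv_mulChart
      (hasFDerivAt_prodMk_right _ _)
  have h2 : HasFDerivAt (fun x => fderiv ℝ (mulChart E Γ) (x, coordOne E Γ))
      (mulHess E Γ ∘L ContinuousLinearMap.inl ℝ E E) (coordOne E Γ) :=
    HasFDerivAt.comp (coordOne E Γ) (g := fderiv ℝ (mulChart E Γ))
      (f := fun x : E => (x, coordOne E Γ)) hasFDerivAt_fderiv_mulChart
      (hasFDerivAt_prodMk_left _ _)
  have h3 : HasFDerivAt (fun x => ((AdL E ((chartOne E Γ).symm x) Y, 0) : E × E))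
      (ContinuousLinearMap.inl ℝ E E ∘L (ContinuousLinearMap.apply ℝ E Y ∘L
        fderiv ℝ (fun x => AdL E ((chartOne E Γ).symm x)) (coordOne E Γ))) (coordOne E Γ) :=
    (ContinuousLinearMap.inl ℝ E E).hasFDerivAt.comp (coordOne E Γ)
      ((ContinuousLinearMap.apply ℝ E Y).hasFDerivAt.comp (coordOne E Γ) ha.hasFDerivAt)
  have h4 := h1.clm_apply h3
  have h5 := h2.clm_apply (hasFDerivAt_const (𝕜 := ℝ) ((0, Y) : E × E) (coordOne E Γ))
  -- Differentiated along `X`, the left side gives `mulHess (0, X) (Y, 0)` plus the derivative of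
  -- `Ad` applied to `Y`, the right side `mulHess (X, 0) (0, Y)`; symmetry of the Hessian turns the
  -- difference into `brk`.
  have h6 : (fun x => fderiv ℝ (mulChart E Γ) (coordOne E Γ, x)
        ((AdL E ((chartOne E Γ).symm x) Y, 0) : E × E)) =ᶠ[𝓝 (coordOne E Γ)]
      fun x => fderiv ℝ (mulChart E Γ) (x, coordOne E Γ) (0, Y) := by
    filter_upwards [(chartOne E Γ).open_target.mem_nhds coordOne_mem] with x hx
      using fderiv_mulChart_AdL hx Y
  have h7 := h6.fderiv_eq (𝕜 := ℝ)
  rw [h4.fderiv, h5.fderiv] at h7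
  have h8 := DFunLike.congr_fun h7 X
  simp only [chartOne_symm_coordOne, AdL_one, add_apply,
    ContinuousLinearMap.comp_apply, ContinuousLinearMap.flip_apply,
    ContinuousLinearMap.inr_apply, ContinuousLinearMap.inl_apply,
    ContinuousLinearMap.apply_apply, zero_apply, map_zero, zero_add,
    ContinuousLinearMap.id_apply, fderiv_mulChart_one_left] at h8
  rw [mulHess_symm (0, X)] at h8
  rw [brk, ← h8]
  abel

/-- The coadjoint action, on the dual of the model space. -/
def coAdL (γ : Γ) (β : E →L[ℝ] ℝ) : E →L[ℝ] ℝ := β ∘L AdL E γ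

theorem coAdL_apply (γ : Γ) (β : E →L[ℝ] ℝ) (X : E) : coAdL γ β X = β (AdL E γ X) := rfl

theorem coAdL_coAdL (γ δ : Γ) (β : E →L[ℝ] ℝ) : coAdL δ (coAdL γ β) = coAdL (γ * δ) β :=
  coAd_coAd γ δ β

theorem coAdL_one (β : E →L[ℝ] ℝ) : coAdL (1 : Γ) β = β := by
  rw [coAdL, AdL_one]; rfl

theorem contMDiff_coAdL (β : E →L[ℝ] ℝ) :
    ContMDiff 𝓘(ℝ, E) 𝓘(ℝ, E →L[ℝ] ℝ) ∞ (fun γ : Γ => coAdL γ β) :=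
  contMDiff_const.clm_comp contMDiff_AdL

/-- The differential of the orbit map `γ ↦ Ad^*_γ β`. -/
def dcoAdL (β : E →L[ℝ] ℝ) (γ : Γ) : E →L[ℝ] (E →L[ℝ] ℝ) :=
  mfderiv 𝓘(ℝ, E) 𝓘(ℝ, E →L[ℝ] ℝ) (fun γ : Γ => coAdL γ β) γ

/-- The coadjoint action is linear in `Ad`, whose differential at `1` is the bracket. -/
theorem dcoAdL_one (β : E →L[ℝ] ℝ) (X Y : E) : dcoAdL β (1 : Γ) X Y = β (brk Γ X Y) := by
  have h1 := fderiv_comp_chartAt_symm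
    ((contMDiff_coAdL (Γ := Γ) β).mdifferentiableAt (x := 1) (by simp))
  have h2 : HasFDerivAt (fun x => coAdL ((chartOne E Γ).symm x) β)
      (ContinuousLinearMap.compL ℝ E E ℝ β ∘L
        fderiv ℝ (fun x => AdL E ((chartOne E Γ).symm x)) (coordOne E Γ)) (coordOne E Γ) :=
    (ContinuousLinearMap.compL ℝ E E ℝ β).hasFDerivAt.comp (coordOne E Γ)
      ((contDiffAt_AdL_chartOne_symm (E := E) (Γ := Γ)).differentiableAt (by simp)).hasFDerivAt
  have h3 := h1.symm.trans h2.fderiv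
  rw [← fderiv_AdL_chartOne_symm]
  exact DFunLike.congr_fun (DFunLike.congr_fun (F := E →L[ℝ] E →L[ℝ] ℝ) h3 X) Y

end LieCalculus


/-! ### Exterior derivative of one-forms on a vector space. -/

section OneForms

variable {E : Type*} [NormedAddCommGroup E] [NormedSpace ℝ E]

variable (E) in
/-- Covectors as alternating `1`-forms, as a continuous linear map. -/
def oneForm : (E →L[ℝ] ℝ) →L[ℝ] (E [⋀^Fin 1]→L[ℝ] ℝ) :=
  LinearMap.mkContinuous
    { toFun := fun f => ContinuousAlternatingMap.ofSubsingleton ℝ E ℝ (0 : Fin 1) f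
      map_add' := fun f g => by ext; rfl
      map_smul' := fun c f => by ext; rfl } 1 fun f => by
    rw [one_mul]
    exact (ContinuousMultilinearMap.norm_ofSubsingleton (0 : Fin 1) f).le

theorem oneForm_apply (f : E →L[ℝ] ℝ) (v : Fin 1 → E) : oneForm E f v = f (v 0) := rfl

theorem extDeriv_oneForm {a : E → E →L[ℝ] ℝ} {x : E} (ha : DifferentiableAt ℝ a x) (u v : E) :
    extDeriv (fun x => oneForm E (a x)) x ![u, v] = fderiv ℝ a x u v - fderiv ℝ a x v u := by
  have hd : DifferentiableAt ℝ (fun x => oneForm E (a x)) x :=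
    (oneForm E).differentiableAt.comp x ha
  rw [extDeriv_apply hd, Fin.sum_univ_two]
  have h : ∀ w : E, ∀ t : E, fderiv ℝ (fun y => a y w) x t = fderiv ℝ a x t w := fun w t => by
    rw [fderiv_clm_apply ha (differentiableAt_const w)]
    simp
  simp only [oneForm_apply]
  have h0 : ((0 : Fin 2).removeNth ![u, v] : Fin 1 → E) 0 = v := rfl
  have h1 : ((1 : Fin 2).removeNth ![u, v] : Fin 1 → E) 0 = u := rfl
  simp only [h0, h1, h]
  simp [sub_eq_add_neg]

end OneForms

/-! ### Right-invariant forms and the Maurer-Cartan equation. -/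

section RightInvariant

variable {E : Type*} [NormedAddCommGroup E] [NormedSpace ℝ E]
  {Γ : Type*} [TopologicalSpace Γ] [ChartedSpace E Γ] [Group Γ] [LieGroup 𝓘(ℝ, E) ∞ Γ]
  {E₁ : Type*} [NormedAddCommGroup E₁] [NormedSpace ℝ E₁]

variable (E) in
/-- The right trivialisation `T_γ Γ → 𝔤`. -/
def rho (γ : Γ) : E →L[ℝ] E := mfderiv 𝓘(ℝ, E) 𝓘(ℝ, E) (fun h : Γ => h * γ⁻¹) γ

variable (E) in
/-- The differential at `1` of the left translation by `γ`. -/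
def dleft (γ : Γ) : E →L[ℝ] E := mfderiv 𝓘(ℝ, E) 𝓘(ℝ, E) (fun h : Γ => γ * h) 1

variable (E) in
/-- The differential at `1` of the right translation by `γ`. -/
def dright (γ : Γ) : E →L[ℝ] E := mfderiv 𝓘(ℝ, E) 𝓘(ℝ, E) (fun h : Γ => h * γ) 1

theorem mdifferentiable_mul_right (γ : Γ) :
    MDifferentiable 𝓘(ℝ, E) 𝓘(ℝ, E) (fun h : Γ => h * γ) :=
  (contMDiff_mul_right (I := 𝓘(ℝ, E)) (n := ∞)).mdifferentiable (by simp)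

theorem mdifferentiable_mul_left (γ : Γ) :
    MDifferentiable 𝓘(ℝ, E) 𝓘(ℝ, E) (fun h : Γ => γ * h) :=
  (contMDiff_mul_left (I := 𝓘(ℝ, E)) (n := ∞)).mdifferentiable (by simp)

theorem rho_dleft (γ : Γ) (X : E) : rho E γ (dleft E γ X) = AdL E γ X := by
  have h := mfderiv_comp (1 : Γ) (g := fun h : Γ => h * γ⁻¹) (f := fun h : Γ => γ * h)
    (mdifferentiable_mul_right (E := E) γ⁻¹ _) (mdifferentiable_mul_left (E := E) γ 1)
  rw [mul_one] at h
  exact (DFunLike.congr_fun (F := E →L[ℝ] E) h X).symm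

theorem rho_dright (γ : Γ) (X : E) : rho E γ (dright E γ X) = X := by
  have h := mfderiv_comp (1 : Γ) (g := fun h : Γ => h * γ⁻¹) (f := fun h : Γ => h * γ)
    (mdifferentiable_mul_right (E := E) γ⁻¹ _) (mdifferentiable_mul_right (E := E) γ 1)
  rw [one_mul, show (fun h : Γ => h * γ⁻¹) ∘ (fun h : Γ => h * γ) = id by ext; simp,
    mfderiv_id] at h
  exact (DFunLike.congr_fun (F := E →L[ℝ] E) h X).symm

theorem dright_rho (γ : Γ) (u : E) : dright E γ (rho E γ u) = u := by
  have h := mfderiv_comp γ (g := fun h : Γ => h * γ) (f := fun h : Γ => h * γ⁻¹)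
    (mdifferentiable_mul_right (E := E) γ _) (mdifferentiable_mul_right (E := E) γ⁻¹ γ)
  rw [mul_inv_cancel, show (fun h : Γ => h * γ) ∘ (fun h : Γ => h * γ⁻¹) = id by ext; simp,
    mfderiv_id] at h
  exact (DFunLike.congr_fun (F := E →L[ℝ] E) h u).symm

theorem rho_injective (γ : Γ) : Injective (rho E γ) :=
  LeftInverse.injective (g := dright E γ) (dright_rho γ)

/-- `Ad γ⁻¹ ∘ rho γ` is the left trivialisation. Left translates are what the projection `Γ → Γ/Γ₀`
and the orbit maps see, while the momentum equation is right-invariant, so one passes repeatedly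
between the two. -/
theorem dleft_AdL_inv_rho (γ : Γ) (u : E) : dleft E γ (AdL E γ⁻¹ (rho E γ u)) = u := by
  apply rho_injective γ
  rw [rho_dleft, AdL_apply_inv]

/-- Derivative of `(g h) (g γ)⁻¹ = g (h γ⁻¹) g⁻¹` at `h = γ`. -/
theorem rho_mul_left (g γ : Γ) (u : E) :
    rho E (g * γ) ((mfderiv 𝓘(ℝ, E) 𝓘(ℝ, E) (fun h : Γ => g * h) γ : E →L[ℝ] E) u) =
      AdL E g (rho E γ u) := by
  have h1 := mfderiv_comp γ (g := fun h : Γ => h * (g * γ)⁻¹) (f := fun h : Γ => g * h)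
    (mdifferentiable_mul_right (E := E) _ _) (mdifferentiable_mul_left (E := E) g γ)
  have h2 := mfderiv_comp γ (g := fun h : Γ => g * h * g⁻¹) (f := fun h : Γ => h * γ⁻¹)
    ((contMDiff_conj (E := E) g).mdifferentiableAt (by simp))
    (mdifferentiable_mul_right (E := E) γ⁻¹ γ)
  rw [show (fun h : Γ => h * (g * γ)⁻¹) ∘ (fun h : Γ => g * h) =
    (fun h : Γ => g * h * g⁻¹) ∘ (fun h : Γ => h * γ⁻¹) by ext; simp [mul_assoc], h2,
    mul_inv_cancel] at h1
  exact (DFunLike.congr_fun (F := E →L[ℝ] E) h1 u).symm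

/-- The differential of the orbit map, in the right trivialisation. -/
theorem dcoAdL_apply (β : E →L[ℝ] ℝ) (γ : Γ) (u Y : E) :
    dcoAdL β γ u Y = β (brk Γ (rho E γ u) (AdL E γ Y)) := by
  rw [← dcoAdL_one]
  let P : (E →L[ℝ] ℝ) →L[ℝ] (E →L[ℝ] ℝ) := (ContinuousLinearMap.compL ℝ E E ℝ).flip (AdL E γ)
  have hd := (contMDiff_coAdL (Γ := Γ) β).mdifferentiableAt (x := γ * γ⁻¹) (by simp)
  -- The factorisation `h = (h γ⁻¹) γ` reduces the derivative at `γ` to the one at `1`, followed by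
  -- the linear map `coAdL γ`.
  have h0 : (fun h : Γ => coAdL h β) = P ∘ ((fun h : Γ => coAdL h β) ∘ fun h : Γ => h * γ⁻¹) := by
    funext h
    change coAdL h β = coAdL γ (coAdL (h * γ⁻¹) β)
    rw [coAdL_coAdL, inv_mul_cancel_right]
  have h1 := mfderiv_comp γ (g := fun h : Γ => coAdL h β) (f := fun h : Γ => h * γ⁻¹) hd
    (mdifferentiable_mul_right (E := E) γ⁻¹ γ)
  have h2 := mfderiv_comp γ (g := P) (f := (fun h : Γ => coAdL h β) ∘ fun h : Γ => h * γ⁻¹)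
    P.mdifferentiableAt (hd.comp γ (mdifferentiable_mul_right (E := E) γ⁻¹ γ))
  rw [← h0, h1, mul_inv_cancel, P.mfderiv_eq] at h2
  exact DFunLike.congr_fun (DFunLike.congr_fun (F := E →L[ℝ] E →L[ℝ] ℝ) h2 u) Y

/-- The adjoint representation acts by automorphisms of the Lie algebra. -/
theorem AdL_brk_of_dual (β : E →L[ℝ] ℝ) (γ : Γ) (X Y : E) :
    β (brk Γ (AdL E γ X) (AdL E γ Y)) = coAdL γ β (brk Γ X Y) := by
  have h1 := dcoAdL_apply β γ (dleft E γ X) Y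
  rw [rho_dleft] at h1
  rw [← h1, ← dcoAdL_one]
  -- Left translation by `γ` turns the orbit map of `β` into that of `coAdL γ β`; comparing its
  -- derivative at `1` with `dcoAdL_apply` gives the claim.
  have h2 := mfderiv_comp (1 : Γ) (g := fun h : Γ => coAdL h β) (f := fun h : Γ => γ * h)
    ((contMDiff_coAdL (Γ := Γ) β).mdifferentiableAt (by simp))
    (mdifferentiable_mul_left (E := E) γ 1)
  rw [show (fun h : Γ => coAdL h β) ∘ (fun h : Γ => γ * h) =
    fun h : Γ => coAdL h (coAdL γ β) by funext h; exact (coAdL_coAdL γ h β).symm, mul_one] at h2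
  exact (DFunLike.congr_fun (DFunLike.congr_fun (F := E →L[ℝ] E →L[ℝ] ℝ) h2 X) Y).symm

/-- The pullback by `c` of the right-invariant Maurer-Cartan form. -/
def maurerCartan (c : E₁ → Γ) (w : E₁) : E₁ →L[ℝ] E :=
  rho E (c w) ∘L (mfderiv 𝓘(ℝ, E₁) 𝓘(ℝ, E) c w : E₁ →L[ℝ] E)

/-- Separating the two occurrences of `c` in `c(w) c(w')⁻¹` exhibits the Maurer-Cartan form as a
partial derivative of a smooth function restricted to the diagonal, hence as smooth. -/
theorem contDiffAt_divChart {c : E₁ → Γ} {w w' : E₁}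
    (hc : ContMDiffAt 𝓘(ℝ, E₁) 𝓘(ℝ, E) ∞ c w) (hc' : ContMDiffAt 𝓘(ℝ, E₁) 𝓘(ℝ, E) ∞ c w')
    (h : c w * (c w')⁻¹ ∈ (chartOne E Γ).source) :
    ContDiffAt ℝ ∞ (fun p : E₁ × E₁ => chartOne E Γ (c p.1 * (c p.2)⁻¹)) (w, w') := by
  refine ContMDiffAt.contDiffAt ?_
  refine (contMDiffAt_chartOne h).comp (w, w') (ContMDiffAt.mul ?_ (ContMDiffAt.inv ?_))
  · exact ContMDiffAt.comp (w, w') (g := c) hc contDiff_fst.contMDiff.contMDiffAt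
  · exact ContMDiffAt.comp (w, w') (g := c) hc' contDiff_snd.contMDiff.contMDiffAt

theorem maurerCartan_eq {c : E₁ → Γ} {w : E₁} (hc : ContMDiffAt 𝓘(ℝ, E₁) 𝓘(ℝ, E) ∞ c w) :
    maurerCartan c w = fderiv ℝ (fun w' => chartOne E Γ (c w' * (c w)⁻¹)) w := by
  have h1 := mfderiv_comp w (g := fun h : Γ => h * (c w)⁻¹) (f := c)
    (mdifferentiable_mul_right (E := E) _ _) (hc.mdifferentiableAt (by simp))
  have h2 := mfderiv_eq_fderiv_chartOne (f := fun w' => c w' * (c w)⁻¹) (a := w)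
    (mul_inv_cancel _) (MDifferentiableAt.comp (I' := 𝓘(ℝ, E)) w
      (mdifferentiable_mul_right (E := E) (c w)⁻¹ _) (hc.mdifferentiableAt (by simp)))
  exact h1.symm.trans h2

theorem maurerCartan_eq_fderiv_comp {c : E₁ → Γ} {w : E₁}
    (hc : ContMDiffAt 𝓘(ℝ, E₁) 𝓘(ℝ, E) ∞ c w) :
    maurerCartan c w = fderiv ℝ (fun p : E₁ × E₁ => chartOne E Γ (c p.1 * (c p.2)⁻¹)) (w, w) ∘L
      ContinuousLinearMap.inl ℝ E₁ E₁ := by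
  rw [maurerCartan_eq hc]
  have h := HasFDerivAt.comp w (f := fun w' : E₁ => (w', w))
    ((contDiffAt_divChart hc hc (by
      rw [mul_inv_cancel]; exact one_mem_chartOne)).differentiableAt (by simp)).hasFDerivAt
    (hasFDerivAt_prodMk_left w w)
  exact h.fderiv

theorem contDiffOn_maurerCartan {c : E₁ → Γ} {U : Set E₁} (hU : IsOpen U)
    (hc : ContMDiffOn 𝓘(ℝ, E₁) 𝓘(ℝ, E) ∞ c U) :
    ContDiffOn ℝ ∞ (maurerCartan (E := E) c) U := by
  have hcw : ∀ w ∈ U, ContMDiffAt 𝓘(ℝ, E₁) 𝓘(ℝ, E) ∞ c w := fun w hw =>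
    hc.contMDiffAt (hU.mem_nhds hw)
  intro w hw
  have h1 := (contDiffAt_divChart (hcw w hw) (hcw w hw)
    (by rw [mul_inv_cancel]; exact one_mem_chartOne)).fderiv_right (m := ∞) (by simp)
  have h2 := h1.comp w (f := fun w : E₁ => (w, w)) (contDiffAt_id.prodMk contDiffAt_id)
  refine (h2.clm_comp (contDiffAt_const (c := ContinuousLinearMap.inl ℝ E₁ E₁))
    |>.congr_of_eventuallyEq ?_).contDiffWithinAt
  filter_upwards [hU.mem_nhds hw] with w' hw'
  exact maurerCartan_eq_fderiv_comp (hcw w' hw')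

/-- The Maurer-Cartan equation. -/
theorem fderiv_maurerCartan_sub {c : E₁ → Γ} {U : Set E₁} (hU : IsOpen U)
    (hc : ContMDiffOn 𝓘(ℝ, E₁) 𝓘(ℝ, E) ∞ c U) {w₀ : E₁} (hw₀ : w₀ ∈ U) (u v : E₁) :
    fderiv ℝ (maurerCartan (E := E) c) w₀ u v - fderiv ℝ (maurerCartan (E := E) c) w₀ v u =
      brk Γ (maurerCartan c w₀ u) (maurerCartan c w₀ v) := by
  have hcw : ∀ w ∈ U, ContMDiffAt 𝓘(ℝ, E₁) 𝓘(ℝ, E) ∞ c w := fun w hw =>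
    hc.contMDiffAt (hU.mem_nhds hw)
  -- Right translation by `c(w₀)⁻¹` brings `c` near `1`, into the single chart where `mulChart` and
  -- `mulHess` live.
  let K : E₁ → E := fun w => chartOne E Γ (c w * (c w₀)⁻¹)
  have hk : ContMDiffAt 𝓘(ℝ, E₁) 𝓘(ℝ, E) ∞ (fun w => c w * (c w₀)⁻¹) w₀ :=
    (hcw w₀ hw₀).mul contMDiffAt_const
  let O : Set E₁ := {w | w ∈ U ∧ c w * (c w₀)⁻¹ ∈ (chartOne E Γ).source}
  have hO : O ∈ 𝓝 w₀ := by
    refine Filter.inter_mem (hU.mem_nhds hw₀) (hk.continuousAt.preimage_mem_nhds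
      ((chartOne E Γ).open_source.mem_nhds ?_))
    rw [mul_inv_cancel]; exact one_mem_chartOne
  have hKd : ∀ w ∈ O, ContDiffAt ℝ ∞ K w := fun w hw => by
    refine ContMDiffAt.contDiffAt ((contMDiffAt_chartOne hw.2).comp w ?_)
    exact (hcw w hw.1).mul contMDiffAt_const
  have hw₀O : w₀ ∈ O := mem_of_mem_nhds hO
  have hK0 : K w₀ = coordOne E Γ := by simp [K, coordOne]
  -- Derivative at `w' = w` of `c(w') c(w₀)⁻¹ = (c(w') c(w)⁻¹) (c(w) c(w₀)⁻¹)`.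
  have hrel : ∀ w ∈ O, ∀ v : E₁, fderiv ℝ (mulChart E Γ) (coordOne E Γ, K w)
      (maurerCartan c w v, 0) = fderiv ℝ K w v := by
    intro w hw v
    let r : E₁ → E := fun w' => chartOne E Γ (c w' * (c w)⁻¹)
    have hr0 : r w = coordOne E Γ := by simp [r, coordOne]
    have hcd : ContMDiffAt 𝓘(ℝ, E₁) 𝓘(ℝ, E) ∞ (fun w' => c w' * (c w)⁻¹) w :=
      (hcw w hw.1).mul contMDiffAt_const
    have h1m : c w * (c w)⁻¹ ∈ (chartOne E Γ).source := by
      rw [mul_inv_cancel]; exact one_mem_chartOne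
    have hr : DifferentiableAt ℝ r w := by
      refine (ContMDiffAt.contDiffAt (n := ∞) ?_).differentiableAt (by simp)
      exact (contMDiffAt_chartOne h1m).comp w hcd
    have hKt : K w ∈ (chartOne E Γ).target := (chartOne E Γ).map_source hw.2
    have h2 : HasFDerivAt (fun w' => (r w', K w))
        ((maurerCartan c w).prod (0 : E₁ →L[ℝ] E)) w := by
      rw [maurerCartan_eq (hcw w hw.1)]
      exact hr.hasFDerivAt.prodMk (hasFDerivAt_const (K w) _)
    have h3 : HasFDerivAt (fun w' => mulChart E Γ (r w', K w))
        (fderiv ℝ (mulChart E Γ) (coordOne E Γ, K w) ∘L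
          (maurerCartan c w).prod (0 : E₁ →L[ℝ] E)) w := by
      refine HasFDerivAt.comp w (g := mulChart E Γ) (f := fun w' => (r w', K w)) ?_ h2
      rw [hr0]
      exact ((contDiffAt_mulChart_right hKt).differentiableAt (by simp)).hasFDerivAt
    have h4 : (fun w' => mulChart E Γ (r w', K w)) =ᶠ[𝓝 w] K := by
      filter_upwards [hcd.continuousAt.preimage_mem_nhds
        ((chartOne E Γ).open_source.mem_nhds h1m)] with w' hw'
      simp only [mulChart, r, K]
      rw [(chartOne E Γ).left_inv hw', (chartOne E Γ).left_inv hw.2]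
      congr 1
      group
    rw [← h4.fderiv_eq, h3.fderiv]
    rfl
  have hKf : HasFDerivAt (fun w => fderiv ℝ (mulChart E Γ) (coordOne E Γ, K w))
      (mulHess E Γ ∘L (ContinuousLinearMap.inr ℝ E E ∘L fderiv ℝ K w₀)) w₀ := by
    refine HasFDerivAt.comp w₀ (g := fderiv ℝ (mulChart E Γ))
      (f := fun w => (coordOne E Γ, K w)) ?_ ?_
    · rw [hK0]; exact hasFDerivAt_fderiv_mulChart
    · exact (hasFDerivAt_prodMk_right (𝕜 := ℝ) (coordOne E Γ) (K w₀)).comp w₀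
        ((hKd w₀ hw₀O).differentiableAt (by simp)).hasFDerivAt
  have hMC : DifferentiableAt ℝ (maurerCartan (E := E) c) w₀ :=
    ((contDiffOn_maurerCartan hU hc).contDiffAt (hU.mem_nhds hw₀)).differentiableAt (by simp)
  have hfK : DifferentiableAt ℝ (fderiv ℝ K) w₀ :=
    ((hKd w₀ hw₀O).fderiv_right (m := ∞) (by simp)).differentiableAt (by simp)
  have hU0 : ∀ v, fderiv ℝ K w₀ v = maurerCartan c w₀ v := fun v => by
    rw [← hrel w₀ hw₀O, hK0, fderiv_mulChart_one_left]
  -- Derivative of `hrel` in `w` at `w₀`. Antisymmetrising in `u, v` removes the Hessian of `K` and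
  -- leaves the bracket.
  have key : ∀ u v : E₁, mulHess E Γ (0, maurerCartan c w₀ u) (maurerCartan c w₀ v, 0) +
      fderiv ℝ (maurerCartan (E := E) c) w₀ u v = fderiv ℝ (fderiv ℝ K) w₀ u v := by
    intro u v
    have h3 : HasFDerivAt (fun w => ((maurerCartan c w v, 0) : E × E))
        (ContinuousLinearMap.inl ℝ E E ∘L (ContinuousLinearMap.apply ℝ E v ∘L
          fderiv ℝ (maurerCartan (E := E) c) w₀)) w₀ :=
      (ContinuousLinearMap.inl ℝ E E).hasFDerivAt.comp w₀
        ((ContinuousLinearMap.apply ℝ E v).hasFDerivAt.comp w₀ hMC.hasFDerivAt)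
    have h4 := hKf.clm_apply h3
    have h5 : HasFDerivAt (fun w => fderiv ℝ K w v)
        (ContinuousLinearMap.apply ℝ E v ∘L fderiv ℝ (fderiv ℝ K) w₀) w₀ :=
      (ContinuousLinearMap.apply ℝ E v).hasFDerivAt.comp w₀ hfK.hasFDerivAt
    have h6 : (fun w => fderiv ℝ (mulChart E Γ) (coordOne E Γ, K w)
        ((maurerCartan c w v, 0) : E × E)) =ᶠ[𝓝 w₀] fun w => fderiv ℝ K w v := by
      filter_upwards [hO] with w hw using hrel w hw v
    have h7 := h6.fderiv_eq (𝕜 := ℝ)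
    rw [h4.fderiv, h5.fderiv] at h7
    have h8 := DFunLike.congr_fun h7 u
    simp only [add_apply, ContinuousLinearMap.comp_apply, ContinuousLinearMap.flip_apply,
      ContinuousLinearMap.inr_apply, ContinuousLinearMap.inl_apply,
      ContinuousLinearMap.apply_apply, hK0, fderiv_mulChart_one_left, hU0] at h8
    rw [← h8, add_comm]
  have hsymm := ((hKd w₀ hw₀O).isSymmSndFDerivAt
    (by simp; exact WithTop.coe_le_coe.2 le_top)).eq u v
  have k1 := key u v
  have k2 := key v u
  rw [hsymm, ← k2, mulHess_symm (0, maurerCartan c w₀ u), mulHess_symm (0, maurerCartan c w₀ v)]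
    at k1
  rw [brk, eq_sub_iff_add_eq.2 ((add_comm _ _).trans k1)]
  abel

theorem contDiffOn_oneForm_maurerCartan (β : E →L[ℝ] ℝ) {c : E₁ → Γ} {U : Set E₁} (hU : IsOpen U)
    (hc : ContMDiffOn 𝓘(ℝ, E₁) 𝓘(ℝ, E) ∞ c U) :
    ContDiffOn ℝ ∞ (fun w => oneForm E₁ (β ∘L maurerCartan (E := E) c w)) U :=
  (oneForm E₁).contDiff.comp_contDiffOn
    (contDiffOn_const.clm_comp (contDiffOn_maurerCartan hU hc))

/-- The exterior derivative of the right-invariant one-form. -/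
theorem extDeriv_oneForm_maurerCartan (β : E →L[ℝ] ℝ) {c : E₁ → Γ} {U : Set E₁} (hU : IsOpen U)
    (hc : ContMDiffOn 𝓘(ℝ, E₁) 𝓘(ℝ, E) ∞ c U) {w : E₁} (hw : w ∈ U) (u v : E₁) :
    extDeriv (fun w => oneForm E₁ (β ∘L maurerCartan (E := E) c w)) w ![u, v] =
      β (brk Γ (maurerCartan c w u) (maurerCartan c w v)) := by
  have hMC : DifferentiableAt ℝ (maurerCartan (E := E) c) w :=
    ((contDiffOn_maurerCartan hU hc).contDiffAt (hU.mem_nhds hw)).differentiableAt (by simp)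
  have h1 : HasFDerivAt (fun w => β ∘L maurerCartan (E := E) c w)
      (ContinuousLinearMap.compL ℝ E₁ E ℝ β ∘L fderiv ℝ (maurerCartan (E := E) c) w) w :=
    (ContinuousLinearMap.compL ℝ E₁ E ℝ β).hasFDerivAt.comp w hMC.hasFDerivAt
  rw [extDeriv_oneForm h1.differentiableAt, h1.fderiv, ← fderiv_maurerCartan_sub hU hc hw, map_sub]
  rfl

end RightInvariant


/-! ### The constant rank theorem. -/

section ConstantRank

open Module Manifold

variable {E : Type*} [NormedAddCommGroup E] [NormedSpace ℝ E] [FiniteDimensional ℝ E]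
  {X : Type*} [TopologicalSpace X] [ChartedSpace E X] [IsManifold 𝓘(ℝ, E) ∞ X]
  {D : Type*} [NormedAddCommGroup D] [NormedSpace ℝ D] [FiniteDimensional ℝ D]
  {Y : Type*} [TopologicalSpace Y]

/-- Project `D` onto the range of `A` and identify that range with the coordinate space of its
dimension. -/
theorem exists_surjective_comp {n : ℕ} (A : E →L[ℝ] D)
    (hA : finrank ℝ (LinearMap.range A.toLinearMap) = n) :
    ∃ p : D →L[ℝ] EuclideanSpace ℝ (Fin n), Surjective (p ∘L A) := by
  obtain ⟨g, hg⟩ := (LinearMap.range A.toLinearMap).subtype.exists_leftInverse_of_injective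
    (by simp)
  let ek : LinearMap.range A.toLinearMap ≃ₗ[ℝ] EuclideanSpace ℝ (Fin n) :=
    LinearEquiv.ofFinrankEq _ _ (by simp [hA])
  refine ⟨(ek.toLinearMap ∘ₗ g).toContinuousLinearMap, fun v => ?_⟩
  obtain ⟨x, hx⟩ := (ek.symm v).2
  refine ⟨x, ?_⟩
  have h1 : g (A x) = ek.symm v := by
    have := LinearMap.congr_fun hg (ek.symm v)
    simp only [LinearMap.comp_apply, Submodule.subtype_apply, LinearMap.id_apply] at this
    rw [← this, ← hx]; rfl
  change ek (g (A x)) = v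
  rw [h1, ek.apply_symm_apply]

/-- Surjectivity of `p ∘ A` makes `p` surjective already on the range of `A`, and equality of
dimensions makes it injective there. -/
theorem ker_comp_le_ker {V : Type*} [NormedAddCommGroup V] [NormedSpace ℝ V]
    (A : E →L[ℝ] D) (p : D →L[ℝ] V) (hs : Surjective (p ∘L A))
    (hA : finrank ℝ (LinearMap.range A.toLinearMap) = finrank ℝ V) {x : E} (hx : p (A x) = 0) :
    A x = 0 := by
  have h1 : Surjective ((p.toLinearMap).domRestrict (LinearMap.range A.toLinearMap)) := fun v => by
    obtain ⟨x, hx⟩ := hs v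
    exact ⟨⟨A x, x, rfl⟩, hx⟩
  have hV : FiniteDimensional ℝ V := Module.Finite.of_surjective _ h1
  have h2 := (LinearMap.injective_iff_surjective_of_finrank_eq_finrank hA).2 h1
  have h3 : (⟨A x, x, rfl⟩ : LinearMap.range A.toLinearMap) = 0 := h2 (by
    rw [map_zero]; exact hx)
  exact congrArg Subtype.val h3

/-- The constant rank theorem, as the existence of local slices. -/
theorem exists_localSlice_of_constant_rank {f : X → D} {π : X → Y} {n : ℕ}
    (hf : ContMDiff 𝓘(ℝ, E) 𝓘(ℝ, D) ∞ f)
    (hn : ∀ x, finrank ℝ (LinearMap.range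
      (mfderiv 𝓘(ℝ, E) 𝓘(ℝ, D) f x : E →L[ℝ] D).toLinearMap) = n)
    (hπ : ∀ x x', π x = π x' ↔ f x = f x') (x : X) :
    ∃ S : LocalSlice (E := E) π (EuclideanSpace ℝ (Fin n)), x ∈ S.U := by
  let V := EuclideanSpace ℝ (Fin n)
  obtain ⟨p, hp⟩ := exists_surjective_comp (E := E) (D := D) (mfderiv 𝓘(ℝ, E) 𝓘(ℝ, D) f x) (hn x)
  let s : X → V := fun y => p (f y)
  have hs : ContMDiff 𝓘(ℝ, E) 𝓘(ℝ, V) ∞ s := p.contDiff.contMDiff.comp hf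
  have hds : ∀ y, mfderiv 𝓘(ℝ, E) 𝓘(ℝ, V) s y =
      p ∘L (mfderiv 𝓘(ℝ, E) 𝓘(ℝ, D) f y : E →L[ℝ] D) := fun y => by
    have h := mfderiv_comp y (g := p) (f := f) p.mdifferentiableAt
      (hf.mdifferentiableAt (by simp))
    rw [p.mfderiv_eq] at h
    exact h
  have hle : n ≤ finrank ℝ E := by
    rw [← hn x]
    let A : E →L[ℝ] D := mfderiv 𝓘(ℝ, E) 𝓘(ℝ, D) f x
    exact LinearMap.finrank_range_le A.toLinearMap
  let K := EuclideanSpace ℝ (Fin (finrank ℝ E - n))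
  obtain ⟨e, hxe, -, he1, heC, heC'⟩ := exists_straightening_of_surjective (W := V) (K := K)
    isOpen_univ hs.contMDiffOn (mem_univ x) (by rw [hds]; exact hp) (by simp [V, K]; omega)
  have hfe : ContDiffOn ℝ ∞ (fun q => f (e.symm q)) e.target :=
    (hf.comp_contMDiffOn heC').contDiffOn
  -- This is where constancy of the rank enters: `p ∘ df` already has full rank `n`, so a direction
  -- killed by it is killed by `df`. Hence `f` is locally constant along the fibres of `s = p ∘ f`.
  have hkey : ∀ q ∈ e.target, ∀ k : K, fderiv ℝ (fun q => f (e.symm q)) q (0, k) = 0 := by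
    intro q hq k
    have hde : MDifferentiableAt 𝓘(ℝ, V × K) 𝓘(ℝ, E) e.symm q :=
      (heC'.contMDiffAt (e.open_target.mem_nhds hq)).mdifferentiableAt (by simp)
    let T : V × K →L[ℝ] E := mfderiv 𝓘(ℝ, V × K) 𝓘(ℝ, E) e.symm q
    let A : E →L[ℝ] D := mfderiv 𝓘(ℝ, E) 𝓘(ℝ, D) f (e.symm q)
    have h1 : fderiv ℝ (fun q => f (e.symm q)) q = A ∘L T := by
      rw [← mfderiv_eq_fderiv]
      exact mfderiv_comp q (g := f) (hf.mdifferentiableAt (by simp)) hde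
    have h2 : (fun q => s (e.symm q)) =ᶠ[𝓝 q] Prod.fst := by
      filter_upwards [e.open_target.mem_nhds hq] with q' hq'
      rw [← he1 _ (e.map_target hq'), e.right_inv hq']
    have h3 : fderiv ℝ (fun q => s (e.symm q)) q = (p ∘L A) ∘L T := by
      rw [← mfderiv_eq_fderiv]
      have := mfderiv_comp q (g := s) (hs.mdifferentiableAt (by simp)) hde
      rw [hds] at this
      exact this
    rw [h2.fderiv_eq, fderiv_fst] at h3
    have h4 : Surjective (p ∘L A) := fun v =>
      ⟨T (v, 0), (DFunLike.congr_fun h3 (v, 0)).symm⟩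
    rw [h1]
    exact ker_comp_le_ker A p h4 ((hn _).trans (by simp))
      (DFunLike.congr_fun h3 ((0, k) : V × K)).symm
  obtain ⟨r, hr, hball⟩ := Metric.isOpen_iff.1 e.open_target (e x) (e.map_source hxe)
  let A := Metric.ball (e x).1 r
  let B := Metric.ball (e x).2 r
  have hAB : A ×ˢ B ⊆ e.target := fun q hq => hball (by
    rw [← Prod.mk.eta (p := e x), ← ball_prod_same]; exact hq)
  have hconst : ∀ a ∈ A, ∀ b ∈ B, ∀ b' ∈ B, f (e.symm (a, b)) = f (e.symm (a, b')) := by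
    intro a ha b hb b' hb'
    have hd : ∀ k ∈ B, HasFDerivAt (fun k => f (e.symm (a, k))) (0 : K →L[ℝ] D) k := by
      intro k hk
      have hm := hAB (mk_mem_prod ha hk)
      have h1 := HasFDerivAt.comp k (f := fun k : K => (a, k))
        ((hfe.contDiffAt (e.open_target.mem_nhds hm)).differentiableAt
          (by simp)).hasFDerivAt (hasFDerivAt_prodMk_right a k)
      have h2 : fderiv ℝ (fun q => f (e.symm q)) (a, k) ∘L ContinuousLinearMap.inr ℝ V K = 0 :=
        ContinuousLinearMap.ext fun t => hkey _ hm t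
      rw [h2] at h1
      exact h1
    exact (convex_ball (e x).2 r).is_const_of_fderivWithin_eq_zero (𝕜 := ℝ)
      (f := fun k => f (e.symm (a, k)))
      (fun k hk => (hd k hk).differentiableAt.differentiableWithinAt)
      (fun k hk => ((hd k hk).hasFDerivWithinAt.fderivWithin
        (Metric.isOpen_ball.uniqueDiffWithinAt hk))) hb hb'
  have hAo : IsOpen A := Metric.isOpen_ball
  have hBo : IsOpen B := Metric.isOpen_ball
  have hb₀ : (e x).2 ∈ B := Metric.mem_ball_self hr
  refine ⟨{ U := e.source ∩ e ⁻¹' (A ×ˢ B), ρ := s, T := A, l := fun a => e.symm (a, (e x).2)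
            isOpen_U := e.isOpen_inter_preimage (hAo.prod hBo)
            isOpen_T := hAo
            contMDiffOn_ρ := hs.contMDiffOn
            contMDiffOn_l := ?_
            mapsTo_ρ := ?_
            mapsTo_l := ?_
            ρ_l := ?_
            fibre := ?_ }, hxe, Metric.mem_ball_self hr, hb₀⟩
  · refine heC'.comp (ContDiff.contMDiff ?_).contMDiffOn fun a ha => hAB (mk_mem_prod ha hb₀)
    exact contDiff_id.prodMk contDiff_const
  · intro u hu
    rw [← he1 u hu.1]
    exact hu.2.1
  · intro a ha
    have hm := hAB (mk_mem_prod ha hb₀)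
    refine ⟨e.map_target hm, ?_⟩
    rw [mem_preimage, e.right_inv hm]
    exact mk_mem_prod ha hb₀
  · intro a ha
    have hm := hAB (mk_mem_prod ha hb₀)
    rw [← he1 _ (e.map_target hm), e.right_inv hm]
  · intro u hu u' hu'
    rw [hπ]
    refine ⟨fun h => congrArg p h, fun h => ?_⟩
    have h1 : (e u).1 = (e u').1 := by rw [he1 u hu.1, he1 u' hu'.1]; exact h
    have h2 := hconst _ hu.2.1 _ hu.2.2 _ hu'.2.2
    rw [Prod.mk.eta, h1, Prod.mk.eta, e.left_inv hu.1, e.left_inv hu'.1] at h2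
    exact h2

end ConstantRank

/-! ### The coadjoint orbit as a manifold. -/

section OrbitManifold

open Module Manifold Topology

variable {E : Type*} [NormedAddCommGroup E] [NormedSpace ℝ E] [FiniteDimensional ℝ E]
  {Γ : Type*} [TopologicalSpace Γ] [ChartedSpace E Γ] [Group Γ] [LieGroup 𝓘(ℝ, E) ∞ Γ]
  {β₀ : LieDual E Γ}

/-- An element of `𝔤^*` as a functional on the model space. -/
def dualOf (β : LieDual E Γ) : E →L[ℝ] ℝ := β

/-- The inclusion of the coadjoint orbit into `𝔤^*`. -/
def orbitIncl (b : Orbit β₀) : E →L[ℝ] ℝ := b.1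

theorem orbitIncl_injective : Injective (orbitIncl (β₀ := β₀)) := Subtype.val_injective

theorem orbitIncl_orbitMap (γ : Γ) : orbitIncl (orbitMap β₀ γ) = coAdL γ (dualOf β₀) := rfl

theorem orbitMap_surjective : Surjective (orbitMap β₀) := by
  rintro ⟨_, γ, rfl⟩
  exact ⟨γ, rfl⟩

theorem orbitMap_eq_iff (γ γ' : Γ) :
    orbitMap β₀ γ = orbitMap β₀ γ' ↔ coAdL γ (dualOf β₀) = coAdL γ' (dualOf β₀) :=
  orbitIncl_injective.eq_iff.symm

theorem coAdL_injective (γ : Γ) : Injective (coAdL (E := E) γ) := fun β β' h => by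
  have h1 := congrArg (coAdL (E := E) γ⁻¹) h
  simpa only [coAdL_coAdL, mul_inv_cancel, coAdL_one] using h1

theorem coAdL_mul (γ δ : Γ) (β : E →L[ℝ] ℝ) : coAdL (γ * δ) β = coAdL δ (coAdL γ β) :=
  (coAdL_coAdL γ δ β).symm

/-- The saturation of an open set is the union of its preimages under left translations by the
stabilizer of `β₀`, each of which is open. -/
theorem isOpenQuotientMap_orbitMap : IsOpenQuotientMap (orbitMap β₀) := by
  have hq : IsQuotientMap (orbitMap β₀) := ⟨⟨rfl⟩, orbitMap_surjective⟩
  refine ⟨orbitMap_surjective, hq.continuous, fun U hU => ?_⟩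
  rw [← hq.isOpen_preimage]
  have h : orbitMap β₀ ⁻¹' (orbitMap β₀ '' U) =
      ⋃ g ∈ {g : Γ | coAdL g (dualOf β₀) = dualOf β₀}, (fun z => g * z) ⁻¹' U := by
    ext z
    simp only [mem_preimage, mem_image, mem_iUnion]
    constructor
    · rintro ⟨u, hu, h⟩
      rw [orbitMap_eq_iff] at h
      refine ⟨u * z⁻¹, ?_, by simpa⟩
      change coAdL (u * z⁻¹) (dualOf β₀) = dualOf β₀
      rw [coAdL_mul, h, coAdL_coAdL, mul_inv_cancel, coAdL_one]
    · rintro ⟨g, hg, h⟩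
      refine ⟨_, h, ?_⟩
      have hg' : coAdL g (dualOf β₀) = dualOf β₀ := hg
      rw [orbitMap_eq_iff, coAdL_mul, hg']
  rw [h]
  have : ContinuousMul Γ := continuousMul_of_contMDiffMul 𝓘(ℝ, E) ∞
  exact isOpen_biUnion fun g _ => hU.preimage (continuous_const_mul g)

theorem dcoAdL_eq (β : E →L[ℝ] ℝ) (γ : Γ) (u : E) :
    dcoAdL β γ u = coAdL γ (dcoAdL (Γ := Γ) β 1 (rho E γ u)) := by
  ext Y
  rw [dcoAdL_apply, coAdL_apply, dcoAdL_one]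

theorem dcoAdL_eq_zero_iff (β : E →L[ℝ] ℝ) (γ : Γ) (u : E) :
    dcoAdL β γ u = 0 ↔ dcoAdL (Γ := Γ) β 1 (rho E γ u) = 0 := by
  rw [dcoAdL_eq]
  exact (coAdL_injective γ).eq_iff' (by simp [coAdL])

/-- By equivariance the differential at `γ` is the one at `1` between two invertible maps, `rho γ`
and `coAdL γ`. This supplies the constant rank hypothesis for the orbit map. -/
theorem finrank_range_dcoAdL (β : E →L[ℝ] ℝ) (γ : Γ) :
    finrank ℝ (LinearMap.range (dcoAdL β γ).toLinearMap) =
      finrank ℝ (LinearMap.range (dcoAdL (Γ := Γ) β 1).toLinearMap) := by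
  have hr : Bijective (rho E γ) :=
    ⟨rho_injective γ, fun X => ⟨dright E γ X, rho_dright γ X⟩⟩
  have h : LinearMap.ker (dcoAdL β γ).toLinearMap =
      (LinearMap.ker (dcoAdL (Γ := Γ) β 1).toLinearMap).comap (rho E γ).toLinearMap := by
    ext u
    exact dcoAdL_eq_zero_iff β γ u
  have h1 := LinearMap.finrank_range_add_finrank_ker (dcoAdL β γ).toLinearMap
  have h2 := LinearMap.finrank_range_add_finrank_ker (dcoAdL (Γ := Γ) β 1).toLinearMap
  have h3 : finrank ℝ (LinearMap.ker (dcoAdL β γ).toLinearMap) =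
      finrank ℝ (LinearMap.ker (dcoAdL (Γ := Γ) β 1).toLinearMap) := by
    rw [h]
    exact (Submodule.equivMapOfInjective (LinearEquiv.ofBijective (rho E γ).toLinearMap hr).symm
      (LinearEquiv.injective _) _ |>.trans (LinearEquiv.ofEq _ _
        (Submodule.map_equiv_eq_comap_symm _ _))).finrank_eq.symm
  omega

variable (β₀) in
/-- The dimension of the coadjoint orbit. -/
def orbitDim : ℕ := finrank ℝ (LinearMap.range (dcoAdL (Γ := Γ) (dualOf β₀) 1).toLinearMap)

variable (β₀) in
/-- The coadjoint orbit as a homogeneous manifold. -/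
theorem exists_orbit_manifold :
    ∃ (_ : ChartedSpace (EuclideanSpace ℝ (Fin (orbitDim β₀))) (Orbit β₀))
      (_ : IsManifold (𝓡 (orbitDim β₀)) ∞ (Orbit β₀)),
      IsSubmersion 𝓘(ℝ, E) (𝓡 (orbitDim β₀)) ∞ (orbitMap β₀) := by
  have : IsManifold 𝓘(ℝ, E) ∞ Γ := isManifold_group
  refine exists_quotient_manifold isOpenQuotientMap_orbitMap ?_ fun x =>
    exists_localSlice_of_constant_rank (contMDiff_coAdL (Γ := Γ) (dualOf β₀))
      (finrank_range_dcoAdL (dualOf β₀)) orbitMap_eq_iff x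
  intro γ γ' h
  rw [orbitMap_eq_iff] at h
  refine ⟨fun z => γ' * γ⁻¹ * z, contMDiff_mul_left, by simp, fun z => ?_⟩
  rw [orbitMap_eq_iff, coAdL_mul, coAdL_mul, ← h, coAdL_coAdL,
    coAdL_coAdL, mul_inv_cancel_left]

variable {n : ℕ} [ChartedSpace (EuclideanSpace ℝ (Fin n)) (Orbit β₀)]
  [IsManifold (𝓡 n) ∞ (Orbit β₀)]

/-- A map from a manifold whose composition with a submersion is smooth, is smooth. -/
theorem contMDiff_of_comp_submersion
    {E₁ : Type*} [NormedAddCommGroup E₁] [NormedSpace ℝ E₁]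
    {M : Type*} [TopologicalSpace M] [ChartedSpace E₁ M] [IsManifold 𝓘(ℝ, E₁) ∞ M]
    {E₂ : Type*} [NormedAddCommGroup E₂] [NormedSpace ℝ E₂]
    {N : Type*} [TopologicalSpace N] [ChartedSpace E₂ N] [IsManifold 𝓘(ℝ, E₂) ∞ N]
    {E₃ : Type*} [NormedAddCommGroup E₃] [NormedSpace ℝ E₃]
    {H₃ : Type*} [TopologicalSpace H₃] {J : ModelWithCorners ℝ E₃ H₃}
    {P : Type*} [TopologicalSpace P] [ChartedSpace H₃ P]
    {π : M → N} (hπ : IsSubmersion 𝓘(ℝ, E₁) 𝓘(ℝ, E₂) ∞ π) (hs : Surjective π) {g : N → P}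
    (hg : ContMDiff 𝓘(ℝ, E₁) J ∞ (fun x => g (π x))) : ContMDiff 𝓘(ℝ, E₂) J ∞ g := by
  intro y
  obtain ⟨x, rfl⟩ := hs y
  obtain ⟨s, U, hU, hx, -, hfs, hsm⟩ := exists_local_section hπ x
  refine (hg.contMDiffAt.comp (π x) (hsm.contMDiffAt (hU.mem_nhds hx))).congr_of_eventuallyEq ?_
  filter_upwards [hU.mem_nhds hx] with z hz
  simp [hfs z hz]

theorem contMDiff_orbitIncl (hπ : IsSubmersion 𝓘(ℝ, E) (𝓡 n) ∞ (orbitMap β₀)) :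
    ContMDiff (𝓡 n) 𝓘(ℝ, E →L[ℝ] ℝ) ∞ (orbitIncl (β₀ := β₀)) := by
  have : IsManifold 𝓘(ℝ, E) ∞ Γ := isManifold_group
  exact contMDiff_of_comp_submersion hπ orbitMap_surjective (contMDiff_coAdL (dualOf β₀))

theorem mfderiv_orbitIncl (hπ : IsSubmersion 𝓘(ℝ, E) (𝓡 n) ∞ (orbitMap β₀)) (γ : Γ) (u : E) :
    (mfderiv (𝓡 n) 𝓘(ℝ, E →L[ℝ] ℝ) (orbitIncl (β₀ := β₀)) (orbitMap β₀ γ) :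
      EuclideanSpace ℝ (Fin n) →L[ℝ] E →L[ℝ] ℝ)
      ((mfderiv 𝓘(ℝ, E) (𝓡 n) (orbitMap β₀) γ : E →L[ℝ] EuclideanSpace ℝ (Fin n)) u) =
      dcoAdL (dualOf β₀) γ u := by
  have h := mfderiv_comp γ (g := orbitIncl (β₀ := β₀)) (f := orbitMap β₀)
    ((contMDiff_orbitIncl hπ).mdifferentiableAt (by simp))
    (hπ.contMDiff.mdifferentiableAt (by simp))
  exact (DFunLike.congr_fun (F := E →L[ℝ] E →L[ℝ] ℝ) h u).symm

/-- The differential of the orbit map into `𝔤^*` has rank `n` and factors through this differential,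
whose source has dimension `n`. -/
theorem injective_mfderiv_orbitIncl (hπ : IsSubmersion 𝓘(ℝ, E) (𝓡 n) ∞ (orbitMap β₀))
    (hn : n = orbitDim β₀) (b : Orbit β₀) :
    Injective (mfderiv (𝓡 n) 𝓘(ℝ, E →L[ℝ] ℝ) (orbitIncl (β₀ := β₀)) b) := by
  have : IsManifold 𝓘(ℝ, E) ∞ Γ := isManifold_group
  obtain ⟨γ, rfl⟩ := orbitMap_surjective b
  let A : EuclideanSpace ℝ (Fin n) →L[ℝ] E →L[ℝ] ℝ :=
    mfderiv (𝓡 n) 𝓘(ℝ, E →L[ℝ] ℝ) (orbitIncl (β₀ := β₀)) (orbitMap β₀ γ)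
  have hr : LinearMap.range (dcoAdL (dualOf β₀) γ).toLinearMap ≤ LinearMap.range A.toLinearMap := by
    rintro _ ⟨u, rfl⟩
    exact ⟨_, mfderiv_orbitIncl hπ γ u⟩
  have h1 := Submodule.finrank_mono hr
  rw [finrank_range_dcoAdL] at h1
  have h2 := LinearMap.finrank_range_add_finrank_ker A.toLinearMap
  have h3 : finrank ℝ (LinearMap.ker A.toLinearMap) = 0 := by
    have : finrank ℝ (EuclideanSpace ℝ (Fin n)) = n := by simp
    have h4 : orbitDim β₀ ≤ finrank ℝ (LinearMap.range A.toLinearMap) := h1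
    omega
  have h5 : LinearMap.ker A.toLinearMap = ⊥ := Submodule.finrank_eq_zero.1 h3
  exact LinearMap.ker_eq_bot.1 h5

theorem continuous_orbitIncl : Continuous (orbitIncl (β₀ := β₀)) :=
  (isOpenQuotientMap_orbitMap (β₀ := β₀)).isQuotientMap.continuous_iff.2
    (contMDiff_coAdL (Γ := Γ) (dualOf β₀)).continuous

theorem t2Space_orbit : T2Space (Orbit β₀) :=
  T2Space.of_injective_continuous orbitIncl_injective continuous_orbitIncl

end OrbitManifold


/-! ### Differentials as linear maps of model spaces. -/

section Differential

variable (E : Type*) [NormedAddCommGroup E] [NormedSpace ℝ E]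
  {M : Type*} [TopologicalSpace M] [ChartedSpace E M]
  (E' : Type*) [NormedAddCommGroup E'] [NormedSpace ℝ E']
  {N : Type*} [TopologicalSpace N] [ChartedSpace E' N]
  {E'' : Type*} [NormedAddCommGroup E''] [NormedSpace ℝ E'']
  {P : Type*} [TopologicalSpace P] [ChartedSpace E'' P]

/-- The differential as a map of model spaces. -/
def mD (f : M → N) (x : M) : E →L[ℝ] E' := mfderiv 𝓘(ℝ, E) 𝓘(ℝ, E') f x

variable {E E'}

theorem mD_eq_fderiv (f : E → E') (x : E) : mD E E' f x = fderiv ℝ f x := mfderiv_eq_fderiv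

theorem mD_comp {g : N → P} {f : M → N} {x : M}
    (hg : MDifferentiableAt 𝓘(ℝ, E') 𝓘(ℝ, E'') g (f x))
    (hf : MDifferentiableAt 𝓘(ℝ, E) 𝓘(ℝ, E') f x) :
    mD E E'' (fun y => g (f y)) x = mD E' E'' g (f x) ∘L mD E E' f x :=
  mfderiv_comp x hg hf

theorem mD_comp_apply {g : N → P} {f : M → N} {x : M}
    (hg : MDifferentiableAt 𝓘(ℝ, E') 𝓘(ℝ, E'') g (f x))
    (hf : MDifferentiableAt 𝓘(ℝ, E) 𝓘(ℝ, E') f x) (v : E) :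
    mD E E'' (fun y => g (f y)) x v = mD E' E'' g (f x) (mD E E' f x v) :=
  DFunLike.congr_fun (mD_comp hg hf) v

theorem mD_congr {f g : M → N} {x : M} (h : f =ᶠ[𝓝 x] g) : mD E E' f x = mD E E' g x :=
  h.mfderiv_eq

theorem mD_id (x : M) : mD E E (fun y : M => y) x = ContinuousLinearMap.id ℝ E := mfderiv_id

theorem mD_const (y : N) (x : M) : mD E E' (fun _ : M => y) x = 0 := mfderiv_const

theorem mD_clm (L : E →L[ℝ] E') (x : E) : mD E E' L x = L := L.mfderiv_eq

end Differential

/-! ### Inverse charts and curves with prescribed velocity. -/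

section ChartSymm

variable {E : Type*} [NormedAddCommGroup E] [NormedSpace ℝ E]
  {M : Type*} [TopologicalSpace M] [ChartedSpace E M] [IsManifold 𝓘(ℝ, E) ∞ M]

theorem contMDiffOn_chartAt_symm' (x : M) :
    ContMDiffOn 𝓘(ℝ, E) 𝓘(ℝ, E) ∞ (chartAt E x).symm (chartAt E x).target :=
  contMDiffOn_symm_of_mem_maximalAtlas (IsManifold.chart_mem_maximalAtlas x)

theorem mfderiv_chartAt_symm_self (x : M) :
    mfderiv 𝓘(ℝ, E) 𝓘(ℝ, E) (chartAt E x).symm (chartAt E x x) = ContinuousLinearMap.id ℝ E := by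
  have hx := mem_chart_source E x
  have ht := (chartAt E x).map_source hx
  have h1 : MDifferentiableAt 𝓘(ℝ, E) 𝓘(ℝ, E) (chartAt E x)
      ((chartAt E x).symm (chartAt E x x)) := by
    rw [(chartAt E x).left_inv hx]
    exact ((contMDiffOn_chartAt' x).contMDiffAt
      ((chartAt E x).open_source.mem_nhds hx)).mdifferentiableAt (by simp)
  have h2 : MDifferentiableAt 𝓘(ℝ, E) 𝓘(ℝ, E) (chartAt E x).symm (chartAt E x x) :=
    ((contMDiffOn_chartAt_symm' x).contMDiffAt
      ((chartAt E x).open_target.mem_nhds ht)).mdifferentiableAt (by simp)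
  have h3 := mfderiv_comp (chartAt E x x) h1 h2
  have h4 : (chartAt E x) ∘ (chartAt E x).symm =ᶠ[𝓝 (chartAt E x x)] id := by
    filter_upwards [(chartAt E x).open_target.mem_nhds ht] with y hy
    simp [(chartAt E x).right_inv hy]
  rw [h4.mfderiv_eq, mfderiv_id, (chartAt E x).left_inv hx, mfderiv_chartAt_self] at h3
  exact h3.symm

/-- Every tangent vector is the velocity of a smooth curve. -/
theorem exists_curve (x : M) (u : E) : ∃ c : ℝ → M, c 0 = x ∧
    ContMDiffAt 𝓘(ℝ, ℝ) 𝓘(ℝ, E) ∞ c 0 ∧ (mfderiv 𝓘(ℝ, ℝ) 𝓘(ℝ, E) c 0 : ℝ →L[ℝ] E) 1 = u := by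
  have hx := mem_chart_source E x
  have ht := (chartAt E x).map_source hx
  let a : ℝ → E := fun t => chartAt E x x + t • u
  have ha0 : a 0 = chartAt E x x := by simp [a]
  have ha : ContDiff ℝ ∞ a := contDiff_const.add (contDiff_id.smul contDiff_const)
  have hs : ContMDiffAt 𝓘(ℝ, E) 𝓘(ℝ, E) ∞ (chartAt E x).symm (a 0) := by
    rw [ha0]
    exact (contMDiffOn_chartAt_symm' x).contMDiffAt ((chartAt E x).open_target.mem_nhds ht)
  refine ⟨fun t => (chartAt E x).symm (a t), by simp [ha0, (chartAt E x).left_inv hx],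
    hs.comp 0 ha.contMDiff.contMDiffAt, ?_⟩
  have h1 := mfderiv_comp (0 : ℝ) (hs.mdifferentiableAt (by simp))
    (ha.contMDiff.mdifferentiableAt (by simp))
  rw [ha0, mfderiv_chartAt_symm_self, mfderiv_eq_fderiv] at h1
  have h2 : HasFDerivAt a ((ContinuousLinearMap.id ℝ ℝ).smulRight u) 0 :=
    ((ContinuousLinearMap.id ℝ ℝ).smulRight u).hasFDerivAt.const_add _
  rw [h2.fderiv] at h1
  exact (DFunLike.congr_fun (F := ℝ →L[ℝ] E) h1 1).trans (one_smul ℝ u)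

end ChartSymm

/-! ### The subgroup `Γ₀`, its Lie algebra, and transversality. -/

section ClosedSubgroup

open Module Manifold Topology

variable {E : Type*} [NormedAddCommGroup E] [NormedSpace ℝ E] [FiniteDimensional ℝ E]
  {Γ : Type*} [TopologicalSpace Γ] [ChartedSpace E Γ] [Group Γ] [LieGroup 𝓘(ℝ, E) ∞ Γ]
  {F : Type*} [NormedAddCommGroup F] [NormedSpace ℝ F] [FiniteDimensional ℝ F]
  {Γ₀ : Subgroup Γ} [ChartedSpace F (Γ ⧸ Γ₀)] [IsManifold 𝓘(ℝ, F) ∞ (Γ ⧸ Γ₀)]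

variable (E F) in
/-- The differential of the projection `Γ → Γ/Γ₀`. -/
def dproj (Γ₀ : Subgroup Γ) [ChartedSpace F (Γ ⧸ Γ₀)] (γ : Γ) : E →L[ℝ] F :=
  mfderiv 𝓘(ℝ, E) 𝓘(ℝ, F) (QuotientGroup.mk : Γ → Γ ⧸ Γ₀) γ

variable (E F) in
/-- The Lie algebra of `Γ₀`, as the kernel of the differential at `1` of `Γ → Γ/Γ₀`. -/
def lieSub (Γ₀ : Subgroup Γ) [ChartedSpace F (Γ ⧸ Γ₀)] : Submodule ℝ E :=
  LinearMap.ker (dproj E F Γ₀ 1).toLinearMap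

theorem mem_lieSub {X : E} : X ∈ lieSub E F Γ₀ ↔ dproj E F Γ₀ 1 X = 0 := Iff.rfl

theorem surjective_dproj
    (hq : IsSubmersion 𝓘(ℝ, E) 𝓘(ℝ, F) ∞ (QuotientGroup.mk : Γ → Γ ⧸ Γ₀)) (γ : Γ) :
    Surjective (dproj E F Γ₀ γ) := by
  have : IsManifold 𝓘(ℝ, E) ∞ Γ := isManifold_group
  exact surjective_mfderiv_of_isSubmersion hq γ

theorem contMDiff_smul_quotient
    (hq : IsSubmersion 𝓘(ℝ, E) 𝓘(ℝ, F) ∞ (QuotientGroup.mk : Γ → Γ ⧸ Γ₀)) (γ : Γ) :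
    ContMDiff 𝓘(ℝ, F) 𝓘(ℝ, F) ∞ (fun q : Γ ⧸ Γ₀ => γ • q) := by
  have : IsManifold 𝓘(ℝ, E) ∞ Γ := isManifold_group
  exact contMDiff_of_comp_submersion hq QuotientGroup.mk_surjective
    (hq.contMDiff.comp (contMDiff_mul_left (a := γ)))

theorem dproj_mul_left
    (hq : IsSubmersion 𝓘(ℝ, E) 𝓘(ℝ, F) ∞ (QuotientGroup.mk : Γ → Γ ⧸ Γ₀)) (γ δ : Γ) (u : E) :
    dproj E F Γ₀ (γ * δ) ((mfderiv 𝓘(ℝ, E) 𝓘(ℝ, E) (fun h : Γ => γ * h) δ : E →L[ℝ] E) u) =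
      (mfderiv 𝓘(ℝ, F) 𝓘(ℝ, F) (fun q : Γ ⧸ Γ₀ => γ • q) (δ : Γ ⧸ Γ₀) : F →L[ℝ] F)
        (dproj E F Γ₀ δ u) := by
  have h1 := mfderiv_comp δ (g := (QuotientGroup.mk : Γ → Γ ⧸ Γ₀)) (f := fun h : Γ => γ * h)
    (hq.contMDiff.mdifferentiableAt (by simp)) (mdifferentiable_mul_left (E := E) γ δ)
  have h2 := mfderiv_comp δ (g := fun q : Γ ⧸ Γ₀ => γ • q) (f := (QuotientGroup.mk : Γ → Γ ⧸ Γ₀))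
    ((contMDiff_smul_quotient hq γ).mdifferentiableAt (by simp))
    (hq.contMDiff.mdifferentiableAt (by simp))
  have h3 : (mfderiv 𝓘(ℝ, E) 𝓘(ℝ, F) ((QuotientGroup.mk : Γ → Γ ⧸ Γ₀) ∘ fun h : Γ => γ * h) δ) =
    mfderiv 𝓘(ℝ, E) 𝓘(ℝ, F) ((fun q : Γ ⧸ Γ₀ => γ • q) ∘ (QuotientGroup.mk : Γ → Γ ⧸ Γ₀)) δ := rfl
  have h4 := h1.symm.trans (h3.trans h2)
  exact DFunLike.congr_fun (F := E →L[ℝ] F) h4 u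

/-- The projection commutes with left translations, so its kernel at `γ` is the left translate of
its kernel at `1`. -/
theorem dproj_dleft_eq_zero_iff
    (hq : IsSubmersion 𝓘(ℝ, E) 𝓘(ℝ, F) ∞ (QuotientGroup.mk : Γ → Γ ⧸ Γ₀)) (γ : Γ) (X : E) :
    dproj E F Γ₀ γ (dleft E γ X) = 0 ↔ X ∈ lieSub E F Γ₀ := by
  have h1 := dproj_mul_left hq γ 1 X
  rw [mul_one] at h1
  constructor
  · intro h
    have h2 := dproj_mul_left hq γ⁻¹ γ (dleft E γ X)
    rw [h, inv_mul_cancel] at h2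
    replace h2 := h2.trans (map_zero _)
    have h3 := mfderiv_comp (1 : Γ) (g := fun h : Γ => γ⁻¹ * h) (f := fun h : Γ => γ * h)
      (mdifferentiable_mul_left (E := E) _ _) (mdifferentiable_mul_left (E := E) γ 1)
    rw [show (fun h : Γ => γ⁻¹ * h) ∘ (fun h : Γ => γ * h) = id by ext; simp, mfderiv_id,
      mul_one] at h3
    have h4 := DFunLike.congr_fun (F := E →L[ℝ] E) h3 X
    rw [mem_lieSub, ← h2]
    exact congrArg (dproj E F Γ₀ 1) h4
  · intro h
    rw [mem_lieSub] at h
    have h2 := congrArg (mfderiv 𝓘(ℝ, F) 𝓘(ℝ, F) (fun q : Γ ⧸ Γ₀ => γ • q)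
      ((1 : Γ) : Γ ⧸ Γ₀) : F →L[ℝ] F) h
    exact h1.trans (h2.trans (map_zero _))

theorem dproj_eq_zero_iff
    (hq : IsSubmersion 𝓘(ℝ, E) 𝓘(ℝ, F) ∞ (QuotientGroup.mk : Γ → Γ ⧸ Γ₀)) (γ : Γ) (u : E) :
    dproj E F Γ₀ γ u = 0 ↔ AdL E γ⁻¹ (rho E γ u) ∈ lieSub E F Γ₀ := by
  rw [← dproj_dleft_eq_zero_iff hq γ, dleft_AdL_inv_rho]

variable (Γ₀) in
/-- A subgroup whose homogeneous space is a quotient manifold is a submanifold. -/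
theorem exists_subgroup_manifold
    (hq : IsSubmersion 𝓘(ℝ, E) 𝓘(ℝ, F) ∞ (QuotientGroup.mk : Γ → Γ ⧸ Γ₀)) {k : ℕ}
    (hk : k = finrank ℝ E - finrank ℝ F) :
    ∃ (_ : ChartedSpace (EuclideanSpace ℝ (Fin k)) Γ₀) (_ : IsManifold (𝓡 k) ∞ Γ₀),
      IsSmoothEmbedding (𝓡 k) 𝓘(ℝ, E) ∞ (Subtype.val : Γ₀ → Γ) ∧
      (∀ σ, Injective (mfderiv (𝓡 k) 𝓘(ℝ, E) (Subtype.val : Γ₀ → Γ) σ)) ∧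
      ∀ X ∈ lieSub E F Γ₀, ∃ u, mfderiv (𝓡 k) 𝓘(ℝ, E) (Subtype.val : Γ₀ → Γ) 1 u = X := by
  have : IsManifold 𝓘(ℝ, E) ∞ Γ := isManifold_group
  -- `Γ₀` is the fibre of the projection over the trivial coset; the coordinates of the coset of
  -- `x`, centred at that point, are the local equation.
  let h : Γ₀ → Γ → F := fun σ x => chartAt F ((σ : Γ) : Γ ⧸ Γ₀) x - chartAt F ((σ : Γ) : Γ ⧸ Γ₀) (σ : Γ)
  have hd : ∀ σ : Γ₀, mfderiv 𝓘(ℝ, E) 𝓘(ℝ, F) (h σ) σ = dproj E F Γ₀ σ := by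
    intro σ
    have h1 := mfderiv_chartAt_comp (f := (QuotientGroup.mk : Γ → Γ ⧸ Γ₀)) (x := (σ : Γ))
      (hq.contMDiff.mdifferentiableAt (by simp))
    rw [dproj, ← h1]
    have h2 : MDifferentiableAt 𝓘(ℝ, E) 𝓘(ℝ, F)
        (fun y : Γ => chartAt F ((σ : Γ) : Γ ⧸ Γ₀) y) σ :=
      (((contMDiffOn_chartAt' _).contMDiffAt ((chartAt F ((σ : Γ) : Γ ⧸ Γ₀)).open_source.mem_nhds
        (mem_chart_source F _))).comp (σ : Γ) hq.contMDiff.contMDiffAt).mdifferentiableAt (by simp)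
    have h3 := mfderiv_comp (σ : Γ)
      (g := fun w : F => w - chartAt F ((σ : Γ) : Γ ⧸ Γ₀) (σ : Γ))
      (f := fun y : Γ => chartAt F ((σ : Γ) : Γ ⧸ Γ₀) y)
      (differentiableAt_id.sub_const _).mdifferentiableAt h2
    rw [mfderiv_eq_fderiv, fderiv_sub_const, fderiv_fun_id] at h3
    exact h3
  let U : Γ₀ → Set Γ := fun σ =>
    (QuotientGroup.mk : Γ → Γ ⧸ Γ₀) ⁻¹' (chartAt F ((σ : Γ) : Γ ⧸ Γ₀)).source
  have hU : ∀ σ, IsOpen (U σ) := fun σ =>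
    (chartAt F ((σ : Γ) : Γ ⧸ Γ₀)).open_source.preimage hq.contMDiff.continuous
  have hσU : ∀ σ : Γ₀, (σ : Γ) ∈ U σ := fun σ => mem_chart_source F ((σ : Γ) : Γ ⧸ Γ₀)
  have hC : ∀ σ, ContMDiffOn 𝓘(ℝ, E) 𝓘(ℝ, F) ∞ (h σ) (U σ) := fun σ =>
    ((contMDiffOn_chartAt' _).comp hq.contMDiff.contMDiffOn fun _ hx => hx).sub contMDiffOn_const
  have hmk : ∀ σ : Γ₀, ((σ : Γ) : Γ ⧸ Γ₀) = ((1 : Γ) : Γ ⧸ Γ₀) := fun σ =>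
    QuotientGroup.eq.2 (by simp)
  have h0 : ∀ σ, ∀ x ∈ U σ, h σ x = 0 ↔ x ∈ range (Subtype.val : Γ₀ → Γ) := by
    intro σ x hx
    rw [sub_eq_zero, (chartAt F ((σ : Γ) : Γ ⧸ Γ₀)).injOn.eq_iff hx (hσU σ), Subtype.range_coe]
    rw [hmk, eq_comm, QuotientGroup.eq]
    simp
  obtain ⟨cs, hm, he, hinj⟩ := exists_submanifold (Z := Γ₀) (W := F) (i := Subtype.val)
    IsEmbedding.subtypeVal
    (fun σ => ⟨U σ, h σ, hU σ, hσU σ, hC σ, h0 σ, by rw [hd]; exact surjective_dproj hq σ⟩) hk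
  refine ⟨cs, hm, he, hinj, fun X hX => ?_⟩
  refine exists_mfderiv_eq_of_mem_ker (W := F) (h := h 1) (z := (1 : Γ₀))
    (he.contMDiff.mdifferentiableAt (by simp)) (hinj 1)
    (((hC 1).contMDiffAt ((hU 1).mem_nhds (hσU 1))).mdifferentiableAt (by simp)) ?_ ?_ hk X ?_
  · filter_upwards [((hU 1).preimage continuous_subtype_val).mem_nhds (hσU 1)] with z hz
    exact (h0 1 _ hz).2 ⟨z, rfl⟩
  · rw [hd]; exact surjective_dproj hq _
  · exact (DFunLike.congr_fun (F := E →L[ℝ] F) (hd 1) X).trans hX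

/-- A curve in `Γ₀` projects to a constant. Conversely, `Γ₀` is a submanifold whose tangent space at
`1` contains this kernel, and any tangent vector of a manifold is the velocity of a curve in it; no
exponential map is needed. -/
theorem mem_lieAlgebraOf_iff
    (hq : IsSubmersion 𝓘(ℝ, E) 𝓘(ℝ, F) ∞ (QuotientGroup.mk : Γ → Γ ⧸ Γ₀)) (X : E) :
    (show GroupLieAlgebra 𝓘(ℝ, E) Γ from X) ∈ lieAlgebraOf Γ₀ ↔ X ∈ lieSub E F Γ₀ := by
  constructor
  · rintro ⟨c, hc0, hc, hcs, rfl⟩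
    have h1 := mfderiv_comp (0 : ℝ) (g := (QuotientGroup.mk : Γ → Γ ⧸ Γ₀)) (f := c)
      (hq.contMDiff.mdifferentiableAt (by simp)) (hcs.mdifferentiableAt (by simp))
    have h2 : (QuotientGroup.mk : Γ → Γ ⧸ Γ₀) ∘ c = fun _ => ((1 : Γ) : Γ ⧸ Γ₀) := by
      funext t
      exact (QuotientGroup.eq.2 (by simpa using hc t))
    rw [h2, mfderiv_const, hc0] at h1
    exact (DFunLike.congr_fun (F := ℝ →L[ℝ] F) h1 1).symm
  · intro hX
    obtain ⟨cs, hm, he, -, hex⟩ := exists_subgroup_manifold Γ₀ hq rfl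
    obtain ⟨u, hu⟩ := hex X hX
    obtain ⟨c, hc0, hc, hcu⟩ := exists_curve
      (E := EuclideanSpace ℝ (Fin (finrank ℝ E - finrank ℝ F))) (1 : Γ₀) u
    refine ⟨fun t => c t, by simp [hc0], fun t => (c t).2, ?_, ?_⟩
    · exact he.contMDiff.contMDiffAt.comp (0 : ℝ) hc
    · have h1 := mfderiv_comp (0 : ℝ) (g := (Subtype.val : Γ₀ → Γ)) (f := c)
        (he.contMDiff.mdifferentiableAt (by simp)) (hc.mdifferentiableAt (by simp))
      rw [hc0] at h1
      refine (DFunLike.congr_fun (F := ℝ →L[ℝ] E) h1 1).trans ?_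
      refine Eq.trans ?_ hu
      exact congrArg (mfderiv _ 𝓘(ℝ, E) (Subtype.val : Γ₀ → Γ) 1 :
        EuclideanSpace ℝ (Fin (finrank ℝ E - finrank ℝ F)) →L[ℝ] E) hcu

variable (E F) in
/-- Restriction of functionals to the Lie algebra of `Γ₀`. -/
def resLie (Γ₀ : Subgroup Γ) [ChartedSpace F (Γ ⧸ Γ₀)] :
    (E →L[ℝ] ℝ) →L[ℝ] (lieSub E F Γ₀ →L[ℝ] ℝ) :=
  (ContinuousLinearMap.compL ℝ (lieSub E F Γ₀) E ℝ).flip (lieSub E F Γ₀).subtypeL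

theorem resLie_apply (β : E →L[ℝ] ℝ) (X : lieSub E F Γ₀) : resLie E F Γ₀ β X = β X := rfl

theorem resLie_eq_zero_iff (β : E →L[ℝ] ℝ) :
    resLie E F Γ₀ β = 0 ↔ ∀ X ∈ lieSub E F Γ₀, β X = 0 :=
  ⟨fun h X hX => DFunLike.congr_fun h ⟨X, hX⟩, fun h => by ext X; exact h X X.2⟩

theorem mem_Ann_iff
    (hq : IsSubmersion 𝓘(ℝ, E) 𝓘(ℝ, F) ∞ (QuotientGroup.mk : Γ → Γ ⧸ Γ₀)) (β : LieDual E Γ) :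
    β ∈ Ann Γ₀ ↔ resLie E F Γ₀ (dualOf β) = 0 := by
  rw [resLie_eq_zero_iff]
  exact forall_congr' fun X => imp_congr (mem_lieAlgebraOf_iff hq X) Iff.rfl

theorem resLie_surjective : Surjective (resLie E F Γ₀) := by
  intro α
  obtain ⟨g, hg⟩ := LinearMap.exists_extend α.toLinearMap
  refine ⟨LinearMap.toContinuousLinearMap g, ?_⟩
  ext X
  exact LinearMap.congr_fun hg X

theorem finrank_dual_lieSub :
    finrank ℝ (lieSub E F Γ₀ →L[ℝ] ℝ) = finrank ℝ (lieSub E F Γ₀) := by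
  rw [← (LinearMap.toContinuousLinearMap (𝕜 := ℝ) (E := lieSub E F Γ₀) (F' := ℝ)).finrank_eq]
  exact Subspace.dual_finrank_eq

/-- Evaluation at `Z` is linear and continuous, so it commutes with differentiation of the
`𝔤^*`-valued orbit map. -/
theorem mem_orbitTangent_iff (β α : LieDual E Γ) :
    α ∈ orbitTangent β ↔ ∃ X : E, dualOf α = dcoAdL (Γ := Γ) (dualOf β) 1 X := by
  have h : ∀ X Z : E, (mfderiv 𝓘(ℝ, E) 𝓘(ℝ, ℝ) (fun γ : Γ => coAdL γ (dualOf β) Z) 1 :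
      E →L[ℝ] ℝ) X = dcoAdL (Γ := Γ) (dualOf β) 1 X Z := fun X Z => by
    have h1 := mfderiv_comp (1 : Γ) (g := ContinuousLinearMap.apply ℝ ℝ Z)
      (f := fun γ : Γ => coAdL γ (dualOf β))
      (ContinuousLinearMap.mdifferentiableAt _)
      ((contMDiff_coAdL (Γ := Γ) (dualOf β)).mdifferentiableAt (by simp))
    rw [ContinuousLinearMap.mfderiv_eq] at h1
    exact DFunLike.congr_fun (F := E →L[ℝ] ℝ) h1 X
  refine exists_congr fun X => ⟨fun hX => ?_, fun hX Z => ?_⟩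
  · ext Z
    exact (hX Z).trans (h X Z)
  · exact (DFunLike.congr_fun hX Z).trans (h X Z).symm

variable {β₀ : LieDual E Γ}

/-- Transversality, in terms of the differential of the orbit map. -/
theorem surjective_resLie_dcoAdL
    (hq : IsSubmersion 𝓘(ℝ, E) 𝓘(ℝ, F) ∞ (QuotientGroup.mk : Γ → Γ ⧸ Γ₀))
    (ht : IsTransversal Γ₀ β₀) (b : Orbit' Γ₀ β₀) :
    Surjective (resLie E F Γ₀ ∘L dcoAdL (Γ := Γ) (orbitIncl b.1) 1) := by
  intro α
  obtain ⟨α', rfl⟩ := resLie_surjective α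
  obtain ⟨α₁, h₁, α₂, h₂, h⟩ := ht b.1 b.2 α'
  obtain ⟨X, hX⟩ := (mem_orbitTangent_iff _ _).1 h₁
  refine ⟨X, ?_⟩
  rw [mem_Ann_iff hq] at h₂
  have h3 : α' = dualOf α₁ + dualOf α₂ := h
  have h4 : dcoAdL (Γ := Γ) (orbitIncl b.1) 1 X = dualOf α₁ := hX.symm
  rw [ContinuousLinearMap.comp_apply, h4, h3, map_add, h₂, add_zero]

/-- Transversality implies that the action of `Γ₀` on `O'` is infinitesimally free. -/
theorem eq_zero_of_mem_lieSub
    (hq : IsSubmersion 𝓘(ℝ, E) 𝓘(ℝ, F) ∞ (QuotientGroup.mk : Γ → Γ ⧸ Γ₀))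
    (ht : IsTransversal Γ₀ β₀) (b : Orbit' Γ₀ β₀) {X : E} (hX : X ∈ lieSub E F Γ₀)
    (h : dcoAdL (Γ := Γ) (orbitIncl b.1) 1 X = 0) : X = 0 := by
  -- By transversality every functional on `𝔤₀` has the form `β([Z, ·])`, and `β([Z, X]) = -β([X,
  -- Z]) = 0`; functionals separate points.
  have h1 : ∀ α : lieSub E F Γ₀ →L[ℝ] ℝ, α ⟨X, hX⟩ = 0 := by
    intro α
    obtain ⟨Z, rfl⟩ := surjective_resLie_dcoAdL hq ht b α
    have h2 := DFunLike.congr_fun h Z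
    rw [dcoAdL_one] at h2
    rw [ContinuousLinearMap.comp_apply, resLie_apply, dcoAdL_one, brk_swap, map_neg, h2]
    simp
  by_contra hne
  have hne' : (⟨X, hX⟩ : lieSub E F Γ₀) ≠ 0 := fun h => hne (congrArg Subtype.val h)
  obtain ⟨g, hg⟩ := SeparatingDual.exists_ne_zero (R := ℝ) hne'
  exact hg (h1 g)

end ClosedSubgroup


/-! ### Slices for smooth group actions. -/

section ActionSlice

open Module Manifold

variable {E : Type*} [NormedAddCommGroup E] [NormedSpace ℝ E] [FiniteDimensional ℝ E]
  {X : Type*} [TopologicalSpace X] [ChartedSpace E X] [IsManifold 𝓘(ℝ, E) ∞ X]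
  {V : Type*} [NormedAddCommGroup V] [NormedSpace ℝ V] [FiniteDimensional ℝ V]
  {G : Type*} [TopologicalSpace G] [ChartedSpace V G] [IsManifold 𝓘(ℝ, V) ∞ G] [Group G]
  {Y : Type*} [TopologicalSpace Y]

/-- The slice theorem for a smooth right action, at a point where it is infinitesimally free and
only small group elements return to a small neighbourhood. -/
theorem exists_localSlice_of_action {a : G → X → X}
    (ha : ContMDiff (𝓘(ℝ, V).prod 𝓘(ℝ, E)) 𝓘(ℝ, E) ∞ (fun p : G × X => a p.1 p.2))
    (hone : ∀ x, a 1 x = x) (hmul : ∀ g h x, a h (a g x) = a (g * h) x)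
    {π : X → Y} (hπ : ∀ x x', π x = π x' ↔ ∃ g, a g x = x') (x : X)
    (hinj : Injective (mD V E (fun g => a g x) 1))
    (hclose : ∀ N ∈ 𝓝 (1 : G), ∃ B ∈ 𝓝 x, ∀ y ∈ B, ∀ g, a g y ∈ B → g ∈ N)
    {m : ℕ} (hm : m = finrank ℝ E - finrank ℝ V) :
    ∃ S : LocalSlice (E := E) π (EuclideanSpace ℝ (Fin m)), x ∈ S.U := by
  have hcomplete : CompleteSpace (V × EuclideanSpace ℝ (Fin m)) := FiniteDimensional.complete ℝ _
  let K := EuclideanSpace ℝ (Fin m)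
  have hle : finrank ℝ V ≤ finrank ℝ E :=
    LinearMap.finrank_le_finrank_of_injective
      (f := (mD V E (fun g => a g x) 1).toLinearMap) hinj
  obtain ⟨L, hL⟩ := exists_prod_equiv_of_injective (E := V) (W := E) (K := K)
    (mD V E (fun g => a g x) 1) hinj (by simp [K]; omega)
  let χ := chartAt E x
  let ξ := chartAt V (1 : G)
  have hxχ : x ∈ χ.source := mem_chart_source E x
  have h1ξ : (1 : G) ∈ ξ.source := mem_chart_source V 1
  -- `κ` runs through a slice at `x` in the directions `K` complementary to the orbit, and `σ`
  -- through the group near `1`. The map `Ψ` below, `(v, w) ↦ σ(v) · κ(w)` in coordinates, has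
  -- derivative `L` at the origin.
  let j : V × K → E := fun q => χ x + L (0, q.2)
  let i : V × K → V := fun q => ξ 1 + q.1
  let κ : V × K → X := fun q => χ.symm (j q)
  let σ : V × K → G := fun q => ξ.symm (i q)
  have hj : ContDiff ℝ ∞ j :=
    contDiff_const.add (L.contDiff.comp (contDiff_const.prodMk contDiff_snd))
  have hi : ContDiff ℝ ∞ i := contDiff_const.add contDiff_fst
  let O₁ : Set (V × K) := j ⁻¹' χ.target ∩ i ⁻¹' ξ.target
  have hO₁ : IsOpen O₁ :=
    (χ.open_target.preimage hj.continuous).inter (ξ.open_target.preimage hi.continuous)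
  have hκ : ContMDiffOn 𝓘(ℝ, V × K) 𝓘(ℝ, E) ∞ κ O₁ :=
    (contMDiffOn_chartAt_symm' x).comp hj.contMDiff.contMDiffOn fun q hq => hq.1
  have hσ : ContMDiffOn 𝓘(ℝ, V × K) 𝓘(ℝ, V) ∞ σ O₁ :=
    (contMDiffOn_chartAt_symm' (1 : G)).comp hi.contMDiff.contMDiffOn fun q hq => hq.2
  have hσκ : ContMDiffOn 𝓘(ℝ, V × K) 𝓘(ℝ, E) ∞ (fun q => a (σ q) (κ q)) O₁ :=
    ha.comp_contMDiffOn (hσ.prodMk hκ)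
  let O₂ : Set (V × K) := O₁ ∩ (fun q => a (σ q) (κ q)) ⁻¹' χ.source
  have hO₂ : IsOpen O₂ := hσκ.continuousOn.isOpen_inter_preimage hO₁ χ.open_source
  have hj0 : j 0 = χ x := by simp [j]
  have hi0 : i 0 = ξ 1 := by simp [i]
  have hκ0 : κ 0 = x := by simp only [κ, hj0]; exact χ.left_inv hxχ
  have hσ0 : σ 0 = 1 := by simp only [σ, hi0]; exact ξ.left_inv h1ξ
  have h0O₁ : (0 : V × K) ∈ O₁ :=
    ⟨by rw [mem_preimage, hj0]; exact χ.map_source hxχ,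
      by rw [mem_preimage, hi0]; exact ξ.map_source h1ξ⟩
  have h0O₂ : (0 : V × K) ∈ O₂ := ⟨h0O₁, by
    rw [mem_preimage, hκ0, hσ0, hone]; exact hxχ⟩
  let Ψ : V × K → E := fun q => χ (a (σ q) (κ q))
  have hΨ : ContDiffOn ℝ ∞ Ψ O₂ :=
    ((contMDiffOn_chartAt' x).comp (hσκ.mono inter_subset_left) fun q hq => hq.2).contDiffOn
  have hΨd : DifferentiableAt ℝ Ψ 0 :=
    (hΨ.contDiffAt (hO₂.mem_nhds h0O₂)).differentiableAt (by simp)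
  have hΨ' : fderiv ℝ Ψ 0 = (L : V × K →L[ℝ] E) := by
    have hright : ∀ w : K, fderiv ℝ Ψ 0 (0, w) = L (0, w) := by
      intro w
      have h1 : HasFDerivAt (fun w : K => Ψ (0, w))
          (fderiv ℝ Ψ 0 ∘L ContinuousLinearMap.inr ℝ V K) 0 :=
        HasFDerivAt.comp (0 : K) (f := fun w : K => ((0, w) : V × K))
          hΨd.hasFDerivAt (hasFDerivAt_prodMk_right 0 0)
      have h2 : (fun w : K => Ψ (0, w)) =ᶠ[𝓝 0] fun w => χ x + L (0, w) := by
        have h3 : ∀ᶠ w : K in 𝓝 0, ((0, w) : V × K) ∈ O₁ :=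
          (Continuous.prodMk_right (0 : V)).continuousAt.preimage_mem_nhds (hO₁.mem_nhds h0O₁)
        filter_upwards [h3] with w hw
        have h4 : σ (0, w) = 1 := by
          simp only [σ, i, add_zero]; exact ξ.left_inv h1ξ
        simp only [Ψ, h4, hone]
        exact χ.right_inv hw.1
      have h5 : HasFDerivAt (fun w : K => χ x + L (0, w))
          ((L : V × K →L[ℝ] E) ∘L ContinuousLinearMap.inr ℝ V K) 0 :=
        ((L : V × K →L[ℝ] E) ∘L ContinuousLinearMap.inr ℝ V K).hasFDerivAt.const_add _
      exact DFunLike.congr_fun ((h1.congr_of_eventuallyEq h2.symm).unique h5) w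
    have hleft : ∀ v : V, fderiv ℝ Ψ 0 (v, 0) = L (v, 0) := by
      intro v
      have h1 : HasFDerivAt (fun v : V => Ψ (v, 0))
          (fderiv ℝ Ψ 0 ∘L ContinuousLinearMap.inl ℝ V K) 0 :=
        HasFDerivAt.comp (0 : V) (f := fun v : V => ((v, 0) : V × K))
          hΨd.hasFDerivAt (hasFDerivAt_prodMk_left 0 0)
      have hκ' : ∀ v : V, κ (v, 0) = x := fun v => by
        have : ((0, 0) : V × K) = 0 := rfl
        simp only [κ, j, this, map_zero, add_zero]; exact χ.left_inv hxχ
      have hax : ContMDiff 𝓘(ℝ, V) 𝓘(ℝ, E) ∞ (fun g => a g x) :=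
        ha.comp (contMDiff_id.prodMk contMDiff_const)
      let f : V → X := fun v => a (ξ.symm (ξ 1 + v)) x
      have h2 : (fun v : V => Ψ (v, 0)) = fun v => χ (f v) := by
        funext v
        simp only [Ψ, hκ']; rfl
      have hadd : MDifferentiableAt 𝓘(ℝ, V) 𝓘(ℝ, V) (fun v : V => ξ 1 + v) 0 :=
        (differentiableAt_id.const_add _).mdifferentiableAt
      have hξ : MDifferentiableAt 𝓘(ℝ, V) 𝓘(ℝ, V) ξ.symm (ξ 1 + (0 : V)) := by
        rw [add_zero]
        exact ((contMDiffOn_chartAt_symm' (1 : G)).contMDiffAt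
          (ξ.open_target.mem_nhds (ξ.map_source h1ξ))).mdifferentiableAt (by simp)
      have hf0 : f 0 = x := by simp only [f, add_zero]; rw [ξ.left_inv h1ξ, hone]
      have hξc : MDifferentiableAt 𝓘(ℝ, V) 𝓘(ℝ, V) (fun v : V => ξ.symm (ξ 1 + v)) 0 :=
        hξ.comp (0 : V) hadd
      have hd : mD V E f 0 = mD V E (fun g => a g x) 1 := by
        have h3 := mD_comp (g := fun g => a g x) (f := fun v : V => ξ.symm (ξ 1 + v)) (x := 0)
          (hax.mdifferentiableAt (by simp)) hξc
        have h4 := mD_comp (g := ξ.symm) (f := fun v : V => ξ 1 + v) (x := 0) hξ hadd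
        have h5 : mD V V ξ.symm (ξ 1) = ContinuousLinearMap.id ℝ V := mfderiv_chartAt_symm_self 1
        have h6 : mD V V (fun v : V => ξ 1 + v) 0 = ContinuousLinearMap.id ℝ V := by
          rw [mD_eq_fderiv, fderiv_const_add, fderiv_fun_id]
        rw [add_zero, h5, h6] at h4
        rw [add_zero, ξ.left_inv h1ξ, h4] at h3
        exact h3
      have h3 : fderiv ℝ (fun v : V => χ (f v)) 0 = mD V E (fun g => a g x) 1 := by
        have h4 := mfderiv_chartAt_comp (E := V) (E' := E) (f := f) (x := 0)
          ((hax.mdifferentiableAt (by simp)).comp (0 : V) hξc)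
        rw [hf0] at h4
        rw [← hd, ← mD_eq_fderiv]
        exact h4
      rw [h2] at h1
      rw [hL, ← h3, h1.fderiv]
      rfl
    refine ContinuousLinearMap.ext fun q => ?_
    have hq : q = (q.1, 0) + (0, q.2) := by simp
    rw [hq, map_add, hright, hleft, ContinuousLinearEquiv.coe_coe, ← map_add]
  obtain ⟨e, h0e, heO, heΨ, heC, heC'⟩ :=
    exists_openPartialHomeomorph_of_contDiffOn hO₂ hΨ h0O₂ L hΨ'
  obtain ⟨r, hr, hball⟩ := Metric.isOpen_iff.1 e.open_source 0 h0e
  -- Group elements whose coordinates are so small that `Ψ` is injective on the corresponding part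
  -- of `V × K`.
  let N₁ : Set G := ξ.source ∩ ξ ⁻¹' (Metric.ball (ξ 1) r)
  have hN₁ : N₁ ∈ 𝓝 (1 : G) :=
    (ξ.isOpen_inter_preimage Metric.isOpen_ball).mem_nhds ⟨h1ξ, Metric.mem_ball_self hr⟩
  obtain ⟨B, hB, hBN⟩ := hclose N₁ hN₁
  have hκB : ∀ᶠ w : K in 𝓝 0, κ (0, w) ∈ B ∧ ‖w‖ < r := by
    refine Filter.Eventually.and ?_ ?_
    · have h1 : ContinuousAt κ ((0, 0) : V × K) :=
        (hκ.contMDiffAt (hO₁.mem_nhds h0O₁)).continuousAt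
      have h2 : ContinuousAt (fun w : K => κ (0, w)) 0 :=
        ContinuousAt.comp (f := fun w : K => ((0, w) : V × K)) h1
          (Continuous.prodMk_right (0 : V)).continuousAt
      refine h2.preimage_mem_nhds ?_
      change B ∈ 𝓝 (κ 0)
      rw [hκ0]; exact hB
    · exact (continuous_norm.continuousAt (x := (0 : K))).preimage_mem_nhds
        (by rw [norm_zero]; exact Iio_mem_nhds hr)
  obtain ⟨A, hA, hAo, h0A⟩ := eventually_nhds_iff.1 hκB
  let D : Set (V × K) := Metric.ball 0 r ×ˢ A
  have hDo : IsOpen D := Metric.isOpen_ball.prod hAo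
  have hDe : D ⊆ e.source := fun q hq => hball (by
    rw [show (0 : V × K) = (0, 0) from rfl, ← ball_prod_same]
    exact ⟨hq.1, by simpa using (hA _ hq.2).2⟩)
  have hD0 : ∀ w ∈ A, ((0, w) : V × K) ∈ D := fun w hw => ⟨Metric.mem_ball_self hr, hw⟩
  have hσ1 : ∀ w : K, σ (0, w) = 1 := fun w => by
    simp only [σ, i, add_zero]; exact ξ.left_inv h1ξ
  have hκs : ∀ w : K, ∀ v : V, κ (v, w) = κ (0, w) := fun w v => rfl
  let U : Set X := χ.source ∩ χ ⁻¹' (e.target ∩ e.symm ⁻¹' D)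
  have hUo : IsOpen U := χ.isOpen_inter_preimage (e.isOpen_inter_preimage_symm hDo)
  have hdecomp : ∀ u ∈ U, a (σ (e.symm (χ u))) (κ (e.symm (χ u))) = u := by
    intro u hu
    have h1 := e.right_inv hu.2.1
    rw [heΨ] at h1
    exact χ.injOn (heO (e.map_target hu.2.1)).2 hu.1 h1
  have hl : ∀ w ∈ A, κ (0, w) ∈ U ∧ e.symm (χ (κ (0, w))) = (0, w) := by
    intro w hw
    have h1 := heO (hDe (hD0 w hw))
    have h2 : χ (κ (0, w)) = e (0, w) := by
      rw [heΨ]; simp only [Ψ, hσ1, hone]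
    have h3 : κ (0, w) ∈ χ.source := by
      have := h1.2
      simpa only [mem_preimage, hσ1, hone] using this
    have h4 : e.symm (χ (κ (0, w))) = (0, w) := by rw [h2, e.left_inv (hDe (hD0 w hw))]
    refine ⟨⟨h3, ?_, ?_⟩, h4⟩
    · rw [h2]; exact e.map_source (hDe (hD0 w hw))
    · rw [mem_preimage, h4]; exact hD0 w hw
  have hsmooth : ContMDiffOn 𝓘(ℝ, E) 𝓘(ℝ, V × K) ∞ (fun u => e.symm (χ u)) U :=
    heC'.contMDiffOn.comp ((contMDiffOn_chartAt' x).mono inter_subset_left) fun u hu => hu.2.1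
  refine ⟨{ U := U, ρ := fun u => (e.symm (χ u)).2, T := A, l := fun w => κ (0, w)
            isOpen_U := hUo
            isOpen_T := hAo
            contMDiffOn_ρ := contDiff_snd.contMDiff.comp_contMDiffOn hsmooth
            contMDiffOn_l := ?_
            mapsTo_ρ := fun u hu => hu.2.2.2
            mapsTo_l := fun w hw => (hl w hw).1
            ρ_l := fun w hw => by rw [(hl w hw).2]
            fibre := ?_ }, ?_⟩
  · exact hκ.comp (contDiff_const.prodMk contDiff_id).contMDiff.contMDiffOn
      fun w hw => (heO (hDe (hD0 w hw))).1
  · intro u hu u' hu'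
    have hd := hdecomp u hu
    have hd' := hdecomp u' hu'
    have hinv : ∀ g z, a g⁻¹ (a g z) = z := fun g z => by rw [hmul, mul_inv_cancel, hone]
    rw [hπ]
    generalize hp : e.symm (χ u) = p at *
    generalize hp' : e.symm (χ u') = p' at *
    have hpD : p ∈ D := hp ▸ hu.2.2
    have hpD' : p' ∈ D := hp' ▸ hu'.2.2
    constructor
    · rintro ⟨g, hg⟩
      -- Removing the small group parts leaves an element carrying one slice point to another. By
      -- `hclose` it lies in `N₁`, where injectivity of `e` forces the slice points to coincide.
      have h1 : a (σ p * g * (σ p')⁻¹) (κ (0, p.2)) = κ (0, p'.2) := by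
        rw [← hmul, ← hmul]
        change a (σ p')⁻¹ (a g (a (σ p) (κ p))) = κ p'
        rw [hd, hg, ← hd', hinv]
      have h2 := hBN _ (hA _ hpD.2).1 (σ p * g * (σ p')⁻¹) (by
        rw [h1]; exact (hA _ hpD'.2).1)
      set g' := σ p * g * (σ p')⁻¹
      have h3 : σ (ξ g' - ξ 1, p.2) = g' := by
        simp only [σ, i, add_sub_cancel]
        exact ξ.left_inv h2.1
      have h4 : ((ξ g' - ξ 1, p.2) : V × K) ∈ D := ⟨by
        have := h2.2
        rw [mem_preimage, Metric.mem_ball, dist_eq_norm] at this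
        simpa using this, hpD.2⟩
      have h5 : e (ξ g' - ξ 1, p.2) = e (0, p'.2) := by
        rw [heΨ, heΨ]
        simp only [Ψ, h3, hσ1, hone, ← h1]
        rfl
      exact (Prod.ext_iff.1 (e.injOn (hDe h4) (hDe (hD0 _ hpD'.2)) h5)).2
    · intro h
      refine ⟨(σ p)⁻¹ * σ p', ?_⟩
      rw [← hd, ← hmul, hinv, ← hd']
      congr 1
      change κ (0, p.2) = κ (0, p'.2)
      rw [h]
  · have := (hl 0 h0A).1
    change κ 0 ∈ U at this
    rwa [hκ0] at this

end ActionSlice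


theorem surjective_mD_of_isSubmersion
    {E₁ : Type*} [NormedAddCommGroup E₁] [NormedSpace ℝ E₁]
    {M : Type*} [TopologicalSpace M] [ChartedSpace E₁ M] [IsManifold 𝓘(ℝ, E₁) ∞ M]
    {E₂ : Type*} [NormedAddCommGroup E₂] [NormedSpace ℝ E₂]
    {N : Type*} [TopologicalSpace N] [ChartedSpace E₂ N] [IsManifold 𝓘(ℝ, E₂) ∞ N]
    {f : M → N} (hf : Manifold.IsSubmersion 𝓘(ℝ, E₁) 𝓘(ℝ, E₂) ∞ f) (x : M) :
    Surjective (mD E₁ E₂ f x) :=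
  surjective_mfderiv_of_isSubmersion hf x

/-! ### The submanifold `O'` and its quotient by `Γ₀`. -/

section LevelOrbit

open Module Manifold Topology

variable {E : Type*} [NormedAddCommGroup E] [NormedSpace ℝ E] [FiniteDimensional ℝ E]
  {Γ : Type*} [TopologicalSpace Γ] [ChartedSpace E Γ] [Group Γ] [LieGroup 𝓘(ℝ, E) ∞ Γ]
  {F : Type*} [NormedAddCommGroup F] [NormedSpace ℝ F] [FiniteDimensional ℝ F]
  {Γ₀ : Subgroup Γ} [ChartedSpace F (Γ ⧸ Γ₀)] [IsManifold 𝓘(ℝ, F) ∞ (Γ ⧸ Γ₀)]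
  {β₀ : LieDual E Γ}
  {n : ℕ} [ChartedSpace (EuclideanSpace ℝ (Fin n)) (Orbit β₀)] [IsManifold (𝓡 n) ∞ (Orbit β₀)]

theorem orbitMapAt_orbitMap (γ δ : Γ) :
    orbitMapAt (orbitMap β₀ γ) δ = orbitMap β₀ (γ * δ) :=
  orbitIncl_injective (coAdL_coAdL γ δ (dualOf β₀))

theorem orbitMapAt_one (b : Orbit β₀) : orbitMapAt b 1 = b :=
  orbitIncl_injective (coAdL_one (orbitIncl b))

theorem orbitMapAt_orbitMapAt (b : Orbit β₀) (γ δ : Γ) :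
    orbitMapAt (orbitMapAt b γ) δ = orbitMapAt b (γ * δ) :=
  orbitIncl_injective (coAdL_coAdL γ δ (orbitIncl b))

/-- A local section `s` of the orbit map reduces the action to multiplication in `Γ`: near the given
point, `b · γ` is the image of `s(b) γ`. -/
theorem contMDiff_orbitMapAt_prod (hπ : IsSubmersion 𝓘(ℝ, E) (𝓡 n) ∞ (orbitMap β₀)) :
    ContMDiff (𝓘(ℝ, E).prod (𝓡 n)) (𝓡 n) ∞
      (fun p : Γ × Orbit β₀ => orbitMapAt p.2 p.1) := by
  have : IsManifold 𝓘(ℝ, E) ∞ Γ := isManifold_group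
  rintro ⟨γ, b⟩
  obtain ⟨δ, rfl⟩ := orbitMap_surjective b
  obtain ⟨s, U, hU, hδ, -, hfs, hs⟩ := exists_local_section hπ δ
  have h1 : ContMDiffAt (𝓘(ℝ, E).prod (𝓡 n)) 𝓘(ℝ, E) ∞
      (fun p : Γ × Orbit β₀ => s p.2 * p.1) (γ, orbitMap β₀ δ) :=
    ContMDiffAt.mul (ContMDiffAt.comp (γ, orbitMap β₀ δ) (g := s)
      (hs.contMDiffAt (hU.mem_nhds hδ)) contMDiffAt_snd) contMDiffAt_fst
  refine (hπ.contMDiff.contMDiffAt.comp _ h1).congr_of_eventuallyEq ?_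
  filter_upwards [(hU.preimage continuous_snd).mem_nhds hδ] with p hp
  simp only [comp_apply]
  rw [← orbitMapAt_orbitMap, hfs _ hp]

theorem contMDiff_orbitMapAt (hπ : IsSubmersion 𝓘(ℝ, E) (𝓡 n) ∞ (orbitMap β₀)) (b : Orbit β₀) :
    ContMDiff 𝓘(ℝ, E) (𝓡 n) ∞ (orbitMapAt b : Γ → Orbit β₀) :=
  (contMDiff_orbitMapAt_prod hπ).comp (contMDiff_id.prodMk contMDiff_const)

theorem mD_orbitMapAt_orbitMap (hπ : IsSubmersion 𝓘(ℝ, E) (𝓡 n) ∞ (orbitMap β₀)) (γ : Γ) (X : E) :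
    mD E (EuclideanSpace ℝ (Fin n)) (orbitMapAt (orbitMap β₀ γ) : Γ → Orbit β₀) 1 X =
      mD E (EuclideanSpace ℝ (Fin n)) (orbitMap β₀) γ (dleft E γ X) := by
  have h : (orbitMapAt (orbitMap β₀ γ) : Γ → Orbit β₀) = fun δ => orbitMap β₀ (γ * δ) :=
    funext fun δ => orbitMapAt_orbitMap γ δ
  rw [h, mD_comp (E' := E) (hπ.contMDiff.mdifferentiableAt (by simp))
    (mdifferentiable_mul_left (E := E) γ 1), mul_one]
  rfl

/-- The orbit is homogeneous, so its tangent spaces consist of infinitesimal generators: a tangent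
vector lifted to `T_γ Γ` is read in the left trivialisation. -/
theorem surjective_mD_orbitMapAt (hπ : IsSubmersion 𝓘(ℝ, E) (𝓡 n) ∞ (orbitMap β₀))
    (b : Orbit β₀) :
    Surjective (mD E (EuclideanSpace ℝ (Fin n)) (orbitMapAt b : Γ → Orbit β₀) 1) := by
  have : IsManifold 𝓘(ℝ, E) ∞ Γ := isManifold_group
  obtain ⟨γ, rfl⟩ := orbitMap_surjective b
  intro v
  obtain ⟨u, hu⟩ := surjective_mD_of_isSubmersion hπ γ v
  refine ⟨AdL E γ⁻¹ (rho E γ u), ?_⟩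
  rw [mD_orbitMapAt_orbitMap hπ, dleft_AdL_inv_rho]
  exact hu

/-- The differential of the inclusion of the orbit into `𝔤^*`. -/
theorem mD_orbitIncl_orbitMapAt (hπ : IsSubmersion 𝓘(ℝ, E) (𝓡 n) ∞ (orbitMap β₀))
    (b : Orbit β₀) (X : E) :
    mD (EuclideanSpace ℝ (Fin n)) (E →L[ℝ] ℝ) orbitIncl b
      (mD E (EuclideanSpace ℝ (Fin n)) (orbitMapAt b : Γ → Orbit β₀) 1 X) =
      dcoAdL (Γ := Γ) (orbitIncl b) 1 X := by
  have h := mD_comp_apply (E := E) (E' := EuclideanSpace ℝ (Fin n)) (E'' := E →L[ℝ] ℝ)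
    (g := orbitIncl) (f := (orbitMapAt b : Γ → Orbit β₀)) (x := 1)
    ((contMDiff_orbitIncl hπ).mdifferentiableAt (by simp))
    ((contMDiff_orbitMapAt hπ b).mdifferentiableAt (by simp)) X
  rw [orbitMapAt_one] at h
  exact h.symm

theorem mem_Ann_orbit_iff
    (hq : IsSubmersion 𝓘(ℝ, E) 𝓘(ℝ, F) ∞ (QuotientGroup.mk : Γ → Γ ⧸ Γ₀)) (b : Orbit β₀) :
    b.1 ∈ Ann Γ₀ ↔ resLie E F Γ₀ (orbitIncl b) = 0 := mem_Ann_iff hq b.1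

theorem contMDiff_resLie_orbitIncl (hπ : IsSubmersion 𝓘(ℝ, E) (𝓡 n) ∞ (orbitMap β₀)) :
    ContMDiff (𝓡 n) 𝓘(ℝ, lieSub E F Γ₀ →L[ℝ] ℝ) ∞
      (fun b : Orbit β₀ => resLie E F Γ₀ (orbitIncl b)) :=
  have h : ContDiff ℝ ∞ (resLie E F Γ₀) := by fun_prop
  h.contMDiff.comp (contMDiff_orbitIncl hπ)

theorem mD_resLie_orbitIncl (hπ : IsSubmersion 𝓘(ℝ, E) (𝓡 n) ∞ (orbitMap β₀)) (b : Orbit β₀) :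
    mD (EuclideanSpace ℝ (Fin n)) (lieSub E F Γ₀ →L[ℝ] ℝ)
      (fun b : Orbit β₀ => resLie E F Γ₀ (orbitIncl b)) b =
    resLie E F Γ₀ ∘L mD (EuclideanSpace ℝ (Fin n)) (E →L[ℝ] ℝ) orbitIncl b := by
  rw [mD_comp (E' := E →L[ℝ] ℝ) (ContinuousLinearMap.mdifferentiableAt _)
    ((contMDiff_orbitIncl hπ).mdifferentiableAt (by simp)), mD_clm]

variable (Γ₀) in
/-- `O'` is a submanifold of the coadjoint orbit. -/
theorem exists_levelOrbit_manifold
    (hq : IsSubmersion 𝓘(ℝ, E) 𝓘(ℝ, F) ∞ (QuotientGroup.mk : Γ → Γ ⧸ Γ₀))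
    (hπ : IsSubmersion 𝓘(ℝ, E) (𝓡 n) ∞ (orbitMap β₀)) (ht : IsTransversal Γ₀ β₀) {n' : ℕ}
    (hn' : n' = n - finrank ℝ (lieSub E F Γ₀)) :
    ∃ (_ : ChartedSpace (EuclideanSpace ℝ (Fin n')) (Orbit' Γ₀ β₀))
      (_ : IsManifold (𝓡 n') ∞ (Orbit' Γ₀ β₀)),
      IsSmoothEmbedding (𝓡 n') (𝓡 n) ∞ (Subtype.val : Orbit' Γ₀ β₀ → Orbit β₀) ∧
      (∀ b, Injective (mD (EuclideanSpace ℝ (Fin n')) (EuclideanSpace ℝ (Fin n))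
        (Subtype.val : Orbit' Γ₀ β₀ → Orbit β₀) b)) ∧
      ∀ (b : Orbit' Γ₀ β₀) (v : EuclideanSpace ℝ (Fin n)),
        resLie E F Γ₀ (mD (EuclideanSpace ℝ (Fin n)) (E →L[ℝ] ℝ) orbitIncl b.1 v) = 0 →
        ∃ u, mD (EuclideanSpace ℝ (Fin n')) (EuclideanSpace ℝ (Fin n))
          (Subtype.val : Orbit' Γ₀ β₀ → Orbit β₀) b u = v := by
  let W := lieSub E F Γ₀ →L[ℝ] ℝ
  let h : Orbit β₀ → W := fun b => resLie E F Γ₀ (orbitIncl b)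
  have hh : ContMDiff (𝓡 n) 𝓘(ℝ, W) ∞ h :=
    contMDiff_resLie_orbitIncl hπ
  have hsurj : ∀ b : Orbit' Γ₀ β₀, Surjective (mD (EuclideanSpace ℝ (Fin n)) W h b.1) := by
    intro b α
    obtain ⟨X, hX⟩ := surjective_resLie_dcoAdL hq ht b α
    refine ⟨mD E (EuclideanSpace ℝ (Fin n)) (orbitMapAt b.1 : Γ → Orbit β₀) 1 X, ?_⟩
    rw [mD_resLie_orbitIncl hπ, ContinuousLinearMap.comp_apply, mD_orbitIncl_orbitMapAt hπ]
    exact hX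
  have hzero : ∀ b : Orbit β₀, h b = 0 ↔ b ∈ range (Subtype.val : Orbit' Γ₀ β₀ → Orbit β₀) := by
    refine fun b => ⟨fun h => ⟨⟨b, (mem_Ann_orbit_iff hq b).2 h⟩, rfl⟩, ?_⟩
    rintro ⟨b, rfl⟩
    exact (mem_Ann_orbit_iff hq b.1).1 b.2
  have hdim : n' = finrank ℝ (EuclideanSpace ℝ (Fin n)) - finrank ℝ W := by
    rw [hn', finrank_dual_lieSub]; simp
  obtain ⟨cs, hm, he, hinj⟩ := exists_submanifold (Z := Orbit' Γ₀ β₀) (W := W)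
    (i := (Subtype.val : Orbit' Γ₀ β₀ → Orbit β₀)) IsEmbedding.subtypeVal
    (fun b => ⟨univ, h, isOpen_univ, mem_univ _, hh.contMDiffOn, fun x _ => hzero x, hsurj b⟩) hdim
  refine ⟨cs, hm, he, hinj, fun b v hv => ?_⟩
  refine exists_mfderiv_eq_of_mem_ker (W := W) (h := h) (he.contMDiff.mdifferentiableAt (by simp))
    (hinj b) (hh.mdifferentiableAt (by simp))
    (Filter.Eventually.of_forall fun z => (hzero _).2 ⟨z, rfl⟩) (hsurj b) hdim v ?_
  have := DFunLike.congr_fun (mD_resLie_orbitIncl (F := F) (Γ₀ := Γ₀) hπ b.1) v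
  exact this.trans hv

variable {n' : ℕ} [ChartedSpace (EuclideanSpace ℝ (Fin n')) (Orbit' Γ₀ β₀)]
  [IsManifold (𝓡 n') ∞ (Orbit' Γ₀ β₀)]

theorem resLie_mD_orbitIncl_val
    (hq : IsSubmersion 𝓘(ℝ, E) 𝓘(ℝ, F) ∞ (QuotientGroup.mk : Γ → Γ ⧸ Γ₀))
    (hπ : IsSubmersion 𝓘(ℝ, E) (𝓡 n) ∞ (orbitMap β₀))
    (he : IsSmoothEmbedding (𝓡 n') (𝓡 n) ∞ (Subtype.val : Orbit' Γ₀ β₀ → Orbit β₀))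
    (b : Orbit' Γ₀ β₀) (u : EuclideanSpace ℝ (Fin n')) :
    resLie E F Γ₀ (mD (EuclideanSpace ℝ (Fin n)) (E →L[ℝ] ℝ) orbitIncl b.1
      (mD (EuclideanSpace ℝ (Fin n')) (EuclideanSpace ℝ (Fin n))
          (Subtype.val : Orbit' Γ₀ β₀ → Orbit β₀) b u)) = 0 := by
  have h1 := mD_comp_apply (E := EuclideanSpace ℝ (Fin n')) (E' := EuclideanSpace ℝ (Fin n))
    (E'' := lieSub E F Γ₀ →L[ℝ] ℝ) (g := fun b : Orbit β₀ => resLie E F Γ₀ (orbitIncl b))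
    (f := (Subtype.val : Orbit' Γ₀ β₀ → Orbit β₀)) (x := b)
    ((contMDiff_resLie_orbitIncl hπ).mdifferentiableAt (by simp)) (he.contMDiff.mdifferentiableAt (by simp)) u
  rw [mD_resLie_orbitIncl hπ, ContinuousLinearMap.comp_apply] at h1
  rw [← h1, show (fun y : Orbit' Γ₀ β₀ => resLie E F Γ₀ (orbitIncl y.1)) = fun _ => 0 from
    funext fun y => (mem_Ann_orbit_iff hq y.1).1 y.2, mD_const]
  rfl

theorem coAd'_one (b : Orbit' Γ₀ β₀) : coAd' 1 b = b := Subtype.ext (orbitMapAt_one b.1)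

theorem coAd'_coAd' (σ τ : Γ₀) (b : Orbit' Γ₀ β₀) : coAd' τ (coAd' σ b) = coAd' (σ * τ) b :=
  Subtype.ext (orbitMapAt_orbitMapAt b.1 σ τ)

/-- The projection `O' → O'/Γ₀`. -/
abbrev orbitQuotientMk (b : Orbit' Γ₀ β₀) : OrbitQuotient Γ₀ β₀ := Quot.mk _ b

/-- The defining relation is already an equivalence, because it comes from a group action. -/
theorem orbitQuotientMk_eq_iff (b b' : Orbit' Γ₀ β₀) :
    orbitQuotientMk b = orbitQuotientMk b' ↔ ∃ σ : Γ₀, coAd' σ b = b' := by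
  have he : Equivalence (fun b b' : Orbit' Γ₀ β₀ => ∃ σ : Γ₀, coAd' σ b = b') :=
    ⟨fun b => ⟨1, coAd'_one b⟩,
      fun {b b'} ⟨σ, h⟩ => ⟨σ⁻¹, by rw [← h, coAd'_coAd', mul_inv_cancel, coAd'_one]⟩,
      fun {b b' b''} ⟨σ, h⟩ ⟨τ, h'⟩ => ⟨σ * τ, by rw [← coAd'_coAd', h, h']⟩⟩
  exact Quot.eq.trans he.eqvGen_iff

variable {k : ℕ} [ChartedSpace (EuclideanSpace ℝ (Fin k)) Γ₀] [IsManifold (𝓡 k) ∞ Γ₀]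

/-- The action is smooth into the ambient orbit and takes values in `O'`; smoothness and continuity
pass to an embedded submanifold. -/
theorem contMDiff_coAd' (hπ : IsSubmersion 𝓘(ℝ, E) (𝓡 n) ∞ (orbitMap β₀))
    (he : IsSmoothEmbedding (𝓡 n') (𝓡 n) ∞ (Subtype.val : Orbit' Γ₀ β₀ → Orbit β₀))
    (hi : IsSmoothEmbedding (𝓡 k) 𝓘(ℝ, E) ∞ (Subtype.val : Γ₀ → Γ)) :
    ContMDiff ((𝓡 k).prod (𝓡 n')) (𝓡 n') ∞ (fun p : Γ₀ × Orbit' Γ₀ β₀ => coAd' p.1 p.2) := by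
  have h1 : ContMDiff ((𝓡 k).prod (𝓡 n')) (𝓡 n) ∞
      (fun p : Γ₀ × Orbit' Γ₀ β₀ => orbitMapAt p.2.1 (p.1 : Γ)) :=
    (contMDiff_orbitMapAt_prod hπ).comp
      ((hi.contMDiff.comp contMDiff_fst).prodMk (he.contMDiff.comp contMDiff_snd))
  exact (ContMDiff.iff_comp_isImmersion he.isImmersion).2
    ⟨h1.continuous.subtype_mk _, h1⟩

theorem mD_val_mem_lieSub
    (hq : IsSubmersion 𝓘(ℝ, E) 𝓘(ℝ, F) ∞ (QuotientGroup.mk : Γ → Γ ⧸ Γ₀))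
    (hi : IsSmoothEmbedding (𝓡 k) 𝓘(ℝ, E) ∞ (Subtype.val : Γ₀ → Γ))
    (u : EuclideanSpace ℝ (Fin k)) :
    mD (EuclideanSpace ℝ (Fin k)) E (Subtype.val : Γ₀ → Γ) 1 u ∈ lieSub E F Γ₀ := by
  have h1 := mD_comp_apply (E := EuclideanSpace ℝ (Fin k)) (E' := E) (E'' := F)
    (g := (QuotientGroup.mk : Γ → Γ ⧸ Γ₀)) (f := (Subtype.val : Γ₀ → Γ)) (x := 1)
    (hq.contMDiff.mdifferentiableAt (by simp)) (hi.contMDiff.mdifferentiableAt (by simp)) u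
  rw [show (fun σ : Γ₀ => ((σ : Γ) : Γ ⧸ Γ₀)) = fun _ => ((1 : Γ) : Γ ⧸ Γ₀) from
    funext fun σ => QuotientGroup.eq.2 (by simp), mD_const] at h1
  exact h1.symm

theorem mD_val_coAd' (hπ : IsSubmersion 𝓘(ℝ, E) (𝓡 n) ∞ (orbitMap β₀))
    (he : IsSmoothEmbedding (𝓡 n') (𝓡 n) ∞ (Subtype.val : Orbit' Γ₀ β₀ → Orbit β₀))
    (hi : IsSmoothEmbedding (𝓡 k) 𝓘(ℝ, E) ∞ (Subtype.val : Γ₀ → Γ)) (b : Orbit' Γ₀ β₀)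
    (u : EuclideanSpace ℝ (Fin k)) :
    mD (EuclideanSpace ℝ (Fin n')) (EuclideanSpace ℝ (Fin n))
      (Subtype.val : Orbit' Γ₀ β₀ → Orbit β₀) b (mD (EuclideanSpace ℝ (Fin k))
        (EuclideanSpace ℝ (Fin n')) (fun σ : Γ₀ => coAd' σ b) 1 u) =
    mD E (EuclideanSpace ℝ (Fin n)) (orbitMapAt b.1 : Γ → Orbit β₀) 1
      (mD (EuclideanSpace ℝ (Fin k)) E (Subtype.val : Γ₀ → Γ) 1 u) := by
  have h1 := mD_comp_apply (E := EuclideanSpace ℝ (Fin k)) (E' := EuclideanSpace ℝ (Fin n'))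
    (E'' := EuclideanSpace ℝ (Fin n)) (g := (Subtype.val : Orbit' Γ₀ β₀ → Orbit β₀))
    (f := fun σ : Γ₀ => coAd' σ b) (x := 1) (he.contMDiff.mdifferentiableAt (by simp))
    (((contMDiff_coAd' hπ he hi).comp
      (contMDiff_id.prodMk contMDiff_const)).mdifferentiableAt (n := ∞) (by simp)) u
  have h2 := mD_comp_apply (E := EuclideanSpace ℝ (Fin k)) (E' := E)
    (E'' := EuclideanSpace ℝ (Fin n)) (g := (orbitMapAt b.1 : Γ → Orbit β₀))
    (f := (Subtype.val : Γ₀ → Γ)) (x := 1)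
    ((contMDiff_orbitMapAt hπ b.1).mdifferentiableAt (by simp))
    (hi.contMDiff.mdifferentiableAt (by simp)) u
  rw [coAd'_one] at h1
  exact h1.symm.trans h2

/-- The infinitesimal action of `Γ₀` on `O'` is free. -/
theorem injective_mD_coAd'
    (hq : IsSubmersion 𝓘(ℝ, E) 𝓘(ℝ, F) ∞ (QuotientGroup.mk : Γ → Γ ⧸ Γ₀))
    (hπ : IsSubmersion 𝓘(ℝ, E) (𝓡 n) ∞ (orbitMap β₀)) (ht : IsTransversal Γ₀ β₀)
    (he : IsSmoothEmbedding (𝓡 n') (𝓡 n) ∞ (Subtype.val : Orbit' Γ₀ β₀ → Orbit β₀))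
    (hi : IsSmoothEmbedding (𝓡 k) 𝓘(ℝ, E) ∞ (Subtype.val : Γ₀ → Γ))
    (hinj : ∀ σ, Injective (mfderiv (𝓡 k) 𝓘(ℝ, E) (Subtype.val : Γ₀ → Γ) σ))
    (b : Orbit' Γ₀ β₀) :
    Injective (mD (EuclideanSpace ℝ (Fin k)) (EuclideanSpace ℝ (Fin n'))
      (fun σ : Γ₀ => coAd' σ b) 1) := by
  refine (injective_iff_map_eq_zero _).2 fun u hu => ?_
  have h1 := mD_val_coAd' hπ he hi b u
  rw [hu, map_zero] at h1
  have h2 := mD_orbitIncl_orbitMapAt hπ b.1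
    (mD (EuclideanSpace ℝ (Fin k)) E (Subtype.val : Γ₀ → Γ) 1 u)
  rw [← h1, map_zero] at h2
  have h3 := eq_zero_of_mem_lieSub hq ht b (mD_val_mem_lieSub hq hi u) h2.symm
  exact hinj 1 (h3.trans (map_zero (mD (EuclideanSpace ℝ (Fin k)) E Subtype.val (1 : Γ₀))).symm)

theorem isOpenQuotientMap_orbitQuotientMk
    (hc : ∀ σ : Γ₀, Continuous (fun b : Orbit' Γ₀ β₀ => coAd' σ b)) :
    IsOpenQuotientMap (orbitQuotientMk : Orbit' Γ₀ β₀ → OrbitQuotient Γ₀ β₀) := by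
  have hq : IsQuotientMap (orbitQuotientMk : Orbit' Γ₀ β₀ → OrbitQuotient Γ₀ β₀) :=
    isQuotientMap_quot_mk
  refine ⟨hq.surjective, hq.continuous, fun U hU => ?_⟩
  rw [← hq.isOpen_preimage]
  have h : orbitQuotientMk ⁻¹' (orbitQuotientMk '' U) =
      ⋃ σ : Γ₀, (fun b : Orbit' Γ₀ β₀ => coAd' σ b) ⁻¹' U := by
    ext z
    simp only [mem_preimage, mem_image, mem_iUnion]
    constructor
    · rintro ⟨u, hu, h⟩
      obtain ⟨σ, hσ⟩ := (orbitQuotientMk_eq_iff _ _).1 h.symm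
      exact ⟨σ, by rw [hσ]; exact hu⟩
    · rintro ⟨σ, h⟩
      exact ⟨_, h, ((orbitQuotientMk_eq_iff _ _).2 ⟨σ, rfl⟩).symm⟩
  rw [h]
  exact isOpen_iUnion fun σ => hU.preimage (hc σ)

variable {m : ℕ}

/-- The orbit space `O'/Γ₀` is a manifold. -/
theorem exists_orbitQuotient_manifold
    (hq : IsSubmersion 𝓘(ℝ, E) 𝓘(ℝ, F) ∞ (QuotientGroup.mk : Γ → Γ ⧸ Γ₀))
    (hπ : IsSubmersion 𝓘(ℝ, E) (𝓡 n) ∞ (orbitMap β₀)) (ht : IsTransversal Γ₀ β₀)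
    (hfree : IsFreeAction Γ₀ β₀) (hproper : IsProperAction Γ₀ β₀)
    (he : IsSmoothEmbedding (𝓡 n') (𝓡 n) ∞ (Subtype.val : Orbit' Γ₀ β₀ → Orbit β₀))
    (hi : IsSmoothEmbedding (𝓡 k) 𝓘(ℝ, E) ∞ (Subtype.val : Γ₀ → Γ))
    (hinj : ∀ σ, Injective (mfderiv (𝓡 k) 𝓘(ℝ, E) (Subtype.val : Γ₀ → Γ) σ))
    (hm : m = n' - k) :
    ∃ (_ : ChartedSpace (EuclideanSpace ℝ (Fin m)) (OrbitQuotient Γ₀ β₀))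
      (_ : IsManifold (𝓡 m) ∞ (OrbitQuotient Γ₀ β₀)),
      T2Space (OrbitQuotient Γ₀ β₀) ∧
      IsSubmersion (𝓡 n') (𝓡 m) ∞ (orbitQuotientMk : Orbit' Γ₀ β₀ → OrbitQuotient Γ₀ β₀) := by
  have hA := contMDiff_coAd' hπ he hi
  have hAc : ∀ σ : Γ₀, ContMDiff (𝓡 n') (𝓡 n') ∞ (fun b : Orbit' Γ₀ β₀ => coAd' σ b) := fun σ =>
    hA.comp (contMDiff_const.prodMk contMDiff_id)
  have hT2 : T2Space (Orbit β₀) := t2Space_orbit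
  have hlc : LocallyCompactSpace (Orbit' Γ₀ β₀) :=
    ChartedSpace.locallyCompactSpace (EuclideanSpace ℝ (Fin n')) _
  have hP : IsProperMap (fun p : Γ₀ × Orbit' Γ₀ β₀ => (coAd' p.1 p.2, p.2)) :=
    isProperMap_iff_isCompact_preimage.2
      ⟨hA.continuous.prodMk continuous_snd, fun K hK => hproper K hK⟩
  have hopen := isOpenQuotientMap_orbitQuotientMk fun σ => (hAc σ).continuous
  have hmove : ∀ b b' : Orbit' Γ₀ β₀, orbitQuotientMk b = orbitQuotientMk b' →
      ∃ g : Orbit' Γ₀ β₀ → Orbit' Γ₀ β₀, ContMDiff (𝓡 n') (𝓡 n') ∞ g ∧ g b = b' ∧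
        ∀ z, orbitQuotientMk (g z) = orbitQuotientMk z := by
    intro b b' h
    obtain ⟨σ, hσ⟩ := (orbitQuotientMk_eq_iff _ _).1 h
    exact ⟨fun z => coAd' σ z, hAc σ, hσ, fun z =>
      ((orbitQuotientMk_eq_iff _ _).2 ⟨σ, rfl⟩).symm⟩
  have hslice : ∀ b : Orbit' Γ₀ β₀, ∃ S : LocalSlice (E := EuclideanSpace ℝ (Fin n'))
      (orbitQuotientMk : Orbit' Γ₀ β₀ → OrbitQuotient Γ₀ β₀) (EuclideanSpace ℝ (Fin m)),
      b ∈ S.U := by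
    intro b
    refine exists_localSlice_of_action (V := EuclideanSpace ℝ (Fin k)) (G := Γ₀)
      (a := fun σ b => coAd' σ b) hA coAd'_one coAd'_coAd' orbitQuotientMk_eq_iff b
      (injective_mD_coAd' hq hπ ht he hi hinj b) ?_ (by simp [hm])
    intro N hN
    obtain ⟨N', hN'N, hN'o, h1⟩ := mem_nhds_iff.1 hN
    -- The elements outside `N'` sweep out a closed set of pairs, since proper maps are closed. By
    -- freeness it misses `(b, b)`, hence also some square neighbourhood `B × B`.
    have hC : IsClosed ((fun p : Γ₀ × Orbit' Γ₀ β₀ => (coAd' p.1 p.2, p.2)) ''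
        (N'ᶜ ×ˢ univ)) :=
      hP.isClosedMap _ (hN'o.isClosed_compl.prod isClosed_univ)
    have hbC : (b, b) ∉ (fun p : Γ₀ × Orbit' Γ₀ β₀ => (coAd' p.1 p.2, p.2)) ''
        (N'ᶜ ×ˢ univ) := by
      rintro ⟨⟨σ, b'⟩, ⟨hσ, -⟩, h⟩
      simp only [Prod.mk.injEq] at h
      obtain ⟨h, rfl⟩ := h
      exact hσ ((hfree σ b' h).symm ▸ h1)
    have hnh := hC.isOpen_compl.mem_nhds hbC
    rw [nhds_prod_eq, Filter.mem_prod_same_iff] at hnh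
    obtain ⟨B, hB, hBB⟩ := hnh
    refine ⟨B, hB, fun y hy σ hσ => hN'N ?_⟩
    by_contra hcon
    exact hBB (mk_mem_prod hσ hy) ⟨(σ, y), ⟨hcon, mem_univ _⟩, rfl⟩
  obtain ⟨cs, hmf, hsub⟩ := exists_quotient_manifold (E := EuclideanSpace ℝ (Fin n')) (n := m)
    hopen hmove hslice
  refine ⟨cs, hmf, ?_, hsub⟩
  -- For an open quotient, Hausdorffness means that the relation is closed; here the relation is the
  -- range of the proper map.
  rw [t2Space_iff_of_isOpenQuotientMap hopen]
  have h := hP.isClosedMap.isClosed_range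
  convert h using 1
  ext ⟨b, b'⟩
  simp only [mem_ofPred_eq, mem_range, Prod.mk.injEq, Prod.exists]
  rw [eq_comm, orbitQuotientMk_eq_iff]
  exact ⟨fun ⟨σ, h⟩ => ⟨σ, b', h, rfl⟩, fun ⟨σ, _, h, h'⟩ => ⟨σ, h' ▸ h⟩⟩

variable [ChartedSpace (EuclideanSpace ℝ (Fin m)) (OrbitQuotient Γ₀ β₀)]
  [IsManifold (𝓡 m) ∞ (OrbitQuotient Γ₀ β₀)]

/-- The kernel of the differential of `O' → O'/Γ₀` consists of the infinitesimal generators. -/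
theorem mD_orbitQuotientMk_eq_zero_iff
    (hq : IsSubmersion 𝓘(ℝ, E) 𝓘(ℝ, F) ∞ (QuotientGroup.mk : Γ → Γ ⧸ Γ₀))
    (hπ : IsSubmersion 𝓘(ℝ, E) (𝓡 n) ∞ (orbitMap β₀)) (ht : IsTransversal Γ₀ β₀)
    (he : IsSmoothEmbedding (𝓡 n') (𝓡 n) ∞ (Subtype.val : Orbit' Γ₀ β₀ → Orbit β₀))
    (hi : IsSmoothEmbedding (𝓡 k) 𝓘(ℝ, E) ∞ (Subtype.val : Γ₀ → Γ))
    (hinj : ∀ σ, Injective (mfderiv (𝓡 k) 𝓘(ℝ, E) (Subtype.val : Γ₀ → Γ) σ))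
    (hm : m = n' - k)
    (hsub : IsSubmersion (𝓡 n') (𝓡 m) ∞
      (orbitQuotientMk : Orbit' Γ₀ β₀ → OrbitQuotient Γ₀ β₀))
    (b : Orbit' Γ₀ β₀) (v : EuclideanSpace ℝ (Fin n')) :
    mD (EuclideanSpace ℝ (Fin n')) (EuclideanSpace ℝ (Fin m))
      (orbitQuotientMk : Orbit' Γ₀ β₀ → OrbitQuotient Γ₀ β₀) b v = 0 ↔
    ∃ u, mD (EuclideanSpace ℝ (Fin k)) (EuclideanSpace ℝ (Fin n'))
      (fun σ : Γ₀ => coAd' σ b) 1 u = v := by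
  set P := mD (EuclideanSpace ℝ (Fin n')) (EuclideanSpace ℝ (Fin m))
    (orbitQuotientMk : Orbit' Γ₀ β₀ → OrbitQuotient Γ₀ β₀) b with hPdef
  set R := mD (EuclideanSpace ℝ (Fin k)) (EuclideanSpace ℝ (Fin n'))
    (fun σ : Γ₀ => coAd' σ b) 1 with hRdef
  have hPs : Surjective P := surjective_mfderiv_of_isSubmersion hsub b
  have hRi : Injective R := injective_mD_coAd' hq hπ ht he hi hinj b
  have hPR : ∀ u, P (R u) = 0 := by
    intro u
    have h1 := mD_comp_apply (E := EuclideanSpace ℝ (Fin k)) (E' := EuclideanSpace ℝ (Fin n'))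
      (E'' := EuclideanSpace ℝ (Fin m))
      (g := (orbitQuotientMk : Orbit' Γ₀ β₀ → OrbitQuotient Γ₀ β₀))
      (f := fun σ : Γ₀ => coAd' σ b) (x := 1) (hsub.contMDiff.mdifferentiableAt (by simp))
      (((contMDiff_coAd' hπ he hi).comp
        (contMDiff_id.prodMk contMDiff_const)).mdifferentiableAt (n := ∞) (by simp)) u
    rw [show (fun σ : Γ₀ => orbitQuotientMk (coAd' σ b)) = fun _ => orbitQuotientMk b from
      funext fun σ => ((orbitQuotientMk_eq_iff _ _).2 ⟨σ, rfl⟩).symm, mD_const, coAd'_one] at h1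
    exact h1.symm
  have hle : LinearMap.range R.toLinearMap ≤ LinearMap.ker P.toLinearMap := by
    rintro _ ⟨u, rfl⟩
    exact hPR u
  have h1 := LinearMap.finrank_range_add_finrank_ker P.toLinearMap
  rw [LinearMap.range_eq_top.2 hPs, finrank_top] at h1
  have h2 := LinearMap.finrank_range_of_inj (f := R.toLinearMap) hRi
  have h3 := Submodule.finrank_mono hle
  simp only [finrank_euclideanSpace, Fintype.card_fin] at h1 h2
  -- The range of `R` has dimension `k` and lies in the kernel of `P`, of dimension `n' - m`; this
  -- inclusion also shows `k ≤ n'`, so the truncated subtraction in `m` is exact.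
  have h4 : LinearMap.range R.toLinearMap = LinearMap.ker P.toLinearMap :=
    Submodule.eq_of_le_of_finrank_eq hle (by omega)
  have h5 : v ∈ LinearMap.ker P.toLinearMap ↔ v ∈ LinearMap.range R.toLinearMap := by rw [h4]
  exact h5

end LevelOrbit


/-! ### Pullback and exterior derivative. -/

section FormCalculus

variable {E : Type*} [NormedAddCommGroup E] [NormedSpace ℝ E]
  {H : Type*} [TopologicalSpace H] {I : ModelWithCorners ℝ E H}
  {M : Type*} [TopologicalSpace M] [ChartedSpace H M]
  {E' : Type*} [NormedAddCommGroup E'] [NormedSpace ℝ E']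
  {H' : Type*} [TopologicalSpace H'] {I' : ModelWithCorners ℝ E' H'}
  {M' : Type*} [TopologicalSpace M'] [ChartedSpace H' M']
  {E'' : Type*} [NormedAddCommGroup E''] [NormedSpace ℝ E'']
  {H'' : Type*} [TopologicalSpace H''] {I'' : ModelWithCorners ℝ E'' H''}
  {M'' : Type*} [TopologicalSpace M''] [ChartedSpace H'' M'']
  {k : ℕ}

theorem pullback_comp {f : M → M'} {g : M' → M''} {x : M}
    (hg : MDifferentiableAt I' I'' g (f x)) (hf : MDifferentiableAt I I' f x)
    (σ : DiffForm I'' M'' k) :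
    pullback I I'' (fun y => g (f y)) σ x = pullback I I' f (pullback I' I'' g σ) x := by
  have h := mfderiv_comp x hg hf
  ext v
  exact congrArg (fun L : E →L[ℝ] E'' => σ (g (f x)) fun i => L (v i)) h

theorem pullback_congr {f g : M → M'} {x : M} (h : f =ᶠ[𝓝 x] g) (σ : DiffForm I' M' k) :
    pullback I I' f σ x = pullback I I' g σ x := by
  have h1 : (mfderiv I I' f x : E →L[ℝ] E') = mfderiv I I' g x := h.mfderiv_eq
  ext v
  change σ (f x) (fun i => (mfderiv I I' f x : E →L[ℝ] E') (v i)) = _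
  rw [h1, h.eq_of_nhds]
  rfl

variable [IsManifold I ∞ M] [I.Boundaryless]

theorem contMDiffOn_extChartAt_symm_infty (x : M) :
    ContMDiffOn 𝓘(ℝ, E) I ∞ (extChartAt I x).symm (extChartAt I x).target :=
  contMDiffOn_extChartAt_symm x

variable {E₁ : Type*} [NormedAddCommGroup E₁] [NormedSpace ℝ E₁]

/-- The exterior derivative commutes with pullback to an open subset of a vector space. -/
theorem pullback_formDeriv {f : E₁ → M} {U : Set E₁} (hU : IsOpen U)
    (hf : ContMDiffOn 𝓘(ℝ, E₁) I ∞ f U) {w : E₁} (hw : w ∈ U) {σ : DiffForm I M k}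
    (hσ : DifferentiableAt ℝ (formInChart I σ (f w)) (extChartAt I (f w) (f w))) :
    pullback 𝓘(ℝ, E₁) I f (formDeriv I σ) w =
      extDeriv (pullback 𝓘(ℝ, E₁) I f σ : E₁ → E₁ [⋀^Fin k]→L[ℝ] ℝ) w := by
  have : IsManifold I 1 M := IsManifold.of_le (n := ∞) (by exact_mod_cast le_top)
  set ψ := extChartAt I (f w)
  let g : E₁ → E := fun w' => ψ (f w')
  let Df : E₁ → E₁ →L[ℝ] E := fun w' => mfderiv 𝓘(ℝ, E₁) I f w'
  let Dψ : M → E →L[ℝ] E := fun y => mfderiv I 𝓘(ℝ, E) ψ y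
  let Ds : E → E →L[ℝ] E := fun z => mfderiv 𝓘(ℝ, E) I ψ.symm z
  have hfw : ∀ w' ∈ U, ContMDiffAt 𝓘(ℝ, E₁) I ∞ f w' := fun w' h =>
    hf.contMDiffAt (hU.mem_nhds h)
  have hψ : ∀ y ∈ (chartAt H (f w)).source, ContMDiffAt I 𝓘(ℝ, E) ∞ ψ y := fun y hy =>
    contMDiffAt_extChartAt' hy
  have hfm : f w ∈ (chartAt H (f w)).source := mem_chart_source H (f w)
  have hg : ContDiffAt ℝ ∞ g w :=
    ((hψ _ hfm).comp w (hfw w hw)).contDiffAt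
  have hgd : ∀ w' ∈ U, f w' ∈ (chartAt H (f w)).source →
      fderiv ℝ g w' = Dψ (f w') ∘L Df w' := by
    intro w' hw' hs
    rw [← mfderiv_eq_fderiv]
    exact mfderiv_comp w' ((hψ _ hs).mdifferentiableAt (by simp))
      ((hfw w' hw').mdifferentiableAt (by simp))
  -- Near `w` the pullback by `f` is the pullback of one fixed coordinate expression by `g`, the map
  -- `f` read in the chart at `f w`; naturality of the derivative between vector spaces then
  -- applies.
  have h1 : (pullback 𝓘(ℝ, E₁) I f σ : E₁ → E₁ [⋀^Fin k]→L[ℝ] ℝ) =ᶠ[𝓝 w] fun w' =>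
      (formInChart I σ (f w) (g w')).compContinuousLinearMap (fderiv ℝ g w') := by
    filter_upwards [hU.mem_nhds hw, (hfw w hw).continuousAt.preimage_mem_nhds
      ((chartAt H (f w)).open_source.mem_nhds hfm)] with w' hw' hs
    have hs' : f w' ∈ ψ.source := by rw [extChartAt_source]; exact hs
    have h2 : ψ.symm (g w') = f w' := ψ.left_inv hs'
    have hinv := mfderivWithin_extChartAt_symm_comp_mfderiv_extChartAt' (I := I) hs'
    rw [I.range_eq_univ, mfderivWithin_univ] at hinv
    have hinv' : ∀ v : E, Ds (g w') (Dψ (f w') v) = v := fun v =>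
      DFunLike.congr_fun (F := E →L[ℝ] E) hinv v
    let τ : M → E [⋀^Fin k]→L[ℝ] ℝ := σ
    refine ContinuousAlternatingMap.ext fun (v : Fin k → E₁) => ?_
    change τ (f w') (fun i => Df w' (v i)) =
      τ (ψ.symm (g w')) (fun i => Ds (g w') (fderiv ℝ g w' (v i)))
    rw [hgd w' hw' hs, h2]
    simp only [ContinuousLinearMap.comp_apply, hinv']
  have h2 : extDeriv (fun w' => (formInChart I σ (f w) (g w')).compContinuousLinearMap
      (fderiv ℝ g w')) w = _ := extDeriv_pullback (r := ∞) (f := g) hσ hg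
    (by rw [minSmoothness_of_isRCLikeNormedField]; exact WithTop.coe_le_coe.2 le_top)
  rw [h1.extDeriv_eq, h2, hgd w hw hfm]
  rfl

end FormCalculus

/-! ### A local criterion for symplectic forms. -/

section Symplectic

variable {E : Type*} [NormedAddCommGroup E] [NormedSpace ℝ E]
  {M : Type*} [TopologicalSpace M] [ChartedSpace E M]

theorem contDiffOn_extDeriv {k : ℕ} {α : E → E [⋀^Fin k]→L[ℝ] ℝ} {U : Set E} (hU : IsOpen U)
    (hα : ContDiffOn ℝ ∞ α U) : ContDiffOn ℝ ∞ (extDeriv α) U :=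
  (ContinuousAlternatingMap.alternatizeUncurryFinCLM ℝ E ℝ).contDiff.comp_contDiffOn
    (hα.fderiv_of_isOpen hU (by simp))

/-- A nondegenerate form which is locally exact in charts is symplectic. -/
theorem isSymplecticForm_of_locally_exact {σ : DiffForm 𝓘(ℝ, E) M 2}
    (h : ∀ x₀ : M, ∀ w ∈ (extChartAt 𝓘(ℝ, E) x₀).target,
      ∃ (U : Set E) (α : E → E [⋀^Fin 1]→L[ℝ] ℝ), IsOpen U ∧ w ∈ U ∧ ContDiffOn ℝ ∞ α U ∧
        ∀ w' ∈ U, formInChart 𝓘(ℝ, E) σ x₀ w' = extDeriv α w')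
    (hnd : ∀ (x : M) (u : E), (∀ v : E, σ x ![u, v] = 0) → u = 0) :
    IsSymplecticForm 𝓘(ℝ, E) σ where
  smooth := by
    intro x₀ w hw
    obtain ⟨U, α, hU, hwU, hα, he⟩ := h x₀ w hw
    have h1 := (contDiffOn_extDeriv hU hα).contDiffAt (hU.mem_nhds hwU)
    refine (h1.congr_of_eventuallyEq ?_).contDiffWithinAt
    filter_upwards [hU.mem_nhds hwU] with w' hw' using he w' hw'
  closed := by
    intro x
    obtain ⟨U, α, hU, hwU, hα, he⟩ := h x (extChartAt 𝓘(ℝ, E) x x) (mem_extChartAt_target x)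
    have h1 : formInChart 𝓘(ℝ, E) σ x =ᶠ[𝓝 (extChartAt 𝓘(ℝ, E) x x)] extDeriv α := by
      filter_upwards [hU.mem_nhds hwU] with w' hw' using he w' hw'
    have h2 : extDeriv (formInChart 𝓘(ℝ, E) σ x) (extChartAt 𝓘(ℝ, E) x x) = 0 := by
      rw [h1.extDeriv_eq]
      exact extDeriv_extDeriv_apply (r := ∞) (hα.contDiffAt (hU.mem_nhds hwU))
        (by rw [minSmoothness_of_isRCLikeNormedField]; exact WithTop.coe_le_coe.2 le_top)
    ext v
    change extDeriv (formInChart 𝓘(ℝ, E) σ x) (extChartAt 𝓘(ℝ, E) x x) _ = 0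
    rw [h2]
    rfl
  nondegenerate := hnd

end Symplectic

/-! ### Descent of basic forms. -/

section Descent

variable {E : Type*} [NormedAddCommGroup E] [NormedSpace ℝ E]
  {X : Type*} [TopologicalSpace X] [ChartedSpace E X]
  {E' : Type*} [NormedAddCommGroup E'] [NormedSpace ℝ E'] [FiniteDimensional ℝ E']
  {Y : Type*} [TopologicalSpace Y] [ChartedSpace E' Y]

/-- Basic forms descend along a surjective map with surjective differentials. -/
theorem exists_pullback_eq {k : ℕ} {π : X → Y} (hπ : Surjective π)
    (hd : ∀ x, Surjective (mD E E' π x)) (α : X → E [⋀^Fin k]→L[ℝ] ℝ)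
    (hα : ∀ x x', π x = π x' → ∀ u u' : Fin k → E,
      (∀ i, mD E E' π x (u i) = mD E E' π x' (u' i)) → α x u = α x' u') :
    ∃ σ : DiffForm 𝓘(ℝ, E') Y k, ∀ (x : X) (u : Fin k → E),
      (σ (π x) : E' [⋀^Fin k]→L[ℝ] ℝ) (fun i => mD E E' π x (u i)) = α x u := by
  have hR : ∀ x, ∃ R : E' →L[ℝ] E, ∀ v, mD E E' π x (R v) = v := fun x => by
    obtain ⟨g, hg⟩ := (mD E E' π x).toLinearMap.exists_rightInverse_of_surjective
      (LinearMap.range_eq_top.2 (hd x))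
    exact ⟨LinearMap.toContinuousLinearMap g, fun v => LinearMap.congr_fun hg v⟩
  choose R hR using hR
  let s : Y → X := surjInv hπ
  have hs : ∀ y, π (s y) = y := surjInv_eq hπ
  let σ : Y → E' [⋀^Fin k]→L[ℝ] ℝ := fun y => (α (s y)).compContinuousLinearMap (R (s y))
  refine ⟨σ, fun x u => hα _ _ (hs _) _ _ fun i => ?_⟩
  exact hR _ _

end Descent

/-! ### Coordinates on the cotangent bundle. -/

section CotangentBundle

variable {F : Type*} [NormedAddCommGroup F] [NormedSpace ℝ F]
  {Q : Type*} [TopologicalSpace Q] [ChartedSpace F Q] [IsManifold 𝓘(ℝ, F) ∞ Q]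

/-- The fibre coordinate of a covector is its transport by the inverse chart: the homomorphism
bundle precomposes with the inverse tangent trivialisation, and the trivial line bundle contributes
the identity. -/
theorem trivializationAt_cotangent_snd {q₀ q : Q} (hq : q ∈ (chartAt F q₀).source)
    (p : F →L[ℝ] ℝ) :
    ((trivializationAt (F →L[ℝ] ℝ) (fun q : Q => TangentSpace 𝓘(ℝ, F) q →L[ℝ] ℝ) q₀
      (⟨q, p⟩ : Cotangent F Q)).2 : F →L[ℝ] ℝ) =
    p ∘L mD F F (chartAt F q₀).symm (chartAt F q₀ q) := by
  have h := TangentBundle.symmL_trivializationAt (I := 𝓘(ℝ, F)) hq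
  rw [ModelWithCorners.range_eq_univ, mfderivWithin_univ] at h
  ext v
  have h2 := DFunLike.congr_fun (F := F →L[ℝ] F) h v
  have h3 : ∀ t : ℝ, (Bundle.Trivialization.continuousLinearMapAt ℝ
      (Bundle.Trivial.trivialization Q ℝ) q : ℝ →L[ℝ] ℝ) t = t := fun t =>
    DFunLike.congr_fun (Bundle.Trivial.continuousLinearMapAt_trivialization ℝ Q ℝ q) t
  exact (h3 _).trans (congrArg p h2)

/-- A section of the cotangent bundle is smooth if its coordinate expression is. -/
theorem contMDiffAt_cotangent_section {p : Q → F →L[ℝ] ℝ} {q₀ : Q}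
    (hp : ContDiffAt ℝ ∞ (fun y => p ((chartAt F q₀).symm y) ∘L mD F F (chartAt F q₀).symm y)
      (chartAt F q₀ q₀)) :
    ContMDiffAt 𝓘(ℝ, F) (𝓘(ℝ, F).prod 𝓘(ℝ, F →L[ℝ] ℝ)) ∞
      (fun q => (⟨q, p q⟩ : Cotangent F Q)) q₀ := by
  refine (Bundle.contMDiffAt_section (E := fun q : Q => TangentSpace 𝓘(ℝ, F) q →L[ℝ] ℝ)
    (s := p) q₀).2 ?_
  have h1 := (hp.contMDiffAt).comp q₀ ((contMDiffOn_chartAt' q₀).contMDiffAt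
    ((chartAt F q₀).open_source.mem_nhds (mem_chart_source F q₀)))
  refine h1.congr_of_eventuallyEq ?_
  filter_upwards [(chartAt F q₀).open_source.mem_nhds (mem_chart_source F q₀)] with q hq
  refine (trivializationAt_cotangent_snd hq (p q)).trans ?_
  simp only [comp_apply]
  rw [(chartAt F q₀).left_inv hq]

variable (F Q) in
theorem mdifferentiable_cotangent_proj :
    MDifferentiable (𝓘(ℝ, F).prod 𝓘(ℝ, F →L[ℝ] ℝ)) 𝓘(ℝ, F) (fun y : Cotangent F Q => y.proj) :=
  ContMDiff.mdifferentiable (n := 1) (Bundle.contMDiff_proj _) (by simp)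

/-- The tautological form in coordinates: `p dq`. -/
theorem formInChart_tautologicalForm (x₀ : Cotangent F Q) {z : F × (F →L[ℝ] ℝ)}
    (hz : z ∈ (extChartAt (𝓘(ℝ, F).prod 𝓘(ℝ, F →L[ℝ] ℝ)) x₀).target) :
    formInChart _ (tautologicalForm F Q) x₀ z =
      oneForm (F × (F →L[ℝ] ℝ)) (z.2 ∘L ContinuousLinearMap.fst ℝ F (F →L[ℝ] ℝ)) := by
  set J := 𝓘(ℝ, F).prod 𝓘(ℝ, F →L[ℝ] ℝ)
  set ψ := extChartAt J x₀ with hψ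
  set x := ψ.symm z with hx
  have hs : x ∈ ψ.source := ψ.map_target hz
  have hψeq : ψ = _ := FiberBundle.extChartAt (IB := 𝓘(ℝ, F)) x₀
  have hproj : ∀ y ∈ ψ.source, (ψ y).1 = chartAt F x₀.proj y.proj ∧
      y.proj ∈ (chartAt F x₀.proj).source ∧
      (ψ y).2 = (trivializationAt (F →L[ℝ] ℝ) (fun q : Q => TangentSpace 𝓘(ℝ, F) q →L[ℝ] ℝ)
        x₀.proj y).2 := by
    intro y hy
    rw [hψeq] at hy ⊢
    have hy2 : y.proj ∈ (extChartAt 𝓘(ℝ, F) x₀.proj).source := hy.2.1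
    rw [extChartAt_source] at hy2
    exact ⟨rfl, hy2, rfl⟩
  obtain ⟨h1, h2, h3⟩ := hproj x hs
  rw [hx, ψ.right_inv hz, ← hx] at h1 h3
  let Dproj : F × (F →L[ℝ] ℝ) →L[ℝ] F := mfderiv J 𝓘(ℝ, F) (fun y : Cotangent F Q => y.proj) x
  let Dψ : F × (F →L[ℝ] ℝ) →L[ℝ] F × (F →L[ℝ] ℝ) :=
    mfderiv 𝓘(ℝ, F × (F →L[ℝ] ℝ)) J ψ.symm z
  let p : F →L[ℝ] ℝ := x.2
  have hsymm : MDifferentiableAt 𝓘(ℝ, F × (F →L[ℝ] ℝ)) J ψ.symm z :=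
    ((contMDiffOn_extChartAt_symm_infty x₀).contMDiffAt
      ((isOpen_extChartAt_target x₀).mem_nhds hz)).mdifferentiableAt (by simp)
  have hc : mD (F × (F →L[ℝ] ℝ)) F (fun z => (ψ.symm z).proj) z = Dproj ∘L Dψ :=
    mfderiv_comp z (mdifferentiable_cotangent_proj F Q _) hsymm
  -- In coordinates the bundle projection is the first factor followed by the inverse base chart.
  -- The derivative of that inverse chart is the one that enters the fibre coordinate, whence `p
  -- dq`.
  have hev : (fun z => (ψ.symm z).proj) =ᶠ[𝓝 z]
      fun z : F × (F →L[ℝ] ℝ) => (chartAt F x₀.proj).symm z.1 := by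
    filter_upwards [(isOpen_extChartAt_target x₀).mem_nhds hz] with z' hz'
    obtain ⟨h1', h2', -⟩ := hproj _ (ψ.map_target hz')
    rw [ψ.right_inv hz'] at h1'
    rw [h1', (chartAt F x₀.proj).left_inv h2']
  have hz1 : z.1 ∈ (chartAt F x₀.proj).target := by
    rw [h1]; exact (chartAt F x₀.proj).map_source h2
  have hc2 := mD_comp (E := F × (F →L[ℝ] ℝ)) (E' := F) (E'' := F) (g := (chartAt F x₀.proj).symm)
    (f := fun z : F × (F →L[ℝ] ℝ) => z.1) (x := z)
    (((contMDiffOn_chartAt_symm' x₀.proj).contMDiffAt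
      ((chartAt F x₀.proj).open_target.mem_nhds hz1)).mdifferentiableAt (by simp))
    (ContinuousLinearMap.fst ℝ F (F →L[ℝ] ℝ)).mdifferentiableAt
  have hfst : mD (F × (F →L[ℝ] ℝ)) F (fun z : F × (F →L[ℝ] ℝ) => z.1) z =
    ContinuousLinearMap.fst ℝ F (F →L[ℝ] ℝ) := mD_clm (ContinuousLinearMap.fst ℝ F _) z
  rw [hfst] at hc2
  have hp := trivializationAt_cotangent_snd h2 p
  rw [← h1] at hp
  refine ContinuousAlternatingMap.ext fun (v : Fin 1 → F × (F →L[ℝ] ℝ)) => ?_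
  change p (Dproj (Dψ (v 0))) = z.2 (v 0).1
  have h4 : Dproj (Dψ (v 0)) = mD F F (chartAt F x₀.proj).symm z.1 (v 0).1 := by
    have := DFunLike.congr_fun (hc.symm.trans ((mD_congr hev).trans hc2)) (v 0)
    exact this
  rw [h4, h3]
  exact (DFunLike.congr_fun hp (v 0).1).symm

end CotangentBundle


/-! ### The momentum level set as a submanifold. -/

section MomentumLevelSet

open Module Manifold Topology

variable {E : Type*} [NormedAddCommGroup E] [NormedSpace ℝ E] [FiniteDimensional ℝ E]
  {Γ : Type*} [TopologicalSpace Γ] [ChartedSpace E Γ] [Group Γ] [LieGroup 𝓘(ℝ, E) ∞ Γ]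
  {F : Type*} [NormedAddCommGroup F] [NormedSpace ℝ F] [FiniteDimensional ℝ F]
  {Γ₀ : Subgroup Γ} [ChartedSpace F (Γ ⧸ Γ₀)] [IsManifold 𝓘(ℝ, F) ∞ (Γ ⧸ Γ₀)]
  {β₀ : LieDual E Γ}

theorem mD_smul_mk
    (hq : IsSubmersion 𝓘(ℝ, E) 𝓘(ℝ, F) ∞ (QuotientGroup.mk : Γ → Γ ⧸ Γ₀)) (γ : Γ) (X : E) :
    mD E F (fun δ : Γ => δ • (γ : Γ ⧸ Γ₀)) 1 X = dproj E F Γ₀ γ (dright E γ X) := by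
  have h := mD_comp_apply (E := E) (E' := E) (E'' := F) (g := (QuotientGroup.mk : Γ → Γ ⧸ Γ₀))
    (f := fun δ : Γ => δ * γ) (x := 1) (hq.contMDiff.mdifferentiableAt (by simp))
    (mdifferentiable_mul_right (E := E) γ 1) X
  rw [one_mul] at h
  exact h

/-- The momentum equation over `q = γ Γ₀`: the covector pulls back to the right-invariant form. -/
theorem momentumMap_eq_iff
    (hq : IsSubmersion 𝓘(ℝ, E) 𝓘(ℝ, F) ∞ (QuotientGroup.mk : Γ → Γ ⧸ Γ₀))
    {x : Cotangent F (Γ ⧸ Γ₀)} {γ : Γ} (hx : x.proj = γ) :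
    momentumMap E F x = β₀ ↔
      ∀ u : E, (x.2 : F →L[ℝ] ℝ) (dproj E F Γ₀ γ u) = dualOf β₀ (rho E γ u) := by
  obtain ⟨q, p⟩ := x
  subst hx
  constructor
  · intro h u
    have h1 := DFunLike.congr_fun (F := E →L[ℝ] ℝ) h (rho E γ u)
    have h2 := mD_smul_mk hq γ (rho E γ u)
    rw [dright_rho] at h2
    refine Eq.trans ?_ h1
    exact congrArg p h2.symm
  · intro h
    refine ContinuousLinearMap.ext fun (X : E) => ?_
    have h2 := h (dright E γ X)
    rw [rho_dright, ← mD_smul_mk hq γ X] at h2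
    exact h2

/-- Evaluate the momentum equation on left translates of `𝔤₀`: these are vertical, so the covector
does not see them, and `rho` turns them into `Ad γ X`. -/
theorem resLie_coAdL_of_momentumMap_eq
    (hq : IsSubmersion 𝓘(ℝ, E) 𝓘(ℝ, F) ∞ (QuotientGroup.mk : Γ → Γ ⧸ Γ₀))
    {x : Cotangent F (Γ ⧸ Γ₀)} {γ : Γ} (hx : x.proj = γ) (h : momentumMap E F x = β₀) :
    resLie E F Γ₀ (coAdL γ (dualOf β₀)) = 0 := by
  rw [resLie_eq_zero_iff]
  intro X hX
  have h1 := (momentumMap_eq_iff hq hx).1 h (dleft E γ X)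
  rw [(dproj_dleft_eq_zero_iff hq γ X).2 hX, rho_dleft] at h1
  exact h1.symm.trans (map_zero (show F →L[ℝ] ℝ from x.2))

/-- A point of the level set is determined by its base point. -/
theorem momentumLevel_ext
    (hq : IsSubmersion 𝓘(ℝ, E) 𝓘(ℝ, F) ∞ (QuotientGroup.mk : Γ → Γ ⧸ Γ₀))
    {x y : Cotangent F (Γ ⧸ Γ₀)} (hx : momentumMap E F x = β₀) (hy : momentumMap E F y = β₀)
    (h : x.proj = y.proj) : x = y := by
  obtain ⟨q, p⟩ := x
  obtain ⟨q', p'⟩ := y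
  obtain rfl : q = q' := h
  obtain ⟨γ, rfl⟩ := QuotientGroup.mk_surjective q
  have h1 := (momentumMap_eq_iff hq rfl).1 hx
  have h2 := (momentumMap_eq_iff hq rfl).1 hy
  have h3 : (p : F →L[ℝ] ℝ) = p' := by
    ext v
    obtain ⟨u, rfl⟩ := surjective_dproj hq γ v
    exact (h1 u).trans (h2 u).symm
  exact congrArg _ h3

/-- The pullback of the right-invariant one-form `β` by a local section of `Γ → Γ/Γ₀`. -/
def sectionCovector (β : E →L[ℝ] ℝ) (s : Γ ⧸ Γ₀ → Γ) (q : Γ ⧸ Γ₀) : F →L[ℝ] ℝ :=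
  β ∘L rho E (s q) ∘L mD F E s q

/-- A vector `u` differs from `ds(dproj u)` by a vertical one, which `β₀ ∘ rho` kills by `h`. So the
covector defined through the section has the required values on all of `T Γ`. -/
theorem momentumMap_sectionCovector
    (hq : IsSubmersion 𝓘(ℝ, E) 𝓘(ℝ, F) ∞ (QuotientGroup.mk : Γ → Γ ⧸ Γ₀))
    {s : Γ ⧸ Γ₀ → Γ} {U : Set (Γ ⧸ Γ₀)} (hU : IsOpen U) (hfs : ∀ q ∈ U, (s q : Γ ⧸ Γ₀) = q)
    (hs : ContMDiffOn 𝓘(ℝ, F) 𝓘(ℝ, E) ∞ s U) {q : Γ ⧸ Γ₀} (hqU : q ∈ U)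
    (h : resLie E F Γ₀ (coAdL (s q) (dualOf β₀)) = 0) :
    momentumMap E F (⟨q, sectionCovector (F := F) (dualOf β₀) s q⟩ : Cotangent F (Γ ⧸ Γ₀)) = β₀ := by
  refine (momentumMap_eq_iff hq (hfs q hqU).symm).2 fun u => ?_
  have h1 : dproj E F Γ₀ (s q) (u - mD F E s q (dproj E F Γ₀ (s q) u)) = 0 := by
    rw [map_sub, sub_eq_zero]
    exact (mfderiv_comp_local_section hU hqU hfs
      ((hs.contMDiffAt (hU.mem_nhds hqU)).mdifferentiableAt (by simp))
      (hq.contMDiff.mdifferentiableAt (by simp)) _).symm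
  rw [dproj_eq_zero_iff hq] at h1
  have h2 := (resLie_eq_zero_iff _).1 h _ h1
  rw [coAdL_apply, AdL_apply_inv, map_sub, map_sub, sub_eq_zero] at h2
  exact h2.symm

theorem contMDiffAt_sectionCovector (β : E →L[ℝ] ℝ) {s : Γ ⧸ Γ₀ → Γ} {U : Set (Γ ⧸ Γ₀)}
    (hU : IsOpen U) (hs : ContMDiffOn 𝓘(ℝ, F) 𝓘(ℝ, E) ∞ s U) {q : Γ ⧸ Γ₀} (hqU : q ∈ U) :
    ContMDiffAt 𝓘(ℝ, F) (𝓘(ℝ, F).prod 𝓘(ℝ, F →L[ℝ] ℝ)) ∞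
      (fun q => (⟨q, sectionCovector (F := F) β s q⟩ : Cotangent F (Γ ⧸ Γ₀))) q := by
  refine contMDiffAt_cotangent_section ?_
  set χ := chartAt F q
  let c : F → Γ := fun y => s (χ.symm y)
  have hV : IsOpen (χ.target ∩ χ.symm ⁻¹' U) := χ.symm.isOpen_inter_preimage hU
  have hχ := contMDiffOn_chartAt_symm' (E := F) q
  have hc : ContMDiffOn 𝓘(ℝ, F) 𝓘(ℝ, E) ∞ c (χ.target ∩ χ.symm ⁻¹' U) :=
    hs.comp (hχ.mono inter_subset_left) fun y hy => hy.2
  have hqs : q ∈ χ.source := mem_chart_source F q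
  have hqV : χ q ∈ χ.target ∩ χ.symm ⁻¹' U :=
    ⟨χ.map_source hqs, by rw [mem_preimage, χ.left_inv hqs]; exact hqU⟩
  have h1 : ContDiffOn ℝ ∞ (fun y => β ∘L maurerCartan (E := E) c y) (χ.target ∩ χ.symm ⁻¹' U) :=
    contDiffOn_const.clm_comp (contDiffOn_maurerCartan hV hc)
  refine (h1.contDiffAt (hV.mem_nhds hqV)).congr_of_eventuallyEq ?_
  filter_upwards [hV.mem_nhds hqV] with y hy
  have h2 := mD_comp (E := F) (E' := F) (E'' := E) (g := s) (f := χ.symm) (x := y)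
    ((hs.contMDiffAt (hU.mem_nhds hy.2)).mdifferentiableAt (by simp))
    ((hχ.contMDiffAt (χ.open_target.mem_nhds hy.1)).mdifferentiableAt (by simp))
  have h3 : maurerCartan (E := E) c y = rho E (c y) ∘L mD F E c y := rfl
  rw [h3, show mD F E c y = _ from h2]
  rfl

/-- Over the domain of a section the level set lies in the graph of one smooth covector field. Its
topology and smooth structure are read off the base from this. -/
theorem val_eq_sectionCovector
    (hq : IsSubmersion 𝓘(ℝ, E) 𝓘(ℝ, F) ∞ (QuotientGroup.mk : Γ → Γ ⧸ Γ₀))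
    {s : Γ ⧸ Γ₀ → Γ} {U : Set (Γ ⧸ Γ₀)} (hU : IsOpen U) (hfs : ∀ q ∈ U, (s q : Γ ⧸ Γ₀) = q)
    (hs : ContMDiffOn 𝓘(ℝ, F) 𝓘(ℝ, E) ∞ s U) (x : MomentumLevel F Γ₀ β₀) (hx : x.1.proj ∈ U) :
    x.1 = ⟨x.1.proj, sectionCovector (F := F) (dualOf β₀) s x.1.proj⟩ :=
  momentumLevel_ext hq x.2 (momentumMap_sectionCovector hq hU hfs hs hx
    (resLie_coAdL_of_momentumMap_eq hq (hfs _ hx).symm x.2)) rfl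

/-- Injectivity is uniqueness of the covector. The inverse is continuous because it is locally given
by the smooth field `sectionCovector`. -/
theorem isEmbedding_momentumLevel_proj
    (hq : IsSubmersion 𝓘(ℝ, E) 𝓘(ℝ, F) ∞ (QuotientGroup.mk : Γ → Γ ⧸ Γ₀)) :
    IsEmbedding (fun x : MomentumLevel F Γ₀ β₀ => x.1.proj) := by
  have : IsManifold 𝓘(ℝ, E) ∞ Γ := isManifold_group
  have hcont : Continuous (fun x : MomentumLevel F Γ₀ β₀ => x.1.proj) :=
    (mdifferentiable_cotangent_proj F (Γ ⧸ Γ₀)).continuous.comp continuous_subtype_val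
  refine ⟨isInducing_iff_nhds.2 fun x => le_antisymm hcont.continuousAt.tendsto.le_comap ?_,
    fun x y h => Subtype.ext (momentumLevel_ext hq x.2 y.2 h)⟩
  obtain ⟨γ, hγ⟩ := QuotientGroup.mk_surjective x.1.proj
  obtain ⟨s, U, hU, hqU, -, hfs, hs⟩ := exists_local_section hq γ
  rw [hγ] at hqU
  rw [nhds_subtype_eq_comap, ← Filter.tendsto_iff_comap]
  have h1 := (contMDiffAt_sectionCovector (F := F) (dualOf β₀) hU hs hqU).continuousAt.tendsto
  rw [← val_eq_sectionCovector hq hU hfs hs x hqU] at h1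
  refine (h1.comp Filter.tendsto_comap).congr' ?_
  filter_upwards [Filter.preimage_mem_comap (hU.mem_nhds hqU)] with y hy
  exact (val_eq_sectionCovector hq hU hfs hs y hy).symm

theorem contMDiff_resLie_coAdL (β : E →L[ℝ] ℝ) :
    ContMDiff 𝓘(ℝ, E) 𝓘(ℝ, lieSub E F Γ₀ →L[ℝ] ℝ) ∞
      (fun γ : Γ => resLie E F Γ₀ (coAdL γ β)) :=
  have h : ContDiff ℝ ∞ (resLie E F Γ₀) := by fun_prop
  h.contMDiff.comp (contMDiff_coAdL β)

theorem mD_resLie_coAdL (β : E →L[ℝ] ℝ) (γ : Γ) :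
    mD E (lieSub E F Γ₀ →L[ℝ] ℝ) (fun γ : Γ => resLie E F Γ₀ (coAdL γ β)) γ =
      resLie E F Γ₀ ∘L dcoAdL β γ := by
  rw [mD_comp (E' := E →L[ℝ] ℝ) (ContinuousLinearMap.mdifferentiableAt _)
    ((contMDiff_coAdL β).mdifferentiableAt (by simp)), mD_clm]
  rfl

/-- `𝔤₀` is isotropic for the pairing given by a point of `O'`. -/
theorem resLie_dcoAdL_eq_zero
    (hq : IsSubmersion 𝓘(ℝ, E) 𝓘(ℝ, F) ∞ (QuotientGroup.mk : Γ → Γ ⧸ Γ₀))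
    (b : Orbit' Γ₀ β₀) {X : E} (hX : X ∈ lieSub E F Γ₀) :
    resLie E F Γ₀ (dcoAdL (Γ := Γ) (orbitIncl b.1) 1 X) = 0 := by
  obtain ⟨cs, hm, he, -, hex⟩ := exists_subgroup_manifold Γ₀ hq rfl
  obtain ⟨u, rfl⟩ := hex X hX
  have h2 := mD_comp_apply (E' := E) (E'' := lieSub E F Γ₀ →L[ℝ] ℝ)
    (g := fun γ : Γ => resLie E F Γ₀ (coAdL γ (orbitIncl b.1))) (f := (Subtype.val : Γ₀ → Γ))
    (x := 1) ((contMDiff_resLie_coAdL _).mdifferentiableAt (by simp))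
    (he.contMDiff.mdifferentiableAt (by simp)) u
  -- `Γ₀` preserves `Ann 𝔤₀`, so along `Γ₀` the restricted orbit map is constant.
  rw [show (fun σ : Γ₀ => resLie E F Γ₀ (coAdL (σ : Γ) (orbitIncl b.1))) = fun _ => 0 from
    funext fun σ => (mem_Ann_orbit_iff hq (coAd' σ b).1).1 (coAd' σ b).2, mD_const,
    mD_resLie_coAdL] at h2
  exact h2.symm

theorem dcoAdL_dleft (β : E →L[ℝ] ℝ) (γ : Γ) (X : E) :
    dcoAdL β γ (dleft E γ X) = dcoAdL (Γ := Γ) (coAdL γ β) 1 X := by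
  ext Y
  rw [dcoAdL_apply, rho_dleft, AdL_brk_of_dual, dcoAdL_one]

/-- Transversality gives surjectivity over `Γ`. Descending along the section changes the vector `u`
by a vertical one, whose contribution vanishes because `𝔤₀` is isotropic. -/
theorem surjective_mD_resLie_section
    (hq : IsSubmersion 𝓘(ℝ, E) 𝓘(ℝ, F) ∞ (QuotientGroup.mk : Γ → Γ ⧸ Γ₀))
    (ht : IsTransversal Γ₀ β₀) {s : Γ ⧸ Γ₀ → Γ} {U : Set (Γ ⧸ Γ₀)} (hU : IsOpen U)
    (hfs : ∀ q ∈ U, (s q : Γ ⧸ Γ₀) = q) (hs : ContMDiffOn 𝓘(ℝ, F) 𝓘(ℝ, E) ∞ s U)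
    {q : Γ ⧸ Γ₀} (hqU : q ∈ U) (h0 : resLie E F Γ₀ (coAdL (s q) (dualOf β₀)) = 0) :
    Surjective (mD F (lieSub E F Γ₀ →L[ℝ] ℝ)
      (fun q => resLie E F Γ₀ (coAdL (s q) (dualOf β₀))) q) := by
  intro α
  let b : Orbit' Γ₀ β₀ := ⟨orbitMap β₀ (s q), (mem_Ann_orbit_iff hq _).2 h0⟩
  have hsd : MDifferentiableAt 𝓘(ℝ, F) 𝓘(ℝ, E) s q :=
    (hs.contMDiffAt (hU.mem_nhds hqU)).mdifferentiableAt (by simp)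
  obtain ⟨X, hX⟩ := surjective_resLie_dcoAdL hq ht b α
  let u : E := dleft E (s q) X
  refine ⟨dproj E F Γ₀ (s q) u, ?_⟩
  have h1 := mD_comp_apply (E := F) (E' := E) (E'' := lieSub E F Γ₀ →L[ℝ] ℝ)
    (g := fun γ : Γ => resLie E F Γ₀ (coAdL γ (dualOf β₀))) (f := s) (x := q)
    ((contMDiff_resLie_coAdL _).mdifferentiableAt (by simp)) hsd (dproj E F Γ₀ (s q) u)
  have h3 : dproj E F Γ₀ (s q) (u - mD F E s q (dproj E F Γ₀ (s q) u)) = 0 := by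
    rw [map_sub, sub_eq_zero]
    exact (mfderiv_comp_local_section hU hqU hfs hsd
      (hq.contMDiff.mdifferentiableAt (by simp)) _).symm
  have h6 : mD F E s q (dproj E F Γ₀ (s q) u) =
    u - (u - mD F E s q (dproj E F Γ₀ (s q) u)) := by abel
  generalize u - mD F E s q (dproj E F Γ₀ (s q) u) = k at h3 h6
  have h4 := resLie_dcoAdL_eq_zero hq b ((dproj_eq_zero_iff hq _ _).1 h3)
  have h5 := dcoAdL_dleft (dualOf β₀) (s q) (AdL E (s q)⁻¹ (rho E (s q) k))
  rw [dleft_AdL_inv_rho] at h5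
  rw [h1, h6, mD_resLie_coAdL, ContinuousLinearMap.comp_apply, map_sub, map_sub, h5]
  have h7 : dcoAdL (dualOf β₀) (s q) u = dcoAdL (Γ := Γ) (orbitIncl b.1) 1 X :=
    dcoAdL_dleft _ _ _
  rw [h7]
  refine Eq.trans ?_ hX
  exact sub_eq_self.2 h4

variable (F Γ₀) in
/-- The momentum level set is a submanifold of the cotangent bundle, and the base point
projection embeds it into `Γ/Γ₀`. -/
theorem exists_momentumLevel_manifold
    (hq : IsSubmersion 𝓘(ℝ, E) 𝓘(ℝ, F) ∞ (QuotientGroup.mk : Γ → Γ ⧸ Γ₀))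
    (ht : IsTransversal Γ₀ β₀) :
    ∃ (l : ℕ) (_ : ChartedSpace (EuclideanSpace ℝ (Fin l)) (MomentumLevel F Γ₀ β₀))
      (_ : IsManifold (𝓡 l) ∞ (MomentumLevel F Γ₀ β₀)),
      IsSmoothEmbedding (𝓡 l) (𝓘(ℝ, F).prod 𝓘(ℝ, F →L[ℝ] ℝ)) ∞
        (Subtype.val : MomentumLevel F Γ₀ β₀ → Cotangent F (Γ ⧸ Γ₀)) ∧
      IsSmoothEmbedding (𝓡 l) 𝓘(ℝ, F) ∞ (fun x : MomentumLevel F Γ₀ β₀ => x.1.proj) := by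
  have : IsManifold 𝓘(ℝ, E) ∞ Γ := isManifold_group
  let W := lieSub E F Γ₀ →L[ℝ] ℝ
  have hreg : ∀ z : MomentumLevel F Γ₀ β₀, ∃ (U : Set (Γ ⧸ Γ₀)) (h : Γ ⧸ Γ₀ → W), IsOpen U ∧
      z.1.proj ∈ U ∧ ContMDiffOn 𝓘(ℝ, F) 𝓘(ℝ, W) ∞ h U ∧
      (∀ x ∈ U, h x = 0 ↔ x ∈ range (fun x : MomentumLevel F Γ₀ β₀ => x.1.proj)) ∧
      Surjective (mD F W h z.1.proj) := by
    intro z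
    obtain ⟨γ, hγ⟩ := QuotientGroup.mk_surjective z.1.proj
    obtain ⟨s, U, hU, hqU, -, hfs, hs⟩ := exists_local_section hq γ
    rw [hγ] at hqU
    refine ⟨U, fun q => resLie E F Γ₀ (coAdL (s q) (dualOf β₀)), hU, hqU,
      (contMDiff_resLie_coAdL _).comp_contMDiffOn hs, fun q hqU => ⟨fun h =>
        ⟨⟨_, momentumMap_sectionCovector hq hU hfs hs hqU h⟩, rfl⟩, ?_⟩, fun α => ?_⟩
    · rintro ⟨x, rfl⟩
      exact resLie_coAdL_of_momentumMap_eq hq (hfs _ hqU).symm x.2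
    · exact surjective_mD_resLie_section hq ht hU hfs hs hqU
        (resLie_coAdL_of_momentumMap_eq hq (hfs _ hqU).symm z.2) α
  obtain ⟨cs, hm, he, hinj⟩ := exists_submanifold (Z := MomentumLevel F Γ₀ β₀) (W := W)
    (i := fun x : MomentumLevel F Γ₀ β₀ => x.1.proj) (isEmbedding_momentumLevel_proj hq) hreg rfl
  refine ⟨_, cs, hm, ?_, he⟩
  have hval : ContMDiff (𝓡 (finrank ℝ F - finrank ℝ W)) (𝓘(ℝ, F).prod 𝓘(ℝ, F →L[ℝ] ℝ)) ∞
      (Subtype.val : MomentumLevel F Γ₀ β₀ → Cotangent F (Γ ⧸ Γ₀)) := by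
    intro x
    obtain ⟨γ, hγ⟩ := QuotientGroup.mk_surjective x.1.proj
    obtain ⟨s, U, hU, hqU, -, hfs, hs⟩ := exists_local_section hq γ
    rw [hγ] at hqU
    refine ((contMDiffAt_sectionCovector (F := F) (dualOf β₀) hU hs hqU).comp x
      he.contMDiff.contMDiffAt).congr_of_eventuallyEq ?_
    filter_upwards [(hU.preimage he.contMDiff.continuous).mem_nhds hqU] with y hy
    exact val_eq_sectionCovector hq hU hfs hs y hy
  -- Followed by the bundle projection, the inclusion is already immersive, so its own differential
  -- is injective.
  refine ⟨isImmersion_of_injective_mfderiv hval fun x => ?_, IsEmbedding.subtypeVal⟩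
  have h1 := mfderiv_comp x (mdifferentiable_cotangent_proj F (Γ ⧸ Γ₀) x.1)
    (hval.mdifferentiableAt (x := x) (by simp))
  intro u v huv
  refine hinj x ?_
  have h2 : ∀ w : EuclideanSpace ℝ (Fin (finrank ℝ F - finrank ℝ W)), _ = _ := fun w =>
    DFunLike.congr_fun (F := EuclideanSpace ℝ (Fin (finrank ℝ F - finrank ℝ W)) →L[ℝ] F) h1 w
  refine (h2 u).trans (Eq.trans ?_ (h2 v).symm)
  exact congrArg (mfderiv (𝓘(ℝ, F).prod 𝓘(ℝ, F →L[ℝ] ℝ)) 𝓘(ℝ, F)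
    (fun y : Cotangent F (Γ ⧸ Γ₀) => y.proj) x.1 : F × (F →L[ℝ] ℝ) →L[ℝ] F) huv

end MomentumLevelSet


/-! ### The reduced space and its bijection with `O'/Γ₀`. -/

section Reduced

open Module Manifold Topology

variable {E : Type*} [NormedAddCommGroup E] [NormedSpace ℝ E] [FiniteDimensional ℝ E]
  {Γ : Type*} [TopologicalSpace Γ] [ChartedSpace E Γ] [Group Γ] [LieGroup 𝓘(ℝ, E) ∞ Γ]
  {F : Type*} [NormedAddCommGroup F] [NormedSpace ℝ F] [FiniteDimensional ℝ F]
  {Γ₀ : Subgroup Γ} [ChartedSpace F (Γ ⧸ Γ₀)] [IsManifold 𝓘(ℝ, F) ∞ (Γ ⧸ Γ₀)]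
  {β₀ : LieDual E Γ}

/-- The stabilizer of `β₀` preserves the momentum level set. -/
theorem momentumMap_cotangentLift
    (hq : IsSubmersion 𝓘(ℝ, E) 𝓘(ℝ, F) ∞ (QuotientGroup.mk : Γ → Γ ⧸ Γ₀)) {γ : Γ}
    (hγ : coAd γ β₀ = β₀) {x : Cotangent F (Γ ⧸ Γ₀)} (hx : momentumMap E F x = β₀) :
    momentumMap E F (cotangentLift F γ x) = β₀ := by
  obtain ⟨q, p⟩ := x
  obtain ⟨δ, rfl⟩ := QuotientGroup.mk_surjective q
  have hx' := (momentumMap_eq_iff hq rfl).1 hx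
  refine (momentumMap_eq_iff hq (γ := γ * δ) rfl).2 fun u => ?_
  let u' : E := mD E E (fun h : Γ => γ⁻¹ * h) (γ * δ) u
  have h1 := dproj_mul_left hq γ⁻¹ (γ * δ) u
  have h2 := rho_mul_left (E := E) γ⁻¹ (γ * δ) u
  have h3 : dproj E F Γ₀ δ u' = (mfderiv 𝓘(ℝ, F) 𝓘(ℝ, F) (fun q : Γ ⧸ Γ₀ => γ⁻¹ • q)
      ((γ * δ : Γ) : Γ ⧸ Γ₀) : F →L[ℝ] F) (dproj E F Γ₀ (γ * δ) u) := by
    rw [← h1, inv_mul_cancel_left]; rfl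
  have h4 : rho E δ u' = AdL E γ⁻¹ (rho E (γ * δ) u) := by
    rw [← h2, inv_mul_cancel_left]; rfl
  have h5 : dualOf β₀ (AdL E γ⁻¹ (rho E (γ * δ) u)) = dualOf β₀ (rho E (γ * δ) u) := by
    have h6 : coAdL γ (dualOf β₀) = dualOf β₀ := hγ
    have h7 := DFunLike.congr_fun h6 (AdL E γ⁻¹ (rho E (γ * δ) u))
    rw [coAdL_apply, AdL_apply_inv] at h7
    exact h7.symm
  rw [← h5, ← h4, ← hx' u']
  exact congrArg (show F →L[ℝ] ℝ from p) h3.symm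

/-- The point of `O'` given by a group element. -/
def orbitPt (hq : IsSubmersion 𝓘(ℝ, E) 𝓘(ℝ, F) ∞ (QuotientGroup.mk : Γ → Γ ⧸ Γ₀)) (γ : Γ)
    (h : resLie E F Γ₀ (coAdL γ (dualOf β₀)) = 0) : Orbit' Γ₀ β₀ :=
  ⟨orbitMap β₀ γ, (mem_Ann_orbit_iff hq _).2 h⟩

/-- The map `M_{β₀} → O'/Γ₀`, `(γ Γ₀, p) ↦ [Ad^*_γ β₀]`. -/
def toOrbitQuotient (hq : IsSubmersion 𝓘(ℝ, E) 𝓘(ℝ, F) ∞ (QuotientGroup.mk : Γ → Γ ⧸ Γ₀))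
    (x : MomentumLevel F Γ₀ β₀) : OrbitQuotient Γ₀ β₀ :=
  orbitQuotientMk (orbitPt hq (Quotient.out x.1.proj)
    (resLie_coAdL_of_momentumMap_eq hq (QuotientGroup.out_eq' x.1.proj).symm x.2))

theorem orbitQuotientMk_orbitPt_eq_iff
    (hq : IsSubmersion 𝓘(ℝ, E) 𝓘(ℝ, F) ∞ (QuotientGroup.mk : Γ → Γ ⧸ Γ₀)) {γ γ' : Γ}
    (h : resLie E F Γ₀ (coAdL γ (dualOf β₀)) = 0)
    (h' : resLie E F Γ₀ (coAdL γ' (dualOf β₀)) = 0) :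
    orbitQuotientMk (orbitPt hq γ h) = orbitQuotientMk (orbitPt hq γ' h') ↔
      ∃ σ : Γ₀, orbitMap β₀ (γ * σ) = orbitMap β₀ γ' := by
  rw [orbitQuotientMk_eq_iff]
  refine exists_congr fun σ => Subtype.ext_iff.trans ?_
  change orbitMapAt (orbitMap β₀ γ) (σ : Γ) = orbitMap β₀ γ' ↔ _
  rw [orbitMapAt_orbitMap]

/-- Two representatives of the base coset differ by an element of `Γ₀`, which is divided out in the
target. -/
theorem toOrbitQuotient_eq
    (hq : IsSubmersion 𝓘(ℝ, E) 𝓘(ℝ, F) ∞ (QuotientGroup.mk : Γ → Γ ⧸ Γ₀))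
    (x : MomentumLevel F Γ₀ β₀) {γ : Γ} (hγ : x.1.proj = γ)
    (h : resLie E F Γ₀ (coAdL γ (dualOf β₀)) = 0) :
    toOrbitQuotient hq x = orbitQuotientMk (orbitPt hq γ h) := by
  refine (orbitQuotientMk_orbitPt_eq_iff hq _ _).2 ⟨⟨(Quotient.out x.1.proj)⁻¹ * γ, ?_⟩, by simp⟩
  exact QuotientGroup.eq.1 ((QuotientGroup.out_eq' x.1.proj).trans hγ)

theorem exists_momentumLevel_over
    (hq : IsSubmersion 𝓘(ℝ, E) 𝓘(ℝ, F) ∞ (QuotientGroup.mk : Γ → Γ ⧸ Γ₀)) {γ : Γ}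
    (h : resLie E F Γ₀ (coAdL γ (dualOf β₀)) = 0) :
    ∃ x : MomentumLevel F Γ₀ β₀, x.1.proj = γ := by
  have : IsManifold 𝓘(ℝ, E) ∞ Γ := isManifold_group
  obtain ⟨s, U, hU, hqU, hsγ, hfs, hs⟩ := exists_local_section hq γ
  exact ⟨⟨_, momentumMap_sectionCovector hq hU hfs hs hqU (by rw [hsγ]; exact h)⟩, rfl⟩

/-- Both sides say that representatives `g`, `h` of the base points lie in the same double coset of
the stabilizer of `β₀` on the left and `Γ₀` on the right. -/
theorem toOrbitQuotient_eq_iff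
    (hq : IsSubmersion 𝓘(ℝ, E) 𝓘(ℝ, F) ∞ (QuotientGroup.mk : Γ → Γ ⧸ Γ₀))
    (x y : MomentumLevel F Γ₀ β₀) :
    toOrbitQuotient hq x = toOrbitQuotient hq y ↔
      ∃ γ : Γ, coAd γ β₀ = β₀ ∧ cotangentLift F γ x.1 = y.1 := by
  obtain ⟨g, hg⟩ := QuotientGroup.mk_surjective x.1.proj
  obtain ⟨h, hh⟩ := QuotientGroup.mk_surjective y.1.proj
  rw [toOrbitQuotient_eq hq x hg.symm (resLie_coAdL_of_momentumMap_eq hq hg.symm x.2),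
    toOrbitQuotient_eq hq y hh.symm (resLie_coAdL_of_momentumMap_eq hq hh.symm y.2),
    orbitQuotientMk_orbitPt_eq_iff]
  constructor
  · rintro ⟨σ, hσ⟩
    rw [orbitMap_eq_iff] at hσ
    have h1 : coAdL (h * (g * σ)⁻¹) (dualOf β₀) = dualOf β₀ := by
      rw [coAdL_mul, ← hσ, ← coAdL_mul, mul_inv_cancel, coAdL_one]
    -- This element fixes `β₀` and carries `g Γ₀` to `h Γ₀`; the covectors then agree because the
    -- base points do.
    refine ⟨h * (g * σ)⁻¹, h1, momentumLevel_ext hq (momentumMap_cotangentLift hq h1 x.2) y.2 ?_⟩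
    change (h * (g * σ)⁻¹) • x.1.proj = y.1.proj
    rw [← hg, ← hh]
    refine QuotientGroup.eq.2 ?_
    simp only [smul_eq_mul]
    convert σ.2 using 1
    group
  · rintro ⟨γ, hγ, hxy⟩
    have h1 : y.1.proj = γ • x.1.proj := by rw [← hxy]; rfl
    rw [← hh, ← hg] at h1
    have h2 : (h : Γ ⧸ Γ₀) = ((γ * g : Γ) : Γ ⧸ Γ₀) := h1
    refine ⟨⟨(γ * g)⁻¹ * h, QuotientGroup.eq.1 h2.symm⟩, ?_⟩
    rw [orbitMap_eq_iff]
    have h3 : coAdL γ (dualOf β₀) = dualOf β₀ := hγ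
    have h4 : g * ((γ * g)⁻¹ * h) = γ⁻¹ * h := by group
    have h5 : coAdL γ⁻¹ (dualOf β₀) = dualOf β₀ := by
      conv_lhs => rw [← h3, ← coAdL_mul, mul_inv_cancel, coAdL_one]
    rw [h4, coAdL_mul, h5]

variable {n : ℕ} [ChartedSpace (EuclideanSpace ℝ (Fin n)) (Orbit β₀)] [IsManifold (𝓡 n) ∞ (Orbit β₀)]
  {n' : ℕ} [ChartedSpace (EuclideanSpace ℝ (Fin n')) (Orbit' Γ₀ β₀)]
  [IsManifold (𝓡 n') ∞ (Orbit' Γ₀ β₀)]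

/-- A smooth map to `Γ` with values over `O'` induces a smooth map to `O'`. -/
theorem exists_levelOrbit_lift
    (hq : IsSubmersion 𝓘(ℝ, E) 𝓘(ℝ, F) ∞ (QuotientGroup.mk : Γ → Γ ⧸ Γ₀))
    (hπ : IsSubmersion 𝓘(ℝ, E) (𝓡 n) ∞ (orbitMap β₀))
    (he : IsSmoothEmbedding (𝓡 n') (𝓡 n) ∞ (Subtype.val : Orbit' Γ₀ β₀ → Orbit β₀))
    {E₁ : Type*} [NormedAddCommGroup E₁] [NormedSpace ℝ E₁]
    {M : Type*} [TopologicalSpace M] [ChartedSpace E₁ M] [IsManifold 𝓘(ℝ, E₁) ∞ M]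
    {c : M → Γ} {U : Set M} (hU : IsOpen U)
    (hc : ContMDiffOn 𝓘(ℝ, E₁) 𝓘(ℝ, E) ∞ c U)
    (h0 : ∀ w ∈ U, resLie E F Γ₀ (coAdL (c w) (dualOf β₀)) = 0) {w₀ : M} (hw₀ : w₀ ∈ U) :
    ∃ g : M → Orbit' Γ₀ β₀, (∀ w (hw : w ∈ U), g w = orbitPt hq (c w) (h0 w hw)) ∧
      ContMDiffOn 𝓘(ℝ, E₁) (𝓡 n') ∞ g U := by
  classical
  -- Membership in `O'` is known only on `U`; off `U` the value at `w₀` serves as a default.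
  let g : M → Orbit' Γ₀ β₀ := fun w =>
    if h : w ∈ U then orbitPt hq (c w) (h0 w h) else orbitPt hq (c w₀) (h0 w₀ hw₀)
  have hg : ∀ w (hw : w ∈ U), g w = orbitPt hq (c w) (h0 w hw) := fun w hw => dif_pos hw
  refine ⟨g, hg, fun w hw => ContMDiffAt.contMDiffWithinAt ?_⟩
  have h1 : ContMDiffAt 𝓘(ℝ, E₁) (𝓡 n) ∞ (fun w => (g w).1) w := by
    refine (hπ.contMDiff.contMDiffAt.comp w
      (hc.contMDiffAt (hU.mem_nhds hw))).congr_of_eventuallyEq ?_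
    filter_upwards [hU.mem_nhds hw] with w' hw'
    rw [hg w' hw']
    rfl
  exact (ContMDiffAt.iff_comp_isImmersionAt (he.isImmersion.isImmersionAt _)).2
    ⟨IsEmbedding.subtypeVal.isInducing.continuousAt_iff.2 h1.continuousAt, h1⟩

variable {m : ℕ} [ChartedSpace (EuclideanSpace ℝ (Fin m)) (OrbitQuotient Γ₀ β₀)]
  [IsManifold (𝓡 m) ∞ (OrbitQuotient Γ₀ β₀)]

/-- Local smooth lifts from `O'/Γ₀` to `Γ` through a given point. -/
theorem exists_group_lift
    (hq : IsSubmersion 𝓘(ℝ, E) 𝓘(ℝ, F) ∞ (QuotientGroup.mk : Γ → Γ ⧸ Γ₀))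
    (hπ : IsSubmersion 𝓘(ℝ, E) (𝓡 n) ∞ (orbitMap β₀))
    (he : IsSmoothEmbedding (𝓡 n') (𝓡 n) ∞ (Subtype.val : Orbit' Γ₀ β₀ → Orbit β₀))
    (hsub : IsSubmersion (𝓡 n') (𝓡 m) ∞
      (orbitQuotientMk : Orbit' Γ₀ β₀ → OrbitQuotient Γ₀ β₀))
    (γ : Γ) (hγ : resLie E F Γ₀ (coAdL γ (dualOf β₀)) = 0) :
    ∃ (c : OrbitQuotient Γ₀ β₀ → Γ) (U : Set (OrbitQuotient Γ₀ β₀)), IsOpen U ∧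
      orbitQuotientMk (orbitPt hq γ hγ) ∈ U ∧ c (orbitQuotientMk (orbitPt hq γ hγ)) = γ ∧
      ContMDiffOn (𝓡 m) 𝓘(ℝ, E) ∞ c U ∧
      ∀ y ∈ U, ∃ h, orbitQuotientMk (orbitPt hq (c y) h) = y := by
  have : IsManifold 𝓘(ℝ, E) ∞ Γ := isManifold_group
  obtain ⟨s, U, hU, hbU, hsb, hfs, hs⟩ := exists_local_section hsub (orbitPt hq γ hγ)
  obtain ⟨t, V, hV, hγV, htγ, hft, ht⟩ := exists_local_section hπ γ
  have hvs : ContMDiffOn (𝓡 m) (𝓡 n) ∞ (fun y => (s y).1) U :=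
    he.contMDiff.comp_contMDiffOn hs
  refine ⟨fun y => t (s y).1, U ∩ (fun y => (s y).1) ⁻¹' V,
    hvs.continuousOn.isOpen_inter_preimage hU hV, ⟨hbU, ?_⟩, ?_,
    ht.comp (hvs.mono inter_subset_left) fun y hy => hy.2, fun y hy => ?_⟩
  · rw [mem_preimage, hsb]; exact hγV
  · exact (congrArg (fun b : Orbit' Γ₀ β₀ => t b.1) hsb).trans htγ
  · have h1 : orbitMap β₀ (t (s y).1) = (s y).1 := hft _ hy.2
    have h2 : resLie E F Γ₀ (coAdL (t (s y).1) (dualOf β₀)) = 0 := by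
      rw [← orbitIncl_orbitMap, h1]
      exact (mem_Ann_orbit_iff hq _).1 (s y).2
    refine ⟨h2, ?_⟩
    rw [show orbitPt hq (t (s y).1) h2 = s y from Subtype.ext h1]
    exact hfs y hy.1

variable {l : ℕ} [ChartedSpace (EuclideanSpace ℝ (Fin l)) (MomentumLevel F Γ₀ β₀)]
  [IsManifold (𝓡 l) ∞ (MomentumLevel F Γ₀ β₀)]

/-- The chosen coset representatives are not smooth, but near a point they may be replaced by a
local section of `Γ → Γ/Γ₀`. -/
theorem contMDiff_toOrbitQuotient
    (hq : IsSubmersion 𝓘(ℝ, E) 𝓘(ℝ, F) ∞ (QuotientGroup.mk : Γ → Γ ⧸ Γ₀))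
    (hπ : IsSubmersion 𝓘(ℝ, E) (𝓡 n) ∞ (orbitMap β₀))
    (he : IsSmoothEmbedding (𝓡 n') (𝓡 n) ∞ (Subtype.val : Orbit' Γ₀ β₀ → Orbit β₀))
    (hsub : IsSubmersion (𝓡 n') (𝓡 m) ∞
      (orbitQuotientMk : Orbit' Γ₀ β₀ → OrbitQuotient Γ₀ β₀))
    (hp : IsSmoothEmbedding (𝓡 l) 𝓘(ℝ, F) ∞ (fun x : MomentumLevel F Γ₀ β₀ => x.1.proj)) :
    ContMDiff (𝓡 l) (𝓡 m) ∞ (toOrbitQuotient hq : MomentumLevel F Γ₀ β₀ → _) := by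
  have : IsManifold 𝓘(ℝ, E) ∞ Γ := isManifold_group
  intro x
  obtain ⟨γ, hγ⟩ := QuotientGroup.mk_surjective x.1.proj
  obtain ⟨s, U, hU, hqU, -, hfs, hs⟩ := exists_local_section hq γ
  rw [hγ] at hqU
  have hV : IsOpen ((fun x : MomentumLevel F Γ₀ β₀ => x.1.proj) ⁻¹' U) :=
    hU.preimage hp.contMDiff.continuous
  obtain ⟨g, hg, hgs⟩ := exists_levelOrbit_lift hq hπ he (E₁ := EuclideanSpace ℝ (Fin l))
    (c := fun y : MomentumLevel F Γ₀ β₀ => s y.1.proj) hV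
    (hs.comp hp.contMDiff.contMDiffOn fun y hy => hy)
    (fun y hy => resLie_coAdL_of_momentumMap_eq hq (hfs _ hy).symm y.2) hqU
  refine (hsub.contMDiff.contMDiffAt.comp x
    (hgs.contMDiffAt (hV.mem_nhds hqU))).congr_of_eventuallyEq ?_
  filter_upwards [hV.mem_nhds hqU] with y hy
  rw [comp_apply, hg y hy]
  exact toOrbitQuotient_eq hq y (hfs _ hy).symm _

/-- Smooth local sections of `M_{β₀} → O'/Γ₀` through a given point. -/
theorem exists_local_section_toOrbitQuotient
    (hq : IsSubmersion 𝓘(ℝ, E) 𝓘(ℝ, F) ∞ (QuotientGroup.mk : Γ → Γ ⧸ Γ₀))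
    (hπ : IsSubmersion 𝓘(ℝ, E) (𝓡 n) ∞ (orbitMap β₀))
    (he : IsSmoothEmbedding (𝓡 n') (𝓡 n) ∞ (Subtype.val : Orbit' Γ₀ β₀ → Orbit β₀))
    (hsub : IsSubmersion (𝓡 n') (𝓡 m) ∞
      (orbitQuotientMk : Orbit' Γ₀ β₀ → OrbitQuotient Γ₀ β₀))
    (hp : IsSmoothEmbedding (𝓡 l) 𝓘(ℝ, F) ∞ (fun x : MomentumLevel F Γ₀ β₀ => x.1.proj))
    (x : MomentumLevel F Γ₀ β₀) :
    ∃ (τ : OrbitQuotient Γ₀ β₀ → MomentumLevel F Γ₀ β₀) (U : Set (OrbitQuotient Γ₀ β₀)),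
      IsOpen U ∧ toOrbitQuotient hq x ∈ U ∧ τ (toOrbitQuotient hq x) = x ∧
      (∀ y ∈ U, toOrbitQuotient hq (τ y) = y) ∧ ContMDiffOn (𝓡 m) (𝓡 l) ∞ τ U := by
  classical
  obtain ⟨γ, hγ⟩ := QuotientGroup.mk_surjective x.1.proj
  have h0 := resLie_coAdL_of_momentumMap_eq hq hγ.symm x.2
  obtain ⟨c, U, hU, hyU, hcγ, hc, hcy⟩ := exists_group_lift hq hπ he hsub γ h0
  rw [← toOrbitQuotient_eq hq x hγ.symm h0] at hyU hcγ
  -- The group lift determines the base point and hence the point of the level set; off `U` any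
  -- value, here `x`, will do.
  have hex : ∀ y : OrbitQuotient Γ₀ β₀, ∃ z : MomentumLevel F Γ₀ β₀, y ∈ U → z.1.proj = c y := by
    intro y
    by_cases hy : y ∈ U
    · obtain ⟨h, -⟩ := hcy y hy
      obtain ⟨z, hz⟩ := exists_momentumLevel_over hq h
      exact ⟨z, fun _ => hz⟩
    · exact ⟨x, fun h => (hy h).elim⟩
  choose τ hτ using hex
  refine ⟨τ, U, hU, hyU, hp.isEmbedding.injective ?_, fun y hy => ?_, fun y hy =>
    ContMDiffAt.contMDiffWithinAt ?_⟩
  · refine (hτ _ hyU).trans ?_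
    rw [hcγ, hγ]
  · obtain ⟨h, h'⟩ := hcy y hy
    rw [toOrbitQuotient_eq hq (τ y) (hτ y hy) h, h']
  · have h1 : ContMDiffAt (𝓡 m) 𝓘(ℝ, F) ∞ (fun y => (τ y).1.proj) y := by
      refine (hq.contMDiff.contMDiffAt.comp y
        (hc.contMDiffAt (hU.mem_nhds hy))).congr_of_eventuallyEq ?_
      filter_upwards [hU.mem_nhds hy] with y' hy' using hτ y' hy'
    exact (ContMDiffAt.iff_comp_isImmersionAt (hp.isImmersion.isImmersionAt _)).2
      ⟨hp.isEmbedding.isInducing.continuousAt_iff.2 h1.continuousAt, h1⟩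

/-- The reduced space is a manifold, diffeomorphic to `O'/Γ₀`. -/
theorem exists_reducedSpace_manifold
    (hq : IsSubmersion 𝓘(ℝ, E) 𝓘(ℝ, F) ∞ (QuotientGroup.mk : Γ → Γ ⧸ Γ₀))
    (hπ : IsSubmersion 𝓘(ℝ, E) (𝓡 n) ∞ (orbitMap β₀))
    (he : IsSmoothEmbedding (𝓡 n') (𝓡 n) ∞ (Subtype.val : Orbit' Γ₀ β₀ → Orbit β₀))
    (hsub : IsSubmersion (𝓡 n') (𝓡 m) ∞
      (orbitQuotientMk : Orbit' Γ₀ β₀ → OrbitQuotient Γ₀ β₀))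
    (hp : IsSmoothEmbedding (𝓡 l) 𝓘(ℝ, F) ∞ (fun x : MomentumLevel F Γ₀ β₀ => x.1.proj)) :
    ∃ (_ : ChartedSpace (EuclideanSpace ℝ (Fin m)) (ReducedSpace F Γ₀ β₀))
      (_ : IsManifold (𝓡 m) ∞ (ReducedSpace F Γ₀ β₀)),
      IsSubmersion (𝓡 l) (𝓡 m) ∞
        (Quot.mk _ : MomentumLevel F Γ₀ β₀ → ReducedSpace F Γ₀ β₀) ∧
      ∃ φ : Diffeomorph (𝓡 m) (𝓡 m) (ReducedSpace F Γ₀ β₀) (OrbitQuotient Γ₀ β₀) ∞,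
        ∀ x : MomentumLevel F Γ₀ β₀, φ (Quot.mk _ x) = toOrbitQuotient hq x := by
  have hΨ := contMDiff_toOrbitQuotient hq hπ he hsub hp
  have hsec := exists_local_section_toOrbitQuotient hq hπ he hsub hp
  -- A map with a continuous local section through every point of its source is open.
  have hopen : IsOpenMap (toOrbitQuotient hq : MomentumLevel F Γ₀ β₀ → _) := by
    refine isOpenMap_iff_nhds_le.2 fun x => ?_
    obtain ⟨τ, U, hU, hxU, hτx, hfs, hs⟩ := hsec x
    have h1 := (hs.contMDiffAt (hU.mem_nhds hxU)).continuousAt.tendsto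
    rw [hτx] at h1
    have h2 : Filter.map (fun y => toOrbitQuotient hq (τ y)) (𝓝 (toOrbitQuotient hq x)) =
        𝓝 (toOrbitQuotient hq x) := by
      rw [Filter.map_congr (m₂ := id), Filter.map_id]
      filter_upwards [hU.mem_nhds hxU] with y hy using hfs y hy
    rw [← h2]
    exact (Filter.map_map (m := τ) (m' := toOrbitQuotient hq)).symm.le.trans (Filter.map_mono h1)
  let φ : ReducedSpace F Γ₀ β₀ → OrbitQuotient Γ₀ β₀ :=
    Quot.lift (toOrbitQuotient hq) fun x y h => (toOrbitQuotient_eq_iff hq x y).2 h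
  have hφc : Continuous φ := continuous_quot_lift _ hΨ.continuous
  have hφo : IsOpenMap φ := by
    intro V hV
    have h1 := hopen _ (hV.preimage continuous_quot_mk)
    convert h1 using 1
    ext y
    constructor
    · rintro ⟨z, hz, rfl⟩
      obtain ⟨x, rfl⟩ := Quot.exists_rep z
      exact ⟨x, hz, rfl⟩
    · rintro ⟨x, hx, rfl⟩
      exact ⟨_, hx, rfl⟩
  have hφb : Bijective φ := by
    constructor
    · intro z z' h
      obtain ⟨x, rfl⟩ := Quot.exists_rep z
      obtain ⟨x', rfl⟩ := Quot.exists_rep z'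
      exact Quot.sound ((toOrbitQuotient_eq_iff hq x x').1 h)
    · intro y
      obtain ⟨b, rfl⟩ := Quot.exists_rep y
      obtain ⟨γ, hγ⟩ := orbitMap_surjective b.1
      have h0 : resLie E F Γ₀ (coAdL γ (dualOf β₀)) = 0 := by
        rw [← orbitIncl_orbitMap, hγ]
        exact (mem_Ann_orbit_iff hq _).1 b.2
      obtain ⟨x, hx⟩ := exists_momentumLevel_over hq h0
      refine ⟨Quot.mk _ x, (toOrbitQuotient_eq hq x hx h0).trans ?_⟩
      rw [show orbitPt hq γ h0 = b from Subtype.ext hγ]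
  have hφ : IsHomeomorph φ := ⟨hφc, hφo, hφb⟩
  let e := Equiv.ofBijective φ hφb
  -- The homeomorphism `φ` is an embedding whose image is cut out by no equations at all; taking `W`
  -- zero-dimensional transports the manifold structure with `n = m`.
  obtain ⟨cs, hm, hemb, -⟩ := exists_submanifold (Z := ReducedSpace F Γ₀ β₀)
    (W := EuclideanSpace ℝ (Fin 0)) (E := EuclideanSpace ℝ (Fin m)) (n := m) (i := φ) hφ.isEmbedding
    (fun z => ⟨univ, fun _ => 0, isOpen_univ, mem_univ _, contMDiffOn_const,
      fun y _ => iff_of_true rfl (hφb.2 y),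
      fun w => ⟨(0 : EuclideanSpace ℝ (Fin m)), Subsingleton.elim (α := EuclideanSpace ℝ (Fin 0)) _ _⟩⟩)
    (by simp)
  have hsymm : ContMDiff (𝓡 m) (𝓡 m) ∞ e.symm := by
    refine (ContMDiff.iff_comp_isImmersion hemb.isImmersion).2 ⟨?_, ?_⟩
    · refine hφ.isEmbedding.isInducing.continuous_iff.2 ?_
      exact continuous_id.congr fun y => (e.apply_symm_apply y).symm
    · exact contMDiff_id.congr fun y => e.apply_symm_apply y
  let Φ : Diffeomorph (𝓡 m) (𝓡 m) (ReducedSpace F Γ₀ β₀) (OrbitQuotient Γ₀ β₀) ∞ :=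
    { e with
      contMDiff_toFun := hemb.contMDiff
      contMDiff_invFun := hsymm }
  refine ⟨cs, hm, ?_, Φ, fun x => rfl⟩
  have hmk : (Quot.mk _ : MomentumLevel F Γ₀ β₀ → ReducedSpace F Γ₀ β₀) =
      fun x => e.symm (toOrbitQuotient hq x) := by
    funext x
    exact (e.symm_apply_apply _).symm
  have hmks : ContMDiff (𝓡 l) (𝓡 m) ∞
      (Quot.mk _ : MomentumLevel F Γ₀ β₀ → ReducedSpace F Γ₀ β₀) := by
    rw [hmk]
    exact hsymm.comp hΨ
  refine isSubmersion_of_surjective_mfderiv hmks fun x v => ?_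
  obtain ⟨τ, U, hU, hxU, hτx, hfs, hs⟩ := hsec x
  have hφx : φ (Quot.mk _ x) = toOrbitQuotient hq x := rfl
  have hev : ∀ z ∈ φ ⁻¹' U, Quot.mk _ (τ (φ z)) = z := fun z hz => hφb.1 (hfs _ hz)
  have h1 := mfderiv_comp_local_section (E' := EuclideanSpace ℝ (Fin m))
    (E := EuclideanSpace ℝ (Fin l))
    (f := (Quot.mk _ : MomentumLevel F Γ₀ β₀ → ReducedSpace F Γ₀ β₀)) (s := fun z => τ (φ z))
    (hU.preimage hφc) (y := Quot.mk _ x) hxU hev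
    (((hs.contMDiffAt (hU.mem_nhds hxU)).comp (Quot.mk _ x)
      hemb.contMDiff.contMDiffAt).mdifferentiableAt (by simp))
    (hmks.mdifferentiableAt (by simp)) v
  have h2 : τ (φ (Quot.mk _ x)) = x := hτx
  let f : MomentumLevel F Γ₀ β₀ → ReducedSpace F Γ₀ β₀ := Quot.mk _
  have key : ∀ z, z = x →
      (∃ w, mD (EuclideanSpace ℝ (Fin l)) (EuclideanSpace ℝ (Fin m)) f z w = v) →
      ∃ w, mD (EuclideanSpace ℝ (Fin l)) (EuclideanSpace ℝ (Fin m)) f x w = v := by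
    rintro z rfl h
    exact h
  exact key _ h2 ⟨_, h1⟩

end Reduced


/-! ### The Kirillov form. -/

section Kirillov

open Module Manifold Topology

variable {E : Type*} [NormedAddCommGroup E] [NormedSpace ℝ E] [FiniteDimensional ℝ E]
  {Γ : Type*} [TopologicalSpace Γ] [ChartedSpace E Γ] [Group Γ] [LieGroup 𝓘(ℝ, E) ∞ Γ]
  {F : Type*} [NormedAddCommGroup F] [NormedSpace ℝ F] [FiniteDimensional ℝ F]
  {Γ₀ : Subgroup Γ} [ChartedSpace F (Γ ⧸ Γ₀)] [IsManifold 𝓘(ℝ, F) ∞ (Γ ⧸ Γ₀)]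
  {β₀ : LieDual E Γ}

theorem eq_vecCons_two {α : Type*} (v : Fin 2 → α) : v = ![v 0, v 1] := by
  ext i
  fin_cases i <;> rfl

variable (Γ) in
/-- The alternating form `(X, Y) ↦ β [X, Y]` on the Lie algebra. -/
def bracketForm (β : E →L[ℝ] ℝ) : E [⋀^Fin 2]→L[ℝ] ℝ :=
  ContinuousAlternatingMap.alternatizeUncurryFin
    ((oneForm E) ∘L ((2⁻¹ : ℝ) • dcoAdL (Γ := Γ) β 1))

/-- Alternatisation doubles a bilinear form that is already antisymmetric; the factor `2⁻¹` undoes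
this. -/
theorem bracketForm_apply (β : E →L[ℝ] ℝ) (v : Fin 2 → E) :
    bracketForm Γ β v = β (brk Γ (v 0) (v 1)) := by
  have h : bracketForm Γ β v = (2⁻¹ : ℝ) * dcoAdL (Γ := Γ) β 1 (v 0) (v 1) -
      (2⁻¹ : ℝ) * dcoAdL (Γ := Γ) β 1 (v 1) (v 0) := by
    rw [bracketForm, ContinuousAlternatingMap.alternatizeUncurryFin_apply]
    simp [Fin.sum_univ_two, oneForm_apply, Fin.removeNth, sub_eq_add_neg]
  rw [h, dcoAdL_one, dcoAdL_one, brk_swap (v 0) (v 1), map_neg]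
  ring

/-- The functional `β([X, ·])` is the tangent vector to the orbit generated by `X`, so the pairing
depends on the two tangent vectors only. This makes the Kirillov form well defined. -/
theorem dual_brk_congr {β : E →L[ℝ] ℝ} {X X' Y Y' : E}
    (hX : dcoAdL β (1 : Γ) X = dcoAdL β (1 : Γ) X')
    (hY : dcoAdL β (1 : Γ) Y = dcoAdL β (1 : Γ) Y') :
    β (brk Γ X Y) = β (brk Γ X' Y') := by
  have h1 : β (brk Γ X Y) = β (brk Γ X' Y) := by rw [← dcoAdL_one, hX, dcoAdL_one]
  have h2 : β (brk Γ Y X') = β (brk Γ Y' X') := by rw [← dcoAdL_one, hY, dcoAdL_one]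
  rw [h1, brk_swap, map_neg, h2, ← map_neg, ← brk_swap]

theorem coAdL_dcoAdL_one (β : E →L[ℝ] ℝ) (γ : Γ) (X : E) :
    coAdL γ (dcoAdL (Γ := Γ) β 1 X) = dcoAdL (Γ := Γ) (coAdL γ β) 1 (AdL E γ⁻¹ X) := by
  ext Y
  rw [coAdL_apply, dcoAdL_one, dcoAdL_one, ← AdL_brk_of_dual, AdL_apply_inv]

variable {n : ℕ} [ChartedSpace (EuclideanSpace ℝ (Fin n)) (Orbit β₀)] [IsManifold (𝓡 n) ∞ (Orbit β₀)]

theorem isKirillovForm_iff (σ : DiffForm (𝓡 n) (Orbit β₀) 2) :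
    IsKirillovForm σ ↔ ∀ (b : Orbit β₀) (X Y : E),
      (σ b : EuclideanSpace ℝ (Fin n) [⋀^Fin 2]→L[ℝ] ℝ)
        ![mD E (EuclideanSpace ℝ (Fin n)) (orbitMapAt b : Γ → Orbit β₀) 1 X,
          mD E (EuclideanSpace ℝ (Fin n)) (orbitMapAt b : Γ → Orbit β₀) 1 Y] =
        orbitIncl b (brk Γ X Y) := by
  refine forall_congr' fun b => forall_congr' fun X => forall_congr' fun Y => ?_
  let τ : Orbit β₀ → EuclideanSpace ℝ (Fin n) [⋀^Fin 2]→L[ℝ] ℝ := σ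
  let D : E →L[ℝ] EuclideanSpace ℝ (Fin n) :=
    mD E (EuclideanSpace ℝ (Fin n)) (orbitMapAt b : Γ → Orbit β₀) 1
  have h1 : pullback 𝓘(ℝ, E) (𝓡 n) (orbitMapAt b) σ (1 : Γ) ![X, Y] = τ b ![D X, D Y] := by
    have h2 : pullback 𝓘(ℝ, E) (𝓡 n) (orbitMapAt b) σ (1 : Γ) ![X, Y] =
      τ (orbitMapAt b 1) (fun i => D ((![X, Y] : Fin 2 → E) i)) := rfl
    rw [h2, orbitMapAt_one, eq_vecCons_two (fun i => D ((![X, Y] : Fin 2 → E) i))]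
    rfl
  have h3 : b.1 ⁅X, Y⁆ = orbitIncl b (brk Γ X Y) :=
    congrArg (orbitIncl b) (bracket_eq_brk (E := E) (Γ := Γ) X Y)
  exact (Eq.congr h1 h3)

/-- On `Γ` the form is the bracket pairing in the left trivialisation. It descends along the orbit
map because it depends only on the generated tangent vectors of `𝔤^*`. -/
theorem exists_isKirillovForm (hπ : IsSubmersion 𝓘(ℝ, E) (𝓡 n) ∞ (orbitMap β₀)) :
    ∃ σ : DiffForm (𝓡 n) (Orbit β₀) 2, IsKirillovForm σ := by
  have : IsManifold 𝓘(ℝ, E) ∞ Γ := isManifold_group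
  have hX : ∀ γ (u : E), mD (EuclideanSpace ℝ (Fin n)) (E →L[ℝ] ℝ) orbitIncl (orbitMap β₀ γ)
      (mD E (EuclideanSpace ℝ (Fin n)) (orbitMap β₀) γ u) =
      dcoAdL (Γ := Γ) (coAdL γ (dualOf β₀)) 1 (AdL E γ⁻¹ (rho E γ u)) := by
    intro γ u
    rw [← dcoAdL_dleft, dleft_AdL_inv_rho]
    exact mfderiv_orbitIncl hπ γ u
  obtain ⟨σ, hσ⟩ := exists_pullback_eq (E := E) (E' := EuclideanSpace ℝ (Fin n))
    (π := orbitMap β₀) orbitMap_surjective (surjective_mD_of_isSubmersion hπ)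
    (fun γ => (bracketForm Γ (coAdL γ (dualOf β₀))).compContinuousLinearMap
      (AdL E γ⁻¹ ∘L rho E γ)) (by
      intro γ γ' h u u' hu
      have h1 := (orbitMap_eq_iff γ γ').1 h
      have h2 : ∀ i, dcoAdL (Γ := Γ) (coAdL γ (dualOf β₀)) 1 (AdL E γ⁻¹ (rho E γ (u i))) =
          dcoAdL (Γ := Γ) (coAdL γ (dualOf β₀)) 1 (AdL E γ'⁻¹ (rho E γ' (u' i))) := by
        intro i
        rw [← hX, hu i, h1, ← hX, h]
      rw [ContinuousAlternatingMap.compContinuousLinearMap_apply,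
        ContinuousAlternatingMap.compContinuousLinearMap_apply, bracketForm_apply,
        bracketForm_apply, ← h1]
      exact dual_brk_congr (h2 0) (h2 1))
  refine ⟨σ, (isKirillovForm_iff σ).2 fun b X Y => ?_⟩
  obtain ⟨γ, rfl⟩ := orbitMap_surjective b
  rw [mD_orbitMapAt_orbitMap hπ, mD_orbitMapAt_orbitMap hπ]
  have h1 := hσ γ ![dleft E γ X, dleft E γ Y]
  rw [ContinuousAlternatingMap.compContinuousLinearMap_apply, bracketForm_apply] at h1
  rw [eq_vecCons_two (fun i => mD E (EuclideanSpace ℝ (Fin n)) (orbitMap β₀) γ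
    ((![dleft E γ X, dleft E γ Y] : Fin 2 → E) i))] at h1
  refine h1.trans ?_
  simp only [comp_apply, ContinuousLinearMap.comp_apply, Matrix.cons_val_zero, Matrix.cons_val_one,
    rho_dleft, AdL_inv_apply]
  rfl

end Kirillov


/-! ### Descent of the Kirillov form to `O'/Γ₀`. -/

section ReducedForm

open Module Manifold Topology

variable {E : Type*} [NormedAddCommGroup E] [NormedSpace ℝ E] [FiniteDimensional ℝ E]
  {Γ : Type*} [TopologicalSpace Γ] [ChartedSpace E Γ] [Group Γ] [LieGroup 𝓘(ℝ, E) ∞ Γ]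
  {F : Type*} [NormedAddCommGroup F] [NormedSpace ℝ F] [FiniteDimensional ℝ F]
  {Γ₀ : Subgroup Γ} [ChartedSpace F (Γ ⧸ Γ₀)] [IsManifold 𝓘(ℝ, F) ∞ (Γ ⧸ Γ₀)]
  {β₀ : LieDual E Γ}
  {n : ℕ} [ChartedSpace (EuclideanSpace ℝ (Fin n)) (Orbit β₀)] [IsManifold (𝓡 n) ∞ (Orbit β₀)]
  {n' : ℕ} [ChartedSpace (EuclideanSpace ℝ (Fin n')) (Orbit' Γ₀ β₀)]
  [IsManifold (𝓡 n') ∞ (Orbit' Γ₀ β₀)]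
  {ωO : DiffForm (𝓡 n) (Orbit β₀) 2}

variable (n) in
/-- The differential of the inclusion `O' → 𝔤^*`. -/
def levelD (b : Orbit' Γ₀ β₀) : EuclideanSpace ℝ (Fin n') →L[ℝ] E →L[ℝ] ℝ :=
  mD (EuclideanSpace ℝ (Fin n)) (E →L[ℝ] ℝ) orbitIncl b.1 ∘L
    mD (EuclideanSpace ℝ (Fin n')) (EuclideanSpace ℝ (Fin n))
      (Subtype.val : Orbit' Γ₀ β₀ → Orbit β₀) b

theorem levelD_eq (hπ : IsSubmersion 𝓘(ℝ, E) (𝓡 n) ∞ (orbitMap β₀))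
    (he : IsSmoothEmbedding (𝓡 n') (𝓡 n) ∞ (Subtype.val : Orbit' Γ₀ β₀ → Orbit β₀))
    (b : Orbit' Γ₀ β₀) :
    mD (EuclideanSpace ℝ (Fin n')) (E →L[ℝ] ℝ)
      (fun b : Orbit' Γ₀ β₀ => orbitIncl b.1) b = levelD n b :=
  mD_comp ((contMDiff_orbitIncl hπ).mdifferentiableAt (by simp))
    (he.contMDiff.mdifferentiableAt (by simp))

theorem resLie_levelD
    (hq : IsSubmersion 𝓘(ℝ, E) 𝓘(ℝ, F) ∞ (QuotientGroup.mk : Γ → Γ ⧸ Γ₀))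
    (hπ : IsSubmersion 𝓘(ℝ, E) (𝓡 n) ∞ (orbitMap β₀))
    (he : IsSmoothEmbedding (𝓡 n') (𝓡 n) ∞ (Subtype.val : Orbit' Γ₀ β₀ → Orbit β₀))
    (b : Orbit' Γ₀ β₀) (u : EuclideanSpace ℝ (Fin n')) :
    resLie E F Γ₀ (levelD n b u) = 0 :=
  resLie_mD_orbitIncl_val hq hπ he b u

theorem exists_levelD_eq_dcoAdL (hπ : IsSubmersion 𝓘(ℝ, E) (𝓡 n) ∞ (orbitMap β₀))
    (b : Orbit' Γ₀ β₀) (u : EuclideanSpace ℝ (Fin n')) :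
    ∃ X : E, levelD n b u = dcoAdL (Γ := Γ) (orbitIncl b.1) 1 X ∧
      mD (EuclideanSpace ℝ (Fin n')) (EuclideanSpace ℝ (Fin n))
        (Subtype.val : Orbit' Γ₀ β₀ → Orbit β₀) b u =
      mD E (EuclideanSpace ℝ (Fin n)) (orbitMapAt b.1 : Γ → Orbit β₀) 1 X := by
  obtain ⟨X, hX⟩ := surjective_mD_orbitMapAt hπ b.1
    (mD (EuclideanSpace ℝ (Fin n')) (EuclideanSpace ℝ (Fin n))
      (Subtype.val : Orbit' Γ₀ β₀ → Orbit β₀) b u)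
  refine ⟨X, ?_, hX.symm⟩
  rw [← mD_orbitIncl_orbitMapAt hπ, hX]
  rfl

/-- Any generators with the right velocities in `𝔤^*` may be used, which frees later computations
from the tangent spaces of the orbit. -/
theorem kirillovForm_val_apply (hπ : IsSubmersion 𝓘(ℝ, E) (𝓡 n) ∞ (orbitMap β₀))
    (hK : IsKirillovForm ωO) (b : Orbit' Γ₀ β₀) (u : Fin 2 → EuclideanSpace ℝ (Fin n'))
    {X Y : E} (hX : levelD n b (u 0) = dcoAdL (Γ := Γ) (orbitIncl b.1) 1 X)
    (hY : levelD n b (u 1) = dcoAdL (Γ := Γ) (orbitIncl b.1) 1 Y) :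
    (ωO b.1 : EuclideanSpace ℝ (Fin n) [⋀^Fin 2]→L[ℝ] ℝ)
      (fun i => mD (EuclideanSpace ℝ (Fin n')) (EuclideanSpace ℝ (Fin n))
        (Subtype.val : Orbit' Γ₀ β₀ → Orbit β₀) b (u i)) = orbitIncl b.1 (brk Γ X Y) := by
  obtain ⟨X', hX', hX''⟩ := exists_levelD_eq_dcoAdL hπ b (u 0)
  obtain ⟨Y', hY', hY''⟩ := exists_levelD_eq_dcoAdL hπ b (u 1)
  rw [eq_vecCons_two (fun i => mD (EuclideanSpace ℝ (Fin n')) (EuclideanSpace ℝ (Fin n))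
        (Subtype.val : Orbit' Γ₀ β₀ → Orbit β₀) b (u i)), hX'', hY'']
  refine ((isKirillovForm_iff ωO).1 hK b.1 X' Y').trans ?_
  exact dual_brk_congr (hX'.symm.trans hX) (hY'.symm.trans hY)

variable {k : ℕ} [ChartedSpace (EuclideanSpace ℝ (Fin k)) Γ₀] [IsManifold (𝓡 k) ∞ Γ₀]

theorem contMDiff_coAd'_left (hπ : IsSubmersion 𝓘(ℝ, E) (𝓡 n) ∞ (orbitMap β₀))
    (he : IsSmoothEmbedding (𝓡 n') (𝓡 n) ∞ (Subtype.val : Orbit' Γ₀ β₀ → Orbit β₀))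
    (hi : IsSmoothEmbedding (𝓡 k) 𝓘(ℝ, E) ∞ (Subtype.val : Γ₀ → Γ)) (σ : Γ₀) :
    ContMDiff (𝓡 n') (𝓡 n') ∞ (fun b : Orbit' Γ₀ β₀ => coAd' σ b) :=
  (contMDiff_coAd' hπ he hi).comp (contMDiff_const.prodMk contMDiff_id)

/-- The inclusion into `𝔤^*` intertwines the action on `O'` with the linear map `coAdL σ`, which is
its own derivative. -/
theorem levelD_coAd' (hπ : IsSubmersion 𝓘(ℝ, E) (𝓡 n) ∞ (orbitMap β₀))
    (he : IsSmoothEmbedding (𝓡 n') (𝓡 n) ∞ (Subtype.val : Orbit' Γ₀ β₀ → Orbit β₀))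
    (hi : IsSmoothEmbedding (𝓡 k) 𝓘(ℝ, E) ∞ (Subtype.val : Γ₀ → Γ)) (σ : Γ₀)
    (b : Orbit' Γ₀ β₀) (u : EuclideanSpace ℝ (Fin n')) :
    levelD n (coAd' σ b) (mD (EuclideanSpace ℝ (Fin n')) (EuclideanSpace ℝ (Fin n'))
      (fun b : Orbit' Γ₀ β₀ => coAd' σ b) b u) = coAdL (σ : Γ) (levelD n b u) := by
  let L : (E →L[ℝ] ℝ) →L[ℝ] (E →L[ℝ] ℝ) :=
    (ContinuousLinearMap.compL ℝ E E ℝ).flip (AdL E (σ : Γ))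
  have hι : MDifferentiable (𝓡 n') 𝓘(ℝ, E →L[ℝ] ℝ) (fun b : Orbit' Γ₀ β₀ => orbitIncl b.1) :=
    ((contMDiff_orbitIncl hπ).comp he.contMDiff).mdifferentiable (by simp)
  have h1 := mD_comp_apply (E := EuclideanSpace ℝ (Fin n')) (E' := E →L[ℝ] ℝ)
    (E'' := E →L[ℝ] ℝ) (g := L) (f := fun b : Orbit' Γ₀ β₀ => orbitIncl b.1) (x := b)
    (ContinuousLinearMap.mdifferentiableAt _) (hι b) u
  have h2 := mD_comp_apply (E := EuclideanSpace ℝ (Fin n')) (E' := EuclideanSpace ℝ (Fin n'))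
    (E'' := E →L[ℝ] ℝ) (g := fun b : Orbit' Γ₀ β₀ => orbitIncl b.1)
    (f := fun b : Orbit' Γ₀ β₀ => coAd' σ b) (x := b) (hι _)
    ((contMDiff_coAd'_left hπ he hi σ).mdifferentiableAt (by simp)) u
  rw [mD_clm, levelD_eq hπ he] at h1
  rw [levelD_eq hπ he] at h2
  exact h2.symm.trans h1

theorem levelD_generator (hπ : IsSubmersion 𝓘(ℝ, E) (𝓡 n) ∞ (orbitMap β₀))
    (he : IsSmoothEmbedding (𝓡 n') (𝓡 n) ∞ (Subtype.val : Orbit' Γ₀ β₀ → Orbit β₀))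
    (hi : IsSmoothEmbedding (𝓡 k) 𝓘(ℝ, E) ∞ (Subtype.val : Γ₀ → Γ))
    (b : Orbit' Γ₀ β₀) (u : EuclideanSpace ℝ (Fin k)) :
    levelD n b (mD (EuclideanSpace ℝ (Fin k)) (EuclideanSpace ℝ (Fin n'))
      (fun σ : Γ₀ => coAd' σ b) 1 u) = dcoAdL (Γ := Γ) (orbitIncl b.1) 1
        (mD (EuclideanSpace ℝ (Fin k)) E (Subtype.val : Γ₀ → Γ) 1 u) := by
  rw [levelD, ContinuousLinearMap.comp_apply, mD_val_coAd' hπ he hi, mD_orbitIncl_orbitMapAt hπ]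

variable {m : ℕ} [ChartedSpace (EuclideanSpace ℝ (Fin m)) (OrbitQuotient Γ₀ β₀)]
  [IsManifold (𝓡 m) ∞ (OrbitQuotient Γ₀ β₀)]

/-- The restriction of the Kirillov form to `O'` descends to `O'/Γ₀`. -/
theorem exists_reduced_kirillovForm
    (hq : IsSubmersion 𝓘(ℝ, E) 𝓘(ℝ, F) ∞ (QuotientGroup.mk : Γ → Γ ⧸ Γ₀))
    (hπ : IsSubmersion 𝓘(ℝ, E) (𝓡 n) ∞ (orbitMap β₀)) (ht : IsTransversal Γ₀ β₀)
    (he : IsSmoothEmbedding (𝓡 n') (𝓡 n) ∞ (Subtype.val : Orbit' Γ₀ β₀ → Orbit β₀))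
    (hi : IsSmoothEmbedding (𝓡 k) 𝓘(ℝ, E) ∞ (Subtype.val : Γ₀ → Γ))
    (hinj : ∀ σ, Injective (mfderiv (𝓡 k) 𝓘(ℝ, E) (Subtype.val : Γ₀ → Γ) σ))
    (hm : m = n' - k)
    (hsub : IsSubmersion (𝓡 n') (𝓡 m) ∞
      (orbitQuotientMk : Orbit' Γ₀ β₀ → OrbitQuotient Γ₀ β₀)) (hK : IsKirillovForm ωO) :
    ∃ ω₁ : DiffForm (𝓡 m) (OrbitQuotient Γ₀ β₀) 2,
      pullback (𝓡 n') (𝓡 m) (orbitQuotientMk : Orbit' Γ₀ β₀ → OrbitQuotient Γ₀ β₀) ω₁ =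
        pullback (𝓡 n') (𝓡 n) (Subtype.val : Orbit' Γ₀ β₀ → Orbit β₀) ωO := by
  let V := EuclideanSpace ℝ (Fin n')
  -- Two vectors with the same image differ by an infinitesimal generator of `Γ₀`, so their
  -- generators in `𝔤` can be chosen to differ by an element of `𝔤₀`.
  have hker : ∀ (b : Orbit' Γ₀ β₀) (u u' : V) (A : E),
      mD V (EuclideanSpace ℝ (Fin m)) (orbitQuotientMk : Orbit' Γ₀ β₀ → _) b u =
        mD V (EuclideanSpace ℝ (Fin m)) (orbitQuotientMk : Orbit' Γ₀ β₀ → _) b u' →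
      levelD n b u = dcoAdL (Γ := Γ) (orbitIncl b.1) 1 A →
      ∃ Z ∈ lieSub E F Γ₀, levelD n b u' = dcoAdL (Γ := Γ) (orbitIncl b.1) 1 (A - Z) := by
    intro b u u' A h hA
    have h0 : mD V (EuclideanSpace ℝ (Fin m)) (orbitQuotientMk : Orbit' Γ₀ β₀ → _) b (u - u') = 0 := by
      rw [map_sub, h, sub_self]
    obtain ⟨t, ht⟩ := (mD_orbitQuotientMk_eq_zero_iff hq hπ ht he hi hinj hm hsub b (u - u')).1 h0
    refine ⟨_, mD_val_mem_lieSub hq hi t, ?_⟩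
    have h1 := levelD_generator hπ he hi b t
    rw [ht, map_sub, hA] at h1
    rw [map_sub, ← h1, sub_sub_cancel]
  let α : Orbit' Γ₀ β₀ → V [⋀^Fin 2]→L[ℝ] ℝ :=
    fun b => (ωO b.1 : EuclideanSpace ℝ (Fin n) [⋀^Fin 2]→L[ℝ] ℝ).compContinuousLinearMap
      (mD V (EuclideanSpace ℝ (Fin n)) (Subtype.val : Orbit' Γ₀ β₀ → Orbit β₀) b)
  have hα : ∀ b b' : Orbit' Γ₀ β₀, orbitQuotientMk b = orbitQuotientMk b' →
      ∀ u u' : Fin 2 → V,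
      (∀ i, mD V (EuclideanSpace ℝ (Fin m)) (orbitQuotientMk : Orbit' Γ₀ β₀ → _) b (u i) =
        mD V (EuclideanSpace ℝ (Fin m)) (orbitQuotientMk : Orbit' Γ₀ β₀ → _) b' (u' i)) →
      α b u = α b' u' := by
    intro b b' hbb u u' hu
    obtain ⟨σ, rfl⟩ := (orbitQuotientMk_eq_iff _ _).1 hbb
    choose X hX using fun i => exists_levelD_eq_dcoAdL hπ b (u i)
    -- Acting by `σ` brings both pairs of vectors to the same base point, where `hker` compares
    -- them.
    have hA : ∀ i, levelD n (coAd' σ b) (mD V V (fun b : Orbit' Γ₀ β₀ => coAd' σ b) b (u i)) =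
        dcoAdL (Γ := Γ) (orbitIncl (coAd' σ b).1) 1 (AdL E (σ : Γ)⁻¹ (X i)) := by
      intro i
      rw [levelD_coAd' hπ he hi, (hX i).1, coAdL_dcoAdL_one]
      rfl
    have hmk : ∀ i, mD V (EuclideanSpace ℝ (Fin m)) (orbitQuotientMk : Orbit' Γ₀ β₀ → _)
        (coAd' σ b) (mD V V (fun b : Orbit' Γ₀ β₀ => coAd' σ b) b (u i)) =
        mD V (EuclideanSpace ℝ (Fin m)) (orbitQuotientMk : Orbit' Γ₀ β₀ → _) (coAd' σ b) (u' i) := by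
      intro i
      rw [← hu i, ← mD_comp_apply (E := V) (E' := V) (E'' := EuclideanSpace ℝ (Fin m))
        (g := (orbitQuotientMk : Orbit' Γ₀ β₀ → _)) (f := fun b : Orbit' Γ₀ β₀ => coAd' σ b) (x := b)
        (hsub.contMDiff.mdifferentiableAt (by simp))
        ((contMDiff_coAd'_left hπ he hi σ).mdifferentiableAt (by simp))]
      rw [show (fun b : Orbit' Γ₀ β₀ => orbitQuotientMk (coAd' σ b)) = orbitQuotientMk from
        funext fun b => ((orbitQuotientMk_eq_iff _ _).2 ⟨σ, rfl⟩).symm]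
    choose Z hZ hZ' using fun i => hker _ _ _ _ (hmk i) (hA i)
    have h1 : α b u = _ := kirillovForm_val_apply hπ hK b u (hX 0).1 (hX 1).1
    have h2 : α (coAd' σ b) u' = _ := kirillovForm_val_apply hπ hK (coAd' σ b) u' (hZ' 0) (hZ' 1)
    rw [h1, h2]
    set β := orbitIncl (coAd' σ b).1 with hβ
    -- The corrections from `𝔤₀` drop out: vectors tangent to `O'` vanish on `𝔤₀`, and `𝔤₀` is
    -- isotropic. What remains is invariant under `Ad σ`.
    have hAZ : ∀ i j, dcoAdL (Γ := Γ) β 1 (AdL E (σ : Γ)⁻¹ (X i)) (Z j) = 0 := fun i j => by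
      rw [← hA]
      exact (resLie_eq_zero_iff _).1 (resLie_levelD hq hπ he _ _) _ (hZ j)
    have hZZ : dcoAdL (Γ := Γ) β 1 (Z 0) (Z 1) = 0 :=
      (resLie_eq_zero_iff _).1 (resLie_dcoAdL_eq_zero hq (coAd' σ b) (hZ 0)) _ (hZ 1)
    have hZA : dcoAdL (Γ := Γ) β 1 (Z 0) (AdL E (σ : Γ)⁻¹ (X 1)) = 0 := by
      rw [dcoAdL_one, brk_swap, map_neg, ← dcoAdL_one, hAZ, neg_zero]
    rw [← dcoAdL_one β]
    simp only [map_sub, _root_.sub_apply, hAZ, hZZ, hZA, sub_zero]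
    have hβ' : β = coAdL (σ : Γ) (orbitIncl b.1) := rfl
    rw [dcoAdL_one, hβ', ← AdL_brk_of_dual, AdL_apply_inv, AdL_apply_inv]
  obtain ⟨ω₁, h⟩ := exists_pullback_eq (E := V) (E' := EuclideanSpace ℝ (Fin m))
    (π := (orbitQuotientMk : Orbit' Γ₀ β₀ → OrbitQuotient Γ₀ β₀)) Quot.mk_surjective
    (surjective_mD_of_isSubmersion hsub) α hα
  refine ⟨ω₁, funext fun b => ContinuousAlternatingMap.ext fun (u : Fin 2 → V) => h b u⟩

end ReducedForm


/-! ### Local exactness and nondegeneracy of the reduced form. -/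

section ReducedSymplectic

open Module Manifold Topology

variable {E : Type*} [NormedAddCommGroup E] [NormedSpace ℝ E] [FiniteDimensional ℝ E]
  {Γ : Type*} [TopologicalSpace Γ] [ChartedSpace E Γ] [Group Γ] [LieGroup 𝓘(ℝ, E) ∞ Γ]
  {F : Type*} [NormedAddCommGroup F] [NormedSpace ℝ F] [FiniteDimensional ℝ F]
  {Γ₀ : Subgroup Γ} [ChartedSpace F (Γ ⧸ Γ₀)] [IsManifold 𝓘(ℝ, F) ∞ (Γ ⧸ Γ₀)]
  {β₀ : LieDual E Γ}
  {n : ℕ} [ChartedSpace (EuclideanSpace ℝ (Fin n)) (Orbit β₀)] [IsManifold (𝓡 n) ∞ (Orbit β₀)]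
  {n' : ℕ} [ChartedSpace (EuclideanSpace ℝ (Fin n')) (Orbit' Γ₀ β₀)]
  [IsManifold (𝓡 n') ∞ (Orbit' Γ₀ β₀)]
  {m : ℕ} [ChartedSpace (EuclideanSpace ℝ (Fin m)) (OrbitQuotient Γ₀ β₀)]
  [IsManifold (𝓡 m) ∞ (OrbitQuotient Γ₀ β₀)]
  {ωO : DiffForm (𝓡 n) (Orbit β₀) 2} {ω₁ : DiffForm (𝓡 m) (OrbitQuotient Γ₀ β₀) 2}
  {E₁ : Type*} [NormedAddCommGroup E₁] [NormedSpace ℝ E₁]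

theorem reduced_kirillovForm_apply (hπ : IsSubmersion 𝓘(ℝ, E) (𝓡 n) ∞ (orbitMap β₀))
    (hK : IsKirillovForm ωO)
    (hω : pullback (𝓡 n') (𝓡 m) (orbitQuotientMk : Orbit' Γ₀ β₀ → OrbitQuotient Γ₀ β₀) ω₁ =
        pullback (𝓡 n') (𝓡 n) (Subtype.val : Orbit' Γ₀ β₀ → Orbit β₀) ωO)
    (b : Orbit' Γ₀ β₀) (u : Fin 2 → EuclideanSpace ℝ (Fin n'))
    {X Y : E} (hX : levelD n b (u 0) = dcoAdL (Γ := Γ) (orbitIncl b.1) 1 X)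
    (hY : levelD n b (u 1) = dcoAdL (Γ := Γ) (orbitIncl b.1) 1 Y) :
    (ω₁ (orbitQuotientMk b) : EuclideanSpace ℝ (Fin m) [⋀^Fin 2]→L[ℝ] ℝ)
      (fun i => mD (EuclideanSpace ℝ (Fin n')) (EuclideanSpace ℝ (Fin m))
        (orbitQuotientMk : Orbit' Γ₀ β₀ → OrbitQuotient Γ₀ β₀) b (u i)) =
      orbitIncl b.1 (brk Γ X Y) :=
  (DFunLike.congr_fun (F := EuclideanSpace ℝ (Fin n') [⋀^Fin 2]→L[ℝ] ℝ)
    (congrFun hω b) u).trans (kirillovForm_val_apply hπ hK b u hX hY)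

/-- The reduced form, pulled back along a map to `O'/Γ₀` that lifts to `Γ`. -/
theorem pullback_reduced_kirillovForm
    (hq : IsSubmersion 𝓘(ℝ, E) 𝓘(ℝ, F) ∞ (QuotientGroup.mk : Γ → Γ ⧸ Γ₀))
    (hπ : IsSubmersion 𝓘(ℝ, E) (𝓡 n) ∞ (orbitMap β₀))
    (he : IsSmoothEmbedding (𝓡 n') (𝓡 n) ∞ (Subtype.val : Orbit' Γ₀ β₀ → Orbit β₀))
    (hsub : IsSubmersion (𝓡 n') (𝓡 m) ∞
      (orbitQuotientMk : Orbit' Γ₀ β₀ → OrbitQuotient Γ₀ β₀)) (hK : IsKirillovForm ωO)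
    (hω : pullback (𝓡 n') (𝓡 m) (orbitQuotientMk : Orbit' Γ₀ β₀ → OrbitQuotient Γ₀ β₀) ω₁ =
        pullback (𝓡 n') (𝓡 n) (Subtype.val : Orbit' Γ₀ β₀ → Orbit β₀) ωO)
    {f : E₁ → OrbitQuotient Γ₀ β₀} {c : E₁ → Γ} {U : Set E₁} (hU : IsOpen U)
    (hc : ContMDiffOn 𝓘(ℝ, E₁) 𝓘(ℝ, E) ∞ c U)
    (hf : ∀ w ∈ U, ∃ h, f w = orbitQuotientMk (orbitPt hq (c w) h)) {w : E₁} (hw : w ∈ U) :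
    pullback 𝓘(ℝ, E₁) (𝓡 m) f ω₁ w =
      extDeriv (fun w => oneForm E₁ (dualOf β₀ ∘L maurerCartan (E := E) c w)) w := by
  obtain ⟨g, hg, hgs⟩ := exists_levelOrbit_lift hq hπ he (c := c) hU hc
    (fun w hw => (hf w hw).1) hw
  have hgd : MDifferentiableAt 𝓘(ℝ, E₁) (𝓡 n') g w :=
    (hgs.contMDiffAt (hU.mem_nhds hw)).mdifferentiableAt (by simp)
  have hcd : MDifferentiableAt 𝓘(ℝ, E₁) 𝓘(ℝ, E) c w :=
    (hc.contMDiffAt (hU.mem_nhds hw)).mdifferentiableAt (by simp)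
  have hfg : f =ᶠ[𝓝 w] fun w => orbitQuotientMk (g w) := by
    filter_upwards [hU.mem_nhds hw] with w' hw'
    obtain ⟨h, h'⟩ := hf w' hw'
    rw [h', hg w' hw']
  rw [pullback_congr hfg, pullback_comp (I' := 𝓡 n') (hsub.contMDiff.mdifferentiableAt (by simp)) hgd]
  have hι : MDifferentiable (𝓡 n') 𝓘(ℝ, E →L[ℝ] ℝ) (fun b : Orbit' Γ₀ β₀ => orbitIncl b.1) :=
    ((contMDiff_orbitIncl hπ).comp he.contMDiff).mdifferentiable (by simp)
  have hgw : orbitIncl (g w).1 = coAdL (c w) (dualOf β₀) := by rw [hg w hw]; rfl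
  -- The velocity of the lifted map in `𝔤^*` is generated by the velocity of `c` in the left
  -- trivialisation.
  have hD : ∀ u : E₁, levelD n (g w) (mD E₁ (EuclideanSpace ℝ (Fin n')) g w u) =
      dcoAdL (Γ := Γ) (orbitIncl (g w).1) 1 (AdL E (c w)⁻¹ (maurerCartan c w u)) := by
    intro u
    have h1 := mD_comp_apply (E := E₁) (E' := EuclideanSpace ℝ (Fin n'))
      (E'' := E →L[ℝ] ℝ) (g := fun b : Orbit' Γ₀ β₀ => orbitIncl b.1) (f := g) (x := w)
      (hι _) hgd u
    rw [levelD_eq hπ he] at h1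
    have h2 := mD_comp_apply (E := E₁) (E' := E) (E'' := E →L[ℝ] ℝ)
      (g := fun γ : Γ => coAdL γ (dualOf β₀)) (f := c) (x := w)
      ((contMDiff_coAdL _).mdifferentiableAt (by simp)) hcd u
    have h3 : (fun w => orbitIncl (g w).1) =ᶠ[𝓝 w] fun w => coAdL (c w) (dualOf β₀) := by
      filter_upwards [hU.mem_nhds hw] with w' hw'
      rw [hg w' hw']
      rfl
    rw [mD_congr h3] at h1
    rw [hgw, ← dcoAdL_dleft]
    have h4 : dleft E (c w) (AdL E (c w)⁻¹ (maurerCartan c w u)) = mD E₁ E c w u :=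
      dleft_AdL_inv_rho _ _
    rw [h4]
    exact h1.symm.trans h2
  refine ContinuousAlternatingMap.ext fun (v : Fin 2 → E₁) => ?_
  have h6 := extDeriv_oneForm_maurerCartan (dualOf β₀) hU hc hw (v 0) (v 1)
  rw [← eq_vecCons_two v] at h6
  have h5 := reduced_kirillovForm_apply hπ hK hω (g w)
    (fun i => mD E₁ (EuclideanSpace ℝ (Fin n')) g w (v i)) (hD (v 0)) (hD (v 1))
  -- `Ad` respects the bracket, so the pairing at `Ad^*_{c(w)} β₀` of left-trivialised velocities is
  -- the pairing at `β₀` of right-trivialised ones, the Maurer-Cartan expression.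
  rw [hgw, ← AdL_brk_of_dual, AdL_apply_inv, AdL_apply_inv] at h5
  exact h5.trans h6.symm

/-- The reduced form is locally exact. -/
theorem exists_pullback_eq_extDeriv
    (hq : IsSubmersion 𝓘(ℝ, E) 𝓘(ℝ, F) ∞ (QuotientGroup.mk : Γ → Γ ⧸ Γ₀))
    (hπ : IsSubmersion 𝓘(ℝ, E) (𝓡 n) ∞ (orbitMap β₀))
    (he : IsSmoothEmbedding (𝓡 n') (𝓡 n) ∞ (Subtype.val : Orbit' Γ₀ β₀ → Orbit β₀))
    (hsub : IsSubmersion (𝓡 n') (𝓡 m) ∞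
      (orbitQuotientMk : Orbit' Γ₀ β₀ → OrbitQuotient Γ₀ β₀)) (hK : IsKirillovForm ωO)
    (hω : pullback (𝓡 n') (𝓡 m) (orbitQuotientMk : Orbit' Γ₀ β₀ → OrbitQuotient Γ₀ β₀) ω₁ =
        pullback (𝓡 n') (𝓡 n) (Subtype.val : Orbit' Γ₀ β₀ → Orbit β₀) ωO)
    {f : E₁ → OrbitQuotient Γ₀ β₀} {V : Set E₁} (hV : IsOpen V)
    (hf : ContMDiffOn 𝓘(ℝ, E₁) (𝓡 m) ∞ f V) {w : E₁} (hw : w ∈ V) :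
    ∃ (U : Set E₁) (α : E₁ → E₁ [⋀^Fin 1]→L[ℝ] ℝ), IsOpen U ∧ w ∈ U ∧ U ⊆ V ∧
      ContDiffOn ℝ ∞ α U ∧ ∀ w' ∈ U, pullback 𝓘(ℝ, E₁) (𝓡 m) f ω₁ w' = extDeriv α w' := by
  obtain ⟨b, hb⟩ := Quot.exists_rep (f w)
  obtain ⟨γ, hγ⟩ := orbitMap_surjective b.1
  have h0 : resLie E F Γ₀ (coAdL γ (dualOf β₀)) = 0 := by
    rw [← orbitIncl_orbitMap, hγ]
    exact (mem_Ann_orbit_iff hq _).1 b.2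
  have hbγ : orbitQuotientMk (orbitPt hq γ h0) = f w := by
    rw [show orbitPt hq γ h0 = b from Subtype.ext hγ]
    exact hb
  obtain ⟨c, W, hW, hbW, -, hc, hcW⟩ := exists_group_lift hq hπ he hsub γ h0
  rw [hbγ] at hbW
  have hU : IsOpen (V ∩ f ⁻¹' W) := hf.continuousOn.isOpen_inter_preimage hV hW
  have hcf : ContMDiffOn 𝓘(ℝ, E₁) 𝓘(ℝ, E) ∞ (fun w => c (f w)) (V ∩ f ⁻¹' W) :=
    hc.comp (hf.mono inter_subset_left) fun w hw => hw.2
  refine ⟨V ∩ f ⁻¹' W, _, hU, ⟨hw, hbW⟩, inter_subset_left,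
    contDiffOn_oneForm_maurerCartan (dualOf β₀) hU hcf, fun w' hw' => ?_⟩
  refine pullback_reduced_kirillovForm hq hπ he hsub hK hω hU hcf (fun w'' hw'' => ?_) hw'
  obtain ⟨h, h'⟩ := hcW _ hw''.2
  exact ⟨h, h'.symm⟩

/-- A vector of `T_β O` orthogonal to `T_β O ∩ Ann 𝔤₀` is tangent to the `Γ₀`-orbit. -/
theorem exists_mem_lieSub_dcoAdL_eq (β : E →L[ℝ] ℝ) {X : E}
    (hX : ∀ Y : E, resLie E F Γ₀ (dcoAdL (Γ := Γ) β 1 Y) = 0 → β (brk Γ X Y) = 0) :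
    ∃ Z ∈ lieSub E F Γ₀, dcoAdL (Γ := Γ) β 1 X = dcoAdL (Γ := Γ) β 1 Z := by
  -- `A` sends `Y` to `β([Y, ·])` on `𝔤₀`. The hypothesis says that `β([X, ·])` vanishes on the
  -- kernel of `A`, so it lies in the range of the transpose, whose source, the double dual of `𝔤₀`,
  -- is `𝔤₀` itself.
  let A : E →ₗ[ℝ] Module.Dual ℝ (lieSub E F Γ₀) :=
    (ContinuousLinearMap.coeLM ℝ).comp (resLie E F Γ₀ ∘L dcoAdL (Γ := Γ) β 1).toLinearMap
  have hA : ∀ Y (Z : lieSub E F Γ₀), A Y Z = β (brk Γ Y Z) := fun Y Z => dcoAdL_one β Y Z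
  have h1 : (dcoAdL (Γ := Γ) β 1 X).toLinearMap ∈ (LinearMap.ker A).dualAnnihilator := by
    rw [Submodule.mem_dualAnnihilator]
    intro Y hY
    refine (dcoAdL_one β X Y).trans (hX Y ?_)
    rw [resLie_eq_zero_iff]
    intro Z hZ
    exact LinearMap.congr_fun (LinearMap.mem_ker.1 hY) ⟨Z, hZ⟩
  rw [← LinearMap.range_dualMap_eq_dualAnnihilator_ker] at h1
  obtain ⟨ψ, hψ⟩ := h1
  obtain ⟨Z, rfl⟩ := (Module.evalEquiv ℝ (lieSub E F Γ₀)).surjective ψ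
  -- The sign comes from `β([Y, Z]) = β([-Z, Y])`.
  refine ⟨-Z, (lieSub E F Γ₀).neg_mem Z.2, ?_⟩
  ext Y
  have h2 : A Y Z = dcoAdL (Γ := Γ) β 1 X Y := LinearMap.congr_fun hψ Y
  rw [← h2, hA, map_neg, _root_.neg_apply, dcoAdL_one, brk_swap, map_neg]

variable {k : ℕ} [ChartedSpace (EuclideanSpace ℝ (Fin k)) Γ₀] [IsManifold (𝓡 k) ∞ Γ₀]

/-- A null vector lifts to `T O'`, where it is orthogonal to all of `T O ∩ Ann 𝔤₀`. So it has the
same velocity in `𝔤^*` as a generator from `𝔤₀`; by injectivity of the inclusions it equals that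
generator, which the quotient map kills. -/
theorem nondegenerate_reduced_kirillovForm
    (hq : IsSubmersion 𝓘(ℝ, E) 𝓘(ℝ, F) ∞ (QuotientGroup.mk : Γ → Γ ⧸ Γ₀))
    (hπ : IsSubmersion 𝓘(ℝ, E) (𝓡 n) ∞ (orbitMap β₀)) (hn : n = orbitDim β₀)
    (ht : IsTransversal Γ₀ β₀)
    (he : IsSmoothEmbedding (𝓡 n') (𝓡 n) ∞ (Subtype.val : Orbit' Γ₀ β₀ → Orbit β₀))
    (heinj : ∀ b, Injective (mD (EuclideanSpace ℝ (Fin n')) (EuclideanSpace ℝ (Fin n))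
        (Subtype.val : Orbit' Γ₀ β₀ → Orbit β₀) b))
    (hesurj : ∀ (b : Orbit' Γ₀ β₀) (v : EuclideanSpace ℝ (Fin n)),
        resLie E F Γ₀ (mD (EuclideanSpace ℝ (Fin n)) (E →L[ℝ] ℝ) orbitIncl b.1 v) = 0 →
        ∃ u, mD (EuclideanSpace ℝ (Fin n')) (EuclideanSpace ℝ (Fin n))
          (Subtype.val : Orbit' Γ₀ β₀ → Orbit β₀) b u = v)
    (hi : IsSmoothEmbedding (𝓡 k) 𝓘(ℝ, E) ∞ (Subtype.val : Γ₀ → Γ))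
    (hinj : ∀ σ, Injective (mfderiv (𝓡 k) 𝓘(ℝ, E) (Subtype.val : Γ₀ → Γ) σ))
    (hisurj : ∀ X ∈ lieSub E F Γ₀, ∃ u, mfderiv (𝓡 k) 𝓘(ℝ, E) (Subtype.val : Γ₀ → Γ) 1 u = X)
    (hm : m = n' - k)
    (hsub : IsSubmersion (𝓡 n') (𝓡 m) ∞
      (orbitQuotientMk : Orbit' Γ₀ β₀ → OrbitQuotient Γ₀ β₀)) (hK : IsKirillovForm ωO)
    (hω : pullback (𝓡 n') (𝓡 m) (orbitQuotientMk : Orbit' Γ₀ β₀ → OrbitQuotient Γ₀ β₀) ω₁ =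
        pullback (𝓡 n') (𝓡 n) (Subtype.val : Orbit' Γ₀ β₀ → Orbit β₀) ωO)
    (y : OrbitQuotient Γ₀ β₀) (u : EuclideanSpace ℝ (Fin m))
    (hu : ∀ v : EuclideanSpace ℝ (Fin m),
      (ω₁ y : EuclideanSpace ℝ (Fin m) [⋀^Fin 2]→L[ℝ] ℝ) ![u, v] = 0) : u = 0 := by
  obtain ⟨b, rfl⟩ := Quot.exists_rep y
  obtain ⟨u, rfl⟩ := surjective_mD_of_isSubmersion hsub b u
  obtain ⟨X, hX, -⟩ := exists_levelD_eq_dcoAdL hπ b u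
  obtain ⟨Z, hZ, hXZ⟩ := exists_mem_lieSub_dcoAdL_eq (F := F) (Γ₀ := Γ₀) (orbitIncl b.1) (X := X) (by
    intro Y hY
    rw [← mD_orbitIncl_orbitMapAt hπ] at hY
    obtain ⟨v, hv⟩ := hesurj b _ hY
    have hvY : levelD n b v = dcoAdL (Γ := Γ) (orbitIncl b.1) 1 Y := by
      rw [levelD, ContinuousLinearMap.comp_apply, hv, mD_orbitIncl_orbitMapAt hπ]
    rw [← reduced_kirillovForm_apply hπ hK hω b ![u, v] hX hvY,
      eq_vecCons_two (fun i => mD (EuclideanSpace ℝ (Fin n')) (EuclideanSpace ℝ (Fin m))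
        (orbitQuotientMk : Orbit' Γ₀ β₀ → OrbitQuotient Γ₀ β₀) b
        ((![u, v] : Fin 2 → EuclideanSpace ℝ (Fin n')) i))]
    exact hu _)
  obtain ⟨t, htZ⟩ := hisurj Z hZ
  refine (mD_orbitQuotientMk_eq_zero_iff hq hπ ht he hi hinj hm hsub b u).2 ⟨t, heinj b ?_⟩
  refine injective_mfderiv_orbitIncl hπ hn b.1 ?_
  have h1 := levelD_generator hπ he hi b t
  rw [show mD (EuclideanSpace ℝ (Fin k)) E (Subtype.val : Γ₀ → Γ) 1 t = Z from htZ, ← hXZ, ← hX] at h1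
  exact h1

end ReducedSymplectic


/-! ### Comparison with the canonical form of the cotangent bundle. -/

section CanonicalForm

open Module Manifold Topology

/-- A form is determined by its pullbacks along inverse charts. -/
theorem eq_of_pullback_chartAt_symm_eq
    {E₁ : Type*} [NormedAddCommGroup E₁] [NormedSpace ℝ E₁]
    {M : Type*} [TopologicalSpace M] [ChartedSpace E₁ M] [IsManifold 𝓘(ℝ, E₁) ∞ M] {k : ℕ}
    {σ τ : DiffForm 𝓘(ℝ, E₁) M k} {x : M}
    (h : pullback 𝓘(ℝ, E₁) 𝓘(ℝ, E₁) (chartAt E₁ x).symm σ (chartAt E₁ x x) =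
      pullback 𝓘(ℝ, E₁) 𝓘(ℝ, E₁) (chartAt E₁ x).symm τ (chartAt E₁ x x)) : σ x = τ x := by
  have key : ∀ (υ : M → E₁ [⋀^Fin k]→L[ℝ] ℝ) (u : Fin k → E₁),
      (pullback 𝓘(ℝ, E₁) 𝓘(ℝ, E₁) (chartAt E₁ x).symm υ (chartAt E₁ x x) :
        E₁ [⋀^Fin k]→L[ℝ] ℝ) u = υ x u := by
    intro υ u
    have h1 : mD E₁ E₁ (chartAt E₁ x).symm (chartAt E₁ x x) = ContinuousLinearMap.id ℝ E₁ :=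
      mfderiv_chartAt_symm_self x
    have h2 : (pullback 𝓘(ℝ, E₁) 𝓘(ℝ, E₁) (chartAt E₁ x).symm υ (chartAt E₁ x x) :
        E₁ [⋀^Fin k]→L[ℝ] ℝ) u = υ ((chartAt E₁ x).symm (chartAt E₁ x x))
        (fun i => mD E₁ E₁ (chartAt E₁ x).symm (chartAt E₁ x x) (u i)) := rfl
    rw [h2, h1, (chartAt E₁ x).left_inv (mem_chart_source E₁ x)]
    rfl
  refine ContinuousAlternatingMap.ext fun (u : Fin k → E₁) => ?_
  refine (key σ u).symm.trans (Eq.trans ?_ (key τ u))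
  exact DFunLike.congr_fun (F := E₁ [⋀^Fin k]→L[ℝ] ℝ) h u

theorem differentiable_oneForm {V : Type*} [NormedAddCommGroup V] [NormedSpace ℝ V]
    {W : Type*} [NormedAddCommGroup W] [NormedSpace ℝ W] {a : V → W →L[ℝ] ℝ}
    (ha : Differentiable ℝ a) : Differentiable ℝ (fun z => oneForm W (a z)) :=
  (oneForm W).differentiable.comp ha

theorem differentiableAt_formInChart_tautologicalForm
    {F : Type*} [NormedAddCommGroup F] [NormedSpace ℝ F]
    {Q : Type*} [TopologicalSpace Q] [ChartedSpace F Q] [IsManifold 𝓘(ℝ, F) ∞ Q]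
    (x : Cotangent F Q) :
    DifferentiableAt ℝ (formInChart _ (tautologicalForm F Q) x)
      (extChartAt (𝓘(ℝ, F).prod 𝓘(ℝ, F →L[ℝ] ℝ)) x x) := by
  have h1 : Differentiable ℝ (fun z : F × (F →L[ℝ] ℝ) =>
      oneForm (F × (F →L[ℝ] ℝ)) (z.2 ∘L ContinuousLinearMap.fst ℝ F (F →L[ℝ] ℝ))) :=
    have h0 : Differentiable ℝ (fun z : F × (F →L[ℝ] ℝ) =>
        z.2 ∘L ContinuousLinearMap.fst ℝ F (F →L[ℝ] ℝ)) := by fun_prop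
    differentiable_oneForm h0
  refine (h1 _).congr_of_eventuallyEq ?_
  filter_upwards [(isOpen_extChartAt_target x).mem_nhds (mem_extChartAt_target x)] with z hz
  exact formInChart_tautologicalForm x hz

variable {E : Type*} [NormedAddCommGroup E] [NormedSpace ℝ E] [FiniteDimensional ℝ E]
  {Γ : Type*} [TopologicalSpace Γ] [ChartedSpace E Γ] [Group Γ] [LieGroup 𝓘(ℝ, E) ∞ Γ]
  {F : Type*} [NormedAddCommGroup F] [NormedSpace ℝ F] [FiniteDimensional ℝ F]
  {Γ₀ : Subgroup Γ} [ChartedSpace F (Γ ⧸ Γ₀)] [IsManifold 𝓘(ℝ, F) ∞ (Γ ⧸ Γ₀)]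
  {β₀ : LieDual E Γ}
  {n : ℕ} [ChartedSpace (EuclideanSpace ℝ (Fin n)) (Orbit β₀)] [IsManifold (𝓡 n) ∞ (Orbit β₀)]
  {n' : ℕ} [ChartedSpace (EuclideanSpace ℝ (Fin n')) (Orbit' Γ₀ β₀)]
  [IsManifold (𝓡 n') ∞ (Orbit' Γ₀ β₀)]
  {m : ℕ} [ChartedSpace (EuclideanSpace ℝ (Fin m)) (OrbitQuotient Γ₀ β₀)]
  [IsManifold (𝓡 m) ∞ (OrbitQuotient Γ₀ β₀)]
  {l : ℕ} [ChartedSpace (EuclideanSpace ℝ (Fin l)) (MomentumLevel F Γ₀ β₀)]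
  [IsManifold (𝓡 l) ∞ (MomentumLevel F Γ₀ β₀)]
  {ωO : DiffForm (𝓡 n) (Orbit β₀) 2} {ω₁ : DiffForm (𝓡 m) (OrbitQuotient Γ₀ β₀) 2}

/-- The tautological form, pulled back along a map to the level set, is the pullback of the
right-invariant one-form `β₀` along a lift to `Γ`. -/
theorem pullback_tautologicalForm
    {E₁ : Type*} [NormedAddCommGroup E₁] [NormedSpace ℝ E₁]
    (hq : IsSubmersion 𝓘(ℝ, E) 𝓘(ℝ, F) ∞ (QuotientGroup.mk : Γ → Γ ⧸ Γ₀))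
    {s : Γ ⧸ Γ₀ → Γ} {U : Set (Γ ⧸ Γ₀)} (hU : IsOpen U) (hfs : ∀ q ∈ U, (s q : Γ ⧸ Γ₀) = q)
    (hs : ContMDiffOn 𝓘(ℝ, F) 𝓘(ℝ, E) ∞ s U) {f : E₁ → MomentumLevel F Γ₀ β₀} {w : E₁}
    (hf : MDifferentiableAt 𝓘(ℝ, E₁) (𝓘(ℝ, F).prod 𝓘(ℝ, F →L[ℝ] ℝ)) (fun w => (f w).1) w)
    (hw : (f w).1.proj ∈ U) :
    pullback 𝓘(ℝ, E₁) (𝓘(ℝ, F).prod 𝓘(ℝ, F →L[ℝ] ℝ)) (fun w => (f w).1)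
      (tautologicalForm F (Γ ⧸ Γ₀)) w =
      oneForm E₁ (dualOf β₀ ∘L maurerCartan (E := E) (fun w => s (f w).1.proj) w) := by
  let J := 𝓘(ℝ, F).prod 𝓘(ℝ, F →L[ℝ] ℝ)
  let Dproj : F × (F →L[ℝ] ℝ) →L[ℝ] F :=
    mfderiv J 𝓘(ℝ, F) (fun y : Cotangent F (Γ ⧸ Γ₀) => y.proj) (f w).1
  let Df : E₁ →L[ℝ] F × (F →L[ℝ] ℝ) := mfderiv 𝓘(ℝ, E₁) J (fun w => (f w).1) w
  have hproj := mdifferentiable_cotangent_proj F (Γ ⧸ Γ₀) (f w).1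
  have h1 : mD E₁ F (fun w => (f w).1.proj) w = Dproj ∘L Df := mfderiv_comp w hproj hf
  have h2 : mD E₁ E (fun w => s (f w).1.proj) w =
      mD F E s (f w).1.proj ∘L mD E₁ F (fun w => (f w).1.proj) w :=
    mD_comp ((hs.contMDiffAt (hU.mem_nhds hw)).mdifferentiableAt (by simp))
      (MDifferentiableAt.comp w hproj hf)
  -- The fibre component depends on the base point, so it is extracted from the equality of bundle
  -- points by destructuring `x`.
  have hsnd : ∀ (x : Cotangent F (Γ ⧸ Γ₀)) (P : Γ ⧸ Γ₀ → F →L[ℝ] ℝ),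
      x = ⟨x.proj, P x.proj⟩ → (x.2 : F →L[ℝ] ℝ) = P x.proj := by
    rintro ⟨q, p⟩ P h
    exact eq_of_heq (Bundle.TotalSpace.mk.inj h).2
  have h3 := hsnd _ (sectionCovector (dualOf β₀) s)
    (val_eq_sectionCovector hq hU hfs hs (f w) hw)
  refine ContinuousAlternatingMap.ext fun (v : Fin 1 → E₁) => ?_
  have h5 : ((f w).1.2 : F →L[ℝ] ℝ) (Dproj (Df (v 0))) =
      dualOf β₀ (rho E (s (f w).1.proj) (mD E₁ E (fun w => s (f w).1.proj) w (v 0))) := by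
    rw [h3, h2, h1]
    rfl
  exact h5

/-- The reduced form pulls back to the restriction of the canonical symplectic form. -/
theorem pullback_toOrbitQuotient_eq_canonicalForm
    (hq : IsSubmersion 𝓘(ℝ, E) 𝓘(ℝ, F) ∞ (QuotientGroup.mk : Γ → Γ ⧸ Γ₀))
    (hπ : IsSubmersion 𝓘(ℝ, E) (𝓡 n) ∞ (orbitMap β₀))
    (he : IsSmoothEmbedding (𝓡 n') (𝓡 n) ∞ (Subtype.val : Orbit' Γ₀ β₀ → Orbit β₀))
    (hsub : IsSubmersion (𝓡 n') (𝓡 m) ∞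
      (orbitQuotientMk : Orbit' Γ₀ β₀ → OrbitQuotient Γ₀ β₀)) (hK : IsKirillovForm ωO)
    (hω : pullback (𝓡 n') (𝓡 m) (orbitQuotientMk : Orbit' Γ₀ β₀ → OrbitQuotient Γ₀ β₀) ω₁ =
        pullback (𝓡 n') (𝓡 n) (Subtype.val : Orbit' Γ₀ β₀ → Orbit β₀) ωO)
    (hv : IsSmoothEmbedding (𝓡 l) (𝓘(ℝ, F).prod 𝓘(ℝ, F →L[ℝ] ℝ)) ∞
        (Subtype.val : MomentumLevel F Γ₀ β₀ → Cotangent F (Γ ⧸ Γ₀)))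
    (hp : IsSmoothEmbedding (𝓡 l) 𝓘(ℝ, F) ∞ (fun x : MomentumLevel F Γ₀ β₀ => x.1.proj)) :
    pullback (𝓡 l) (𝓡 m) (toOrbitQuotient hq : MomentumLevel F Γ₀ β₀ → _) ω₁ =
      pullback (𝓡 l) (𝓘(ℝ, F).prod 𝓘(ℝ, F →L[ℝ] ℝ))
        (Subtype.val : MomentumLevel F Γ₀ β₀ → Cotangent F (Γ ⧸ Γ₀))
        (canonicalForm F (Γ ⧸ Γ₀)) := by
  have : IsManifold 𝓘(ℝ, E) ∞ Γ := isManifold_group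
  let E₁ := EuclideanSpace ℝ (Fin l)
  funext x
  refine eq_of_pullback_chartAt_symm_eq (E₁ := E₁) ?_
  set χ := chartAt E₁ x
  have hxs : x ∈ χ.source := mem_chart_source E₁ x
  have hxt : χ x ∈ χ.target := χ.map_source hxs
  have hχ : ContMDiffOn 𝓘(ℝ, E₁) (𝓡 l) ∞ χ.symm χ.target := contMDiffOn_chartAt_symm' x
  have hχd : MDifferentiableAt 𝓘(ℝ, E₁) (𝓡 l) χ.symm (χ x) :=
    (hχ.contMDiffAt (χ.open_target.mem_nhds hxt)).mdifferentiableAt (by simp)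
  obtain ⟨γ, hγ⟩ := QuotientGroup.mk_surjective x.1.proj
  obtain ⟨s, U, hU, hqU, -, hfs, hs⟩ := exists_local_section hq γ
  rw [hγ] at hqU
  have hpf : ContMDiffOn 𝓘(ℝ, E₁) 𝓘(ℝ, F) ∞ (fun w => (χ.symm w).1.proj) χ.target :=
    hp.contMDiff.comp_contMDiffOn hχ
  have hvf : ContMDiffOn 𝓘(ℝ, E₁) (𝓘(ℝ, F).prod 𝓘(ℝ, F →L[ℝ] ℝ)) ∞
      (fun w => (χ.symm w).1) χ.target := hv.contMDiff.comp_contMDiffOn hχ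
  have hV : IsOpen (χ.target ∩ (fun w => (χ.symm w).1.proj) ⁻¹' U) :=
    hpf.continuousOn.isOpen_inter_preimage χ.open_target hU
  have hxV : χ x ∈ χ.target ∩ (fun w => (χ.symm w).1.proj) ⁻¹' U :=
    ⟨hxt, by rw [mem_preimage, χ.left_inv hxs]; exact hqU⟩
  have hc : ContMDiffOn 𝓘(ℝ, E₁) 𝓘(ℝ, E) ∞ (fun w => s (χ.symm w).1.proj)
      (χ.target ∩ (fun w => (χ.symm w).1.proj) ⁻¹' U) :=
    hs.comp (hpf.mono inter_subset_left) fun w hw => hw.2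
  have h1 := pullback_comp (I := 𝓘(ℝ, E₁)) (I' := 𝓡 l) (I'' := 𝓡 m)
    (g := (toOrbitQuotient hq : MomentumLevel F Γ₀ β₀ → _)) (f := χ.symm) (x := χ x)
    ((contMDiff_toOrbitQuotient hq hπ he hsub hp).mdifferentiableAt (by simp)) hχd ω₁
  have h2 := pullback_comp (I := 𝓘(ℝ, E₁)) (I' := 𝓡 l) (I'' := 𝓘(ℝ, F).prod 𝓘(ℝ, F →L[ℝ] ℝ))
    (g := (Subtype.val : MomentumLevel F Γ₀ β₀ → Cotangent F (Γ ⧸ Γ₀))) (f := χ.symm) (x := χ x)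
    (hv.contMDiff.mdifferentiableAt (by simp)) hχd (canonicalForm F (Γ ⧸ Γ₀))
  refine h1.symm.trans (Eq.trans ?_ h2)
  -- In a chart of the level set both sides are the exterior derivative of `β₀` composed with the
  -- Maurer-Cartan form of the same lift `w ↦ s((χ.symm w).1.proj)`.
  have h3 := pullback_reduced_kirillovForm hq hπ he hsub hK hω
    (f := fun w => toOrbitQuotient hq (χ.symm w)) hV hc
    (fun w hw => ⟨resLie_coAdL_of_momentumMap_eq hq (hfs _ hw.2).symm (χ.symm w).2,
      toOrbitQuotient_eq hq _ (hfs _ hw.2).symm _⟩) hxV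
  have h4 := pullback_formDeriv (σ := tautologicalForm F (Γ ⧸ Γ₀)) χ.open_target hvf hxt
    (differentiableAt_formInChart_tautologicalForm _)
  have h5 : (pullback 𝓘(ℝ, E₁) (𝓘(ℝ, F).prod 𝓘(ℝ, F →L[ℝ] ℝ)) (fun w => (χ.symm w).1)
      (tautologicalForm F (Γ ⧸ Γ₀)) : E₁ → E₁ [⋀^Fin 1]→L[ℝ] ℝ) =ᶠ[𝓝 (χ x)] fun w =>
      oneForm E₁ (dualOf β₀ ∘L maurerCartan (E := E) (fun w => s (χ.symm w).1.proj) w) := by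
    filter_upwards [hV.mem_nhds hxV] with w hw
    exact pullback_tautologicalForm hq hU hfs hs (f := χ.symm)
      ((hvf.contMDiffAt (χ.open_target.mem_nhds hw.1)).mdifferentiableAt (by simp)) hw.2
  rw [h5.extDeriv_eq] at h4
  exact h3.trans h4.symm

end CanonicalForm


/-! ### Transport of symplectic forms by diffeomorphisms. -/

section Transport

open Module Manifold Topology

variable {V : Type*} [NormedAddCommGroup V] [NormedSpace ℝ V]
  {M : Type*} [TopologicalSpace M] [ChartedSpace V M] [IsManifold 𝓘(ℝ, V) ∞ M]
  {N : Type*} [TopologicalSpace N] [ChartedSpace V N] [IsManifold 𝓘(ℝ, V) ∞ N]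

/-- The pullback by a diffeomorphism of a nondegenerate form whose pullbacks to vector spaces are
locally exact is symplectic. -/
theorem isSymplecticForm_pullback_of_locally_exact {σ : DiffForm 𝓘(ℝ, V) N 2}
    (φ : Diffeomorph 𝓘(ℝ, V) 𝓘(ℝ, V) M N ∞)
    (h : ∀ (f : V → N) (O : Set V), IsOpen O → ContMDiffOn 𝓘(ℝ, V) 𝓘(ℝ, V) ∞ f O → ∀ w ∈ O,
      ∃ (U : Set V) (α : V → V [⋀^Fin 1]→L[ℝ] ℝ), IsOpen U ∧ w ∈ U ∧ U ⊆ O ∧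
        ContDiffOn ℝ ∞ α U ∧ ∀ w' ∈ U, pullback 𝓘(ℝ, V) 𝓘(ℝ, V) f σ w' = extDeriv α w')
    (hnd : ∀ (y : N) (u : V), (∀ v : V, σ y ![u, v] = 0) → u = 0) :
    IsSymplecticForm 𝓘(ℝ, V) (pullback 𝓘(ℝ, V) 𝓘(ℝ, V) φ σ) := by
  refine isSymplecticForm_of_locally_exact (fun x₀ w hw => ?_) fun x u hu => ?_
  · have hs := contMDiffOn_extChartAt_symm_infty (I := 𝓘(ℝ, V)) x₀
    obtain ⟨U, α, hU, hwU, hUO, hα, hf⟩ := h (fun w => φ ((extChartAt 𝓘(ℝ, V) x₀).symm w)) _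
      (isOpen_extChartAt_target x₀) (φ.contMDiff.comp_contMDiffOn hs) w hw
    refine ⟨U, α, hU, hwU, hα, fun w' hw' => ?_⟩
    rw [← hf w' hw']
    exact (pullback_comp (I' := 𝓘(ℝ, V)) (φ.contMDiff.mdifferentiableAt (by simp))
      ((hs.contMDiffAt ((isOpen_extChartAt_target x₀).mem_nhds (hUO hw'))).mdifferentiableAt
        (by simp)) σ).symm
  · have h1 : ∀ v : V, mD V V φ.symm (φ x) (mD V V φ x v) = v := fun v => by
      have h2 := mD_comp_apply (E := V) (E' := V) (E'' := V) (g := φ.symm) (f := φ) (x := x)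
        (φ.symm.contMDiff.mdifferentiableAt (by simp)) (φ.contMDiff.mdifferentiableAt (by simp)) v
      rw [← h2, show (fun x => φ.symm (φ x)) = fun x => x from funext φ.symm_apply_apply, mD_id]
      rfl
    have h3 : ∀ v : V, mD V V φ x (mD V V φ.symm (φ x) v) = v := fun v => by
      have hd : MDifferentiableAt 𝓘(ℝ, V) 𝓘(ℝ, V) φ (φ.symm (φ x)) :=
        φ.contMDiff.mdifferentiableAt (by simp)
      have h2 := mD_comp_apply (E := V) (E' := V) (E'' := V) (g := φ) (f := φ.symm) (x := φ x)
        hd (φ.symm.contMDiff.mdifferentiableAt (by simp)) v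
      rw [φ.symm_apply_apply] at h2
      rw [← h2, show (fun y => φ (φ.symm y)) = fun y => y from funext φ.apply_symm_apply, mD_id]
      rfl
    have h4 : mD V V φ x u = 0 := by
      refine hnd (φ x) _ fun v => ?_
      have h5 := hu (mD V V φ.symm (φ x) v)
      let τ : N → V [⋀^Fin 2]→L[ℝ] ℝ := σ
      have h6 : τ (φ x) (fun i => mD V V φ x ((![u, mD V V φ.symm (φ x) v] : Fin 2 → V) i)) = 0 :=
        h5
      rw [eq_vecCons_two (fun i => mD V V φ x ((![u, mD V V φ.symm (φ x) v] : Fin 2 → V) i))] at h6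
      have h7 : τ (φ x) ![mD V V φ x u, mD V V φ x (mD V V φ.symm (φ x) v)] = 0 := h6
      rw [h3] at h7
      exact h7
    have h8 := h1 u
    rw [h4, map_zero] at h8
    exact h8.symm

end Transport

end CoadjointReduction

end

/-! ### Assembly of the reduction theorem. -/

theorem theorem5
    {E : Type*} [NormedAddCommGroup E] [NormedSpace ℝ E] [FiniteDimensional ℝ E]
    {Γ : Type*} [TopologicalSpace Γ] [T2Space Γ] [SecondCountableTopology Γ]
    [ChartedSpace E Γ] [Group Γ] [LieGroup 𝓘(ℝ, E) ∞ Γ]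
    (Γ₀ : Subgroup Γ) (hΓ₀ : IsClosed (Γ₀ : Set Γ))
    {F : Type*} [NormedAddCommGroup F] [NormedSpace ℝ F] [FiniteDimensional ℝ F]
    [ChartedSpace F (Γ ⧸ Γ₀)] [IsManifold 𝓘(ℝ, F) ∞ (Γ ⧸ Γ₀)]
    (hquot : Manifold.IsSubmersion 𝓘(ℝ, E) 𝓘(ℝ, F) ∞ (QuotientGroup.mk : Γ → Γ ⧸ Γ₀))
    (β₀ : LieDual E Γ)
    (htrans : IsTransversal Γ₀ β₀)
    (hfree : IsFreeAction Γ₀ β₀)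
    (hproper : IsProperAction Γ₀ β₀) :
    -- the coadjoint orbit `O` as a manifold, and its Kirillov form
    ∃ (n : ℕ) (_ : ChartedSpace (EuclideanSpace ℝ (Fin n)) (Orbit β₀))
      (_ : IsManifold (𝓡 n) ∞ (Orbit β₀)) (ωO : DiffForm (𝓡 n) (Orbit β₀) 2),
      Manifold.IsSubmersion 𝓘(ℝ, E) (𝓡 n) ∞ (orbitMap β₀) ∧ IsKirillovForm ωO ∧
    -- `O'` as a submanifold of `O`
    ∃ (n' : ℕ) (_ : ChartedSpace (EuclideanSpace ℝ (Fin n')) (Orbit' Γ₀ β₀))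
      (_ : IsManifold (𝓡 n') ∞ (Orbit' Γ₀ β₀)),
      Manifold.IsSmoothEmbedding (𝓡 n') (𝓡 n) ∞ (Subtype.val : Orbit' Γ₀ β₀ → Orbit β₀) ∧
    -- the quotient manifold `O' / Ad^*_{Γ₀}` with the form induced by the Kirillov form
    ∃ (m : ℕ) (_ : ChartedSpace (EuclideanSpace ℝ (Fin m)) (OrbitQuotient Γ₀ β₀))
      (_ : IsManifold (𝓡 m) ∞ (OrbitQuotient Γ₀ β₀)) (ω₁ : DiffForm (𝓡 m) (OrbitQuotient Γ₀ β₀) 2),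
      T2Space (OrbitQuotient Γ₀ β₀) ∧ SecondCountableTopology (OrbitQuotient Γ₀ β₀) ∧
      Manifold.IsSubmersion (𝓡 n') (𝓡 m) ∞ (Quot.mk _ : Orbit' Γ₀ β₀ → OrbitQuotient Γ₀ β₀) ∧
      pullback (𝓡 n') (𝓡 m) (Quot.mk _ : Orbit' Γ₀ β₀ → OrbitQuotient Γ₀ β₀) ω₁ =
        pullback (𝓡 n') (𝓡 n) (Subtype.val : Orbit' Γ₀ β₀ → Orbit β₀) ωO ∧
      IsSymplecticForm (𝓡 m) ω₁ ∧
    -- the level set of the momentum map as a submanifold of the cotangent bundle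
    ∃ (l : ℕ) (_ : ChartedSpace (EuclideanSpace ℝ (Fin l)) (MomentumLevel F Γ₀ β₀))
      (_ : IsManifold (𝓡 l) ∞ (MomentumLevel F Γ₀ β₀)),
      Manifold.IsSmoothEmbedding (𝓡 l) (𝓘(ℝ, F).prod 𝓘(ℝ, F →L[ℝ] ℝ)) ∞
        (Subtype.val : MomentumLevel F Γ₀ β₀ → Cotangent F (Γ ⧸ Γ₀)) ∧
    -- the reduced space as a quotient manifold with its reduced symplectic form
    ∃ (r : ℕ) (_ : ChartedSpace (EuclideanSpace ℝ (Fin r)) (ReducedSpace F Γ₀ β₀))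
      (_ : IsManifold (𝓡 r) ∞ (ReducedSpace F Γ₀ β₀)) (ω₂ : DiffForm (𝓡 r) (ReducedSpace F Γ₀ β₀) 2),
      T2Space (ReducedSpace F Γ₀ β₀) ∧ SecondCountableTopology (ReducedSpace F Γ₀ β₀) ∧
      Manifold.IsSubmersion (𝓡 l) (𝓡 r) ∞
        (Quot.mk _ : MomentumLevel F Γ₀ β₀ → ReducedSpace F Γ₀ β₀) ∧
      pullback (𝓡 l) (𝓡 r) (Quot.mk _ : MomentumLevel F Γ₀ β₀ → ReducedSpace F Γ₀ β₀) ω₂ =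
        pullback (𝓡 l) (𝓘(ℝ, F).prod 𝓘(ℝ, F →L[ℝ] ℝ))
          (Subtype.val : MomentumLevel F Γ₀ β₀ → Cotangent F (Γ ⧸ Γ₀))
          (canonicalForm F (Γ ⧸ Γ₀)) ∧
      IsSymplecticForm (𝓡 r) ω₂ ∧
    -- the symplectomorphism
    ∃ φ : Diffeomorph (𝓡 r) (𝓡 m) (ReducedSpace F Γ₀ β₀) (OrbitQuotient Γ₀ β₀) ∞,
      pullback (𝓡 r) (𝓡 m) φ ω₁ = ω₂ := by
  have hman : IsManifold 𝓘(ℝ, E) ∞ Γ := isManifold_group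
  obtain ⟨csO, hmO, hπ⟩ := exists_orbit_manifold β₀
  obtain ⟨ωO, hK⟩ := exists_isKirillovForm hπ
  obtain ⟨csG, hmG, hi, hinj, hisurj⟩ := exists_subgroup_manifold Γ₀ hquot rfl
  obtain ⟨csO', hmO', he, heinj, hesurj⟩ :=
    exists_levelOrbit_manifold Γ₀ hquot hπ htrans rfl
  obtain ⟨csY, hmY, hT2, hsub⟩ :=
    exists_orbitQuotient_manifold hquot hπ htrans hfree hproper he hi hinj rfl
  obtain ⟨ω₁, hω⟩ := exists_reduced_kirillovForm hquot hπ htrans he hi hinj rfl hsub hK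
  obtain ⟨l, csM, hmM, hv, hp⟩ := exists_momentumLevel_manifold F Γ₀ hquot htrans
  obtain ⟨csR, hmR, hRsub, φ, hφ⟩ := exists_reducedSpace_manifold hquot hπ he hsub hp
  have hscO : SecondCountableTopology (Orbit β₀) :=
    isOpenQuotientMap_orbitMap.isQuotientMap.secondCountableTopology
      isOpenQuotientMap_orbitMap.isOpenMap
  have hscO' : SecondCountableTopology (Orbit' Γ₀ β₀) :=
    Topology.IsEmbedding.subtypeVal.secondCountableTopology
  have hYq := isOpenQuotientMap_orbitQuotientMk (Γ₀ := Γ₀) (β₀ := β₀) fun σ =>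
    (contMDiff_coAd'_left hπ he hi σ).continuous
  have hscY : SecondCountableTopology (OrbitQuotient Γ₀ β₀) :=
    hYq.isQuotientMap.secondCountableTopology hYq.isOpenMap
  have hnd := nondegenerate_reduced_kirillovForm hquot hπ rfl htrans he heinj hesurj hi hinj hisurj
    rfl hsub hK hω
  have hω₁ : IsSymplecticForm _ ω₁ := isSymplecticForm_of_locally_exact (fun x₀ w hw => by
    obtain ⟨U, α, hU, hwU, -, hα, hf⟩ := exists_pullback_eq_extDeriv hquot hπ he hsub hK hω
      (isOpen_extChartAt_target x₀) (contMDiffOn_extChartAt_symm_infty x₀) hw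
    exact ⟨U, α, hU, hwU, hα, hf⟩) hnd
  -- The reduced form is taken to be the pullback of `ω₁` by `φ`, so the symplectomorphism property
  -- is definitional and the content lies in identifying its pullback to the level set with the
  -- canonical form.
  refine ⟨_, csO, hmO, ωO, hπ, hK, _, csO', hmO', he, _, csY, hmY, ω₁, hT2, hscY, hsub, hω, hω₁,
    l, csM, hmM, hv, _, csR, hmR, pullback _ _ φ ω₁, φ.toHomeomorph.symm.t2Space,
    φ.toHomeomorph.secondCountableTopology, hRsub, ?_,
    isSymplecticForm_pullback_of_locally_exact φ (fun f O hO hf w hw =>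
      exists_pullback_eq_extDeriv hquot hπ he hsub hK hω hO hf hw) hnd, φ, rfl⟩
  rw [← pullback_toOrbitQuotient_eq_canonicalForm hquot hπ he hsub hK hω hv hp]
  funext x
  rw [← pullback_comp (φ.contMDiff.mdifferentiableAt (by simp))
    (hRsub.contMDiff.mdifferentiableAt (by simp))]
  simp only [hφ]
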